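/- Let $\mathbb K$ be $\mathbb R$ or $\mathbb C$. A *hemistrict Lie 2-algebra* $L$ is a complex $d\colon L^{-1}\to L^0$ of $\mathbb K$-vector spaces with a cochain map $[-,-]\colon L\otimes L\to L$ satisfying the left Leibniz rule $[x,[y,z]]=[[x,y],z]+(-1)^{|x||y|}[y,[x,z]]$ and a symmetric bilinear map $h_2\colon L^0\times L^0\to L^{-1}$ such that $[x,y]+[y,x]=dh_2(x,y)$, $[x,\alpha]+[\alpha,x]=h_2(x,d\alpha)$, $[h_2(x,y),z]=0$ and $[x,h_2(y,z)]=h_2([x,y],z)+h_2(y,[x,z])$ for $x,y,z\in L^0$, $\alpha\in L^{-1}$. It is *injective* if $d$ is injective. A *representation* $V=(\vec V,l,r,h_v)$ of $L$ on a complex $\vec V=(d\colon V^{-1}\to V^0)$ consists of cochain maps $l\colon L\otimes \vec V\to \vec V$, $r\colon \vec V\otimes L\to \vec V$ and a bilinear map $h_v\colon L^0\times V^0\to V^{-1}$ such that $l_xl_y-(-1)^{|x||y|}l_yl_x=l_{[x,y]}$; $l(x,v)+r(v,x)=dh_v(x,v)$, $l(x,u)+r(u,x)=h_v(x,du)$,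 $l(\alpha,v)+r(v,\alpha)=h_v(d\alpha,v)$; $r(h_v(x,v),y)=0$, $l(h_2(x,y),v)=0$ and $l(x,h_v(y,v))=h_v([x,y],v)+h_v(y,l(x,v))$, for $x,y\in L^0$, $\alpha\in L^{-1}$, $v\in V^0$, $u\in V^{-1}$. *The standard complex.* $C^n(L,V)$, $n\ge -1$, consists of the families $\omega=(\omega^{(p)}_k)$, $p\in\{-1,0\}$, $0\le k\le\frac{n-p}{2}$, of multilinear maps $\omega_k^{(p)}(x_1,\dots,x_m\mid\alpha_1,\dots,\alpha_k)\in V^p$ with $m=n-p-2k$, $x_i\in L^0$, $\alpha_j\in L^{-1}$, symmetric in the $\alpha$'s, with $$\omega^{(p)}_k(\dots,x_i,x_{i+1},\dots\mid\alpha)+\omega^{(p)}_k(\dots,x_{i+1},x_i,\dots\mid\alpha)=-\omega^{(p)}_{k+1}(\dots,\widehat{x_i},\widehat{x_{i+1}},\dots\mid h_2(x_i,x_{i+1}),\alpha).$$ The differential is $$\begin{aligned}(D\omega)^{(p)}_k(x_1,\dots,x_m\mid\alpha_1,\dots,\alpha_k)=&\sum_j\omega^{(p)}_{k-1}(d\alpha_j,x_1,\dots,x_m\mid\dots,\widehat{\alpha_j},\dots)+\sum_i(-1)^{i+1}l_{x_i}\omega^{(p)}_k(\dots,\widehat{x_i},\dots\mid\alpha)\\&+\sum_{i<j}(-1)^i\omega^{(p)}_k(\dots,\widehat{x_i},\dots,[x_i,x_j],\dots\mid\alpha)+\sum_{i,j}(-1)^{i+1}\omega^{(p)}_k(\dots,\widehat{x_i},\dots\mid\dots,[\alpha_j,x_i],\dots)+\epsilon^{(p)},\end{aligned}$$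 where $[x_i,x_j]$ and $[\alpha_j,x_i]$ take the places of $x_j$ and $\alpha_j$, $\epsilon^{(0)}=(-1)^m d\,\omega^{(-1)}_k(x\mid\alpha)$ and $\epsilon^{(-1)}=(-1)^{m+1}\sum_j l_{\alpha_j}\omega^{(0)}_{k-1}(x\mid\dots,\widehat{\alpha_j},\dots)$. Its cohomology is $H^\bullet(L,V)$. *The induced objects.* $L_{\mathrm{Lie}}=L^0/dL^{-1}$ is the Lie algebra with bracket induced by $[-,-]$. The skew-symmetrization $\tilde L$ is the semistrict Lie 2-algebra (2-term $L_\infty$-algebra) on $d\colon L^{-1}\to L^0$ with $$\tilde l_2(a,b)=\tfrac12\big([a,b]-(-1)^{|a||b|}[b,a]\big),\qquad \tilde l_3(x,y,z)=-\tfrac16\big(h_2(\tilde l_2(x,y),z)+h_2(\tilde l_2(y,z),x)+h_2(\tilde l_2(z,x),y)\big).$$ If $l_\alpha=0$ for all $\alpha\in L^{-1}$, then $l$ makes $\vec V$ a complex of $L_{\mathrm{Lie}}$-modules, and a representation of $\tilde L$. Let $H^\bullet_{\mathrm{CE}}(L_{\mathrm{Lie}},V)$ be the cohomology of the total Chevalley–Eilenberg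 complex whose degree $n$ part is $\mathrm{Hom}(\wedge^{n+1}L_{\mathrm{Lie}},V^{-1})\oplus\mathrm{Hom}(\wedge^{n}L_{\mathrm{Lie}},V^{0})$, with differential $d_V+d_{\mathrm{CE}}$. Let $H^\bullet(\tilde L,V)$ be the generalized Chevalley–Eilenberg cohomology of $\tilde L$: the degree $n$ part of the complex is $\bigoplus_{p+2q+r=n}\mathrm{Hom}(\wedge^pL^0\otimes S^qL^{-1},V^r)$, $r\in\{-1,0\}$, and the differential is the sum of $d_V$ and of the duals of $d$, $\tilde l_2$, $\tilde l_3$ and the action $l$ (for $\tilde l_3$: the sum over $i<j<s$, with the sign of the permutation moving $x_i,x_j,x_s$ to the front, of $\omega(\dots,\widehat{x_i},\dots,\widehat{x_j},\dots,\widehat{x_s},\dots\mid\tilde l_3(x_i,x_j,x_s),\alpha)$; the other terms as in $D$ above, with $\tilde l_2$ in place of $[-,-]$). **Theorem.** Let $L$ be an injective hemistrict Lie 2-algebra and $V=(\vec V,l,r,h_v)$ a representation of $L$ such that $l_\alpha=0$ for all $\alpha\in L^{-1}$. 1. If $h_2(d\alpha,d\beta)=0$ for all $\alpha,\beta\in L^{-1}$,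 then $H^n(L,V)\cong H^n_{\mathrm{CE}}(L_{\mathrm{Lie}},V)$ as vector spaces for every $n$. 2. $H^n(\tilde L,V)\cong H^n_{\mathrm{CE}}(L_{\mathrm{Lie}},V)$ as vector spaces for every $n$. -/

import Mathlib

/-! ### Cohomology of a graded family of submodules with a differential -/

section Generic

variable {𝕜 : Type*} [Field 𝕜]

/-- Given submodules `C n` (the homogeneous parts of a cochain complex) of one ambient space and the
differential `D` on that space, the `n`-th cohomology: cocycles of degree `n` modulo those of the
form `D η` with `η` a cochain of degree `n - 1`. -/
abbrev gradedCohomology {X : Type*} [AddCommGroup X] [Module 𝕜 X]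
    (C : ℤ → Submodule 𝕜 X) (D : X →ₗ[𝕜] X) (n : ℤ) : Type _ :=
  ↥(C n ⊓ LinearMap.ker D) ⧸
    ((C (n - 1)).map D).comap (C n ⊓ LinearMap.ker D).subtype

/-- Families `ω` of functions `ω m k (x₁, …, x_m ∣ α₁, …, α_k)` with values in `W`. -/
abbrev Family (X Y W : Type*) : Type _ := (m k : ℕ) → (Fin m → X) → (Fin k → Y) → W

variable {L₁ L₀ W W' : Type*} [AddCommGroup L₁] [Module 𝕜 L₁] [AddCommGroup L₀] [Module 𝕜 L₀]
  [AddCommGroup W] [Module 𝕜 W] [AddCommGroup W'] [Module 𝕜 W']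

variable (𝕜 L₁ L₀ W) in
/-- Families of maps `(L₀)^m × (L₁)^k → W` that are multilinear, symmetric in the arguments from
`L₁`, and of weight `w`: the component with `m` arguments from `L₀` and `k` arguments from `L₁`
vanishes unless `m + 2k = w`. -/
def multilinearFamilies (w : ℤ) : Submodule 𝕜 (Family L₀ L₁ W) where
  carrier := {ω |
    (∀ m k : ℕ, (m : ℤ) + 2 * k ≠ w → ω m k = 0) ∧
    (∀ m k : ℕ, ∃ F : MultilinearMap 𝕜 (fun _ : Fin m => L₀)
        (MultilinearMap 𝕜 (fun _ : Fin k => L₁) W), ∀ x α, ω m k x α = F x α) ∧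
    (∀ (m k : ℕ) (σ : Equiv.Perm (Fin k)) x α, ω m k x (α ∘ σ) = ω m k x α)}
  zero_mem' := ⟨fun _ _ _ => rfl, fun _ _ => ⟨0, fun _ _ => rfl⟩, fun _ _ _ _ _ => rfl⟩
  add_mem' := by
    rintro a b ⟨ha, ha', ha''⟩ ⟨hb, hb', hb''⟩
    refine ⟨fun m k h => by simp [ha m k h, hb m k h], fun m k => ?_, fun m k σ x α => ?_⟩
    · obtain ⟨F, hF⟩ := ha' m k
      obtain ⟨G, hG⟩ := hb' m k
      exact ⟨F + G, fun x α => by simp [hF, hG]⟩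
    · simp [ha'', hb'']
  smul_mem' := by
    rintro c a ⟨ha, ha', ha''⟩
    refine ⟨fun m k h => by simp [ha m k h], fun m k => ?_, fun m k σ x α => ?_⟩
    · obtain ⟨F, hF⟩ := ha' m k
      exact ⟨c • F, fun x α => by simp [hF]⟩
    · simp [ha'']

/-! The building blocks of the differentials.  All indices start at `0`; `i.removeNth x` omits the
`i`-th entry of `x`. -/

/-- `(x ∣ α) ↦ ∑ j, ω (d α_j, x₀, …, x_{m-1} ∣ α₀, …, omit α_j, …)`. -/
def insertTerm (d : L₁ →ₗ[𝕜] L₀) : Family L₀ L₁ W →ₗ[𝕜] Family L₀ L₁ W where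
  toFun ω
    | _, 0 => 0
    | m, k + 1 => fun x α => ∑ j : Fin (k + 1), ω (m + 1) k (Matrix.vecCons (d (α j)) x)
        (j.removeNth α)
  map_add' a b := by
    funext m k x α
    cases k
    · exact (add_zero _).symm
    · simp only [Pi.add_apply, Finset.sum_add_distrib]
  map_smul' c a := by
    funext m k x α
    cases k
    · exact (smul_zero c).symm
    · simp only [Pi.smul_apply, Finset.smul_sum, RingHom.id_apply]

/-- `(x ∣ α) ↦ ∑ i, (-1)^i l(x_i, ω (x₀, …, omit x_i, … ∣ α))`. -/
def actionTerm (l : L₀ →ₗ[𝕜] W →ₗ[𝕜] W) : Family L₀ L₁ W →ₗ[𝕜] Family L₀ L₁ W where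
  toFun ω
    | 0, _ => 0
    | m + 1, k => fun x α => ∑ i : Fin (m + 1), (-1 : 𝕜) ^ (i : ℕ) •
        l (x i) (ω m k (i.removeNth x) α)
  map_add' a b := by
    funext m k x α
    cases m
    · exact (add_zero _).symm
    · simp only [Pi.add_apply, map_add, smul_add, Finset.sum_add_distrib]
  map_smul' c a := by
    funext m k x α
    cases m
    · exact (smul_zero c).symm
    · simp only [Pi.smul_apply, map_smul, Finset.smul_sum, smul_comm c, RingHom.id_apply]

/-- `(x ∣ α) ↦ ∑ i < j, (-1)^(i+1) ω (x₀, …, omit x_i, …, x_{j-1}, b(x_i, x_j), x_{j+1}, … ∣ α)`: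
the entry `x_i` is omitted and `x_j` is replaced by `b(x_i, x_j)`. -/
def bracketTerm (b : L₀ →ₗ[𝕜] L₀ →ₗ[𝕜] L₀) : Family L₀ L₁ W →ₗ[𝕜] Family L₀ L₁ W where
  toFun ω
    | 0, _ => 0
    | m + 1, k => fun x α => ∑ i : Fin (m + 1), ∑ j ∈ Finset.Ioi i, (-1 : 𝕜) ^ ((i : ℕ) + 1) •
        ω m k (i.removeNth (Function.update x j (b (x i) (x j)))) α
  map_add' a b := by
    funext m k x α
    cases m
    · exact (add_zero _).symm
    · simp only [Pi.add_apply, smul_add, Finset.sum_add_distrib]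
  map_smul' c a := by
    funext m k x α
    cases m
    · exact (smul_zero c).symm
    · simp only [Pi.smul_apply, Finset.smul_sum, smul_comm c, RingHom.id_apply]

/-- `(x ∣ α) ↦ ∑ i, ∑ j, (-1)^i ω (x₀, …, omit x_i, … ∣ α₀, …, c(α_j, x_i), …)`. -/
def mixedBracketTerm (c : L₁ →ₗ[𝕜] L₀ →ₗ[𝕜] L₁) : Family L₀ L₁ W →ₗ[𝕜] Family L₀ L₁ W where
  toFun ω
    | 0, _ => 0
    | m + 1, k => fun x α => ∑ i : Fin (m + 1), ∑ j : Fin k, (-1 : 𝕜) ^ (i : ℕ) •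
        ω m k (i.removeNth x) (Function.update α j (c (α j) (x i)))
  map_add' a b := by
    funext m k x α
    cases m
    · exact (add_zero _).symm
    · simp only [Pi.add_apply, smul_add, Finset.sum_add_distrib]
  map_smul' c a := by
    funext m k x α
    cases m
    · exact (smul_zero c).symm
    · simp only [Pi.smul_apply, Finset.smul_sum, smul_comm c, RingHom.id_apply]

/-- The term dual to a 3-bracket:
`(x ∣ α) ↦ ∑ ± ω (x with three entries omitted ∣ t(the three entries), α)`, where the sum is over
the three-element subsets of the entries of `x`, taken in increasing order, and `±` is the sign of
the permutation that moves these entries to the front.  The indices `i ≤ j ≤ r` are counted after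
the preceding omissions. -/
def tripleBracketTerm (t : L₀ →ₗ[𝕜] L₀ →ₗ[𝕜] L₀ →ₗ[𝕜] L₁) :
    Family L₀ L₁ W →ₗ[𝕜] Family L₀ L₁ W where
  toFun ω
    | m + 3, k => fun x α => ∑ i : Fin (m + 3), ∑ j : Fin (m + 2), ∑ r : Fin (m + 1),
        if (i : ℕ) ≤ j ∧ (j : ℕ) ≤ r then
          (-1 : 𝕜) ^ ((i : ℕ) + j + r) •
            ω m (k + 1) (r.removeNth (j.removeNth (i.removeNth x)))
              (Matrix.vecCons (t (x i) (i.removeNth x j) (j.removeNth (i.removeNth x) r)) α)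
        else 0
    | 0, _ => 0
    | 1, _ => 0
    | 2, _ => 0
  map_add' a b := by
    funext m k x α
    rcases m with _ | _ | _ | m
    iterate 3 exact (add_zero _).symm
    simp only [Pi.add_apply, smul_add, ite_add_zero, Finset.sum_add_distrib]
  map_smul' c a := by
    funext m k x α
    rcases m with _ | _ | _ | m
    iterate 3 exact (smul_zero c).symm
    simp only [Pi.smul_apply, Finset.smul_sum, smul_comm c, smul_ite, smul_zero, RingHom.id_apply]

/-- `(x ∣ α) ↦ (-1)^m dV (ω (x ∣ α))`, where `m` is the number of arguments from `L₀`. -/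
def coefficientTerm (dV : W →ₗ[𝕜] W') : Family L₀ L₁ W →ₗ[𝕜] Family L₀ L₁ W' where
  toFun ω m k x α := (-1 : 𝕜) ^ m • dV (ω m k x α)
  map_add' a b := by
    funext m k x α
    simp
  map_smul' c a := by
    funext m k x α
    simp [smul_comm c]

/-- `(x ∣ α) ↦ (-1)^(m+1) ∑ j, l(α_j, ω (x ∣ α₀, …, omit α_j, …))`, where `m` is the number of
arguments from `L₀`. -/
def oddActionTerm (l : L₁ →ₗ[𝕜] W →ₗ[𝕜] W') : Family L₀ L₁ W →ₗ[𝕜] Family L₀ L₁ W' where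
  toFun ω
    | _, 0 => 0
    | m, k + 1 => fun x α => (-1 : 𝕜) ^ (m + 1) • ∑ j : Fin (k + 1),
        l (α j) (ω m k x (j.removeNth α))
  map_add' a b := by
    funext m k x α
    cases k
    · exact (add_zero _).symm
    · simp only [Pi.add_apply, map_add, smul_add, Finset.sum_add_distrib]
  map_smul' c a := by
    funext m k x α
    cases k
    · exact (smul_zero c).symm
    · simp only [Pi.smul_apply, map_smul, Finset.smul_sum, smul_comm c, RingHom.id_apply]

/-- `(x ∣ α) ↦ (-1)^(m+1) ∑ ± μ(x_i, x_j, ω (x with two entries omitted ∣ α))`, where `m` is the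
number of arguments from `L₀`, the sum is over the pairs of entries of `x` in increasing order and
`±` is the sign of the permutation that moves them to the front.  The index `j ≥ i` is counted
after the omission of `x_i`. -/
def pairActionTerm (μ : L₀ →ₗ[𝕜] L₀ →ₗ[𝕜] W →ₗ[𝕜] W') :
    Family L₀ L₁ W →ₗ[𝕜] Family L₀ L₁ W' where
  toFun ω
    | m + 2, k => fun x α => (-1 : 𝕜) ^ (m + 2 + 1) • ∑ i : Fin (m + 2), ∑ j : Fin (m + 1),
        if (i : ℕ) ≤ j then
          (-1 : 𝕜) ^ ((i : ℕ) + j) •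
            μ (x i) (i.removeNth x j) (ω m k (j.removeNth (i.removeNth x)) α)
        else 0
    | 0, _ => 0
    | 1, _ => 0
  map_add' a b := by
    funext m k x α
    rcases m with _ | _ | m
    iterate 2 exact (add_zero _).symm
    simp only [Pi.add_apply, map_add, smul_add, ite_add_zero, Finset.sum_add_distrib]
  map_smul' c a := by
    funext m k x α
    rcases m with _ | _ | m
    iterate 2 exact (smul_zero c).symm
    simp only [Pi.smul_apply, map_smul, Finset.smul_sum, smul_comm c, smul_ite, smul_zero,
      RingHom.id_apply]

end Generic

/-! ### Hemistrict Lie 2-algebras, their representations and their standard complex -/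

/-- A hemistrict Lie 2-algebra on the 2-term complex `d : L₁ → L₀`, with `L₁` in degree `-1` and
`L₀` in degree `0`: a 2-term dg (left) Leibniz algebra with a symmetric alternator `h`, which
controls the failure of skew-symmetry.  The bracket has the components `[x, y] = br x y`,
`[x, α] = brR x α` and `[α, x] = brL α x` for `x y : L₀` and `α : L₁`; `[α, β]` lies in degree `-2`
and vanishes. -/
structure HemistrictLie2Algebra (𝕜 L₁ L₀ : Type*) [Field 𝕜] [AddCommGroup L₁] [Module 𝕜 L₁]
    [AddCommGroup L₀] [Module 𝕜 L₀] where
  d : L₁ →ₗ[𝕜] L₀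
  br : L₀ →ₗ[𝕜] L₀ →ₗ[𝕜] L₀
  brR : L₀ →ₗ[𝕜] L₁ →ₗ[𝕜] L₁
  brL : L₁ →ₗ[𝕜] L₀ →ₗ[𝕜] L₁
  h : L₀ →ₗ[𝕜] L₀ →ₗ[𝕜] L₁
  /-- The bracket is a cochain map. -/
  d_brR : ∀ x α, d (brR x α) = br x (d α)
  d_brL : ∀ α x, d (brL α x) = br (d α) x
  brR_d : ∀ α β, brR (d α) β = brL α (d β)
  /-- The Leibniz rule. -/
  leibniz : ∀ x y z, br x (br y z) = br (br x y) z + br y (br x z)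
  leibniz_right : ∀ x y α, brR x (brR y α) = brR (br x y) α + brR y (brR x α)
  leibniz_mid : ∀ x α z, brR x (brL α z) = brL (brR x α) z + brL α (br x z)
  leibniz_left : ∀ α y z, brL α (br y z) = brL (brL α y) z + brR y (brL α z)
  /-- The alternator is symmetric. -/
  h_symm : ∀ x y, h x y = h y x
  /-- The bracket is skew-symmetric up to the chain homotopy `h`. -/
  br_add_br : ∀ x y, br x y + br y x = d (h x y)
  brR_add_brL : ∀ x α, brR x α + brL α x = h x (d α)
  /-- Compatibility of the alternator and the bracket. -/
  brL_h : ∀ x y z, brL (h x y) z = 0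
  brR_h : ∀ x y z, brR x (h y z) = h (br x y) z + h y (br x z)

namespace HemistrictLie2Algebra

section

variable {𝕜 L₁ L₀ : Type*} [Field 𝕜] [AddCommGroup L₁] [Module 𝕜 L₁]
  [AddCommGroup L₀] [Module 𝕜 L₀]

/-- A representation of a hemistrict Lie 2-algebra on the 2-term complex `dV : V₁ → V₀`, with `V₁`
in degree `-1` and `V₀` in degree `0`.  The left action has the components `l x v = l₀ x v`,
`l x u = l₁ x u`, `l α v = lα α v`, and the right action the components `r v x = r₀ v x`,
`r u x = r₁ u x`, `r v α = rα v α`, for `x : L₀`, `α : L₁`, `v : V₀`, `u : V₁`; `hv` is the action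
homotopy. -/
structure Rep (L : HemistrictLie2Algebra 𝕜 L₁ L₀) (V₁ V₀ : Type*) [AddCommGroup V₁] [Module 𝕜 V₁]
    [AddCommGroup V₀] [Module 𝕜 V₀] where
  dV : V₁ →ₗ[𝕜] V₀
  l₀ : L₀ →ₗ[𝕜] V₀ →ₗ[𝕜] V₀
  l₁ : L₀ →ₗ[𝕜] V₁ →ₗ[𝕜] V₁
  lα : L₁ →ₗ[𝕜] V₀ →ₗ[𝕜] V₁
  r₀ : V₀ →ₗ[𝕜] L₀ →ₗ[𝕜] V₀
  r₁ : V₁ →ₗ[𝕜] L₀ →ₗ[𝕜] V₁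
  rα : V₀ →ₗ[𝕜] L₁ →ₗ[𝕜] V₁
  hv : L₀ →ₗ[𝕜] V₀ →ₗ[𝕜] V₁
  /-- The left action is a cochain map. -/
  dV_l₁ : ∀ x u, dV (l₁ x u) = l₀ x (dV u)
  dV_lα : ∀ α v, dV (lα α v) = l₀ (L.d α) v
  l₁_d : ∀ α u, l₁ (L.d α) u = lα α (dV u)
  /-- The right action is a cochain map. -/
  dV_r₁ : ∀ u x, dV (r₁ u x) = r₀ (dV u) x
  dV_rα : ∀ v α, dV (rα v α) = r₀ v (L.d α)
  r₁_d : ∀ u α, r₁ u (L.d α) = rα (dV u) α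
  /-- The left action is a left representation of the dg Leibniz algebra. -/
  l₀_br : ∀ x y v, l₀ x (l₀ y v) - l₀ y (l₀ x v) = l₀ (L.br x y) v
  l₁_br : ∀ x y u, l₁ x (l₁ y u) - l₁ y (l₁ x u) = l₁ (L.br x y) u
  lα_brR : ∀ x α v, l₁ x (lα α v) - lα α (l₀ x v) = lα (L.brR x α) v
  lα_brL : ∀ α x v, lα α (l₀ x v) - l₁ x (lα α v) = lα (L.brL α x) v
  /-- The two actions skew-commute up to the chain homotopy `hv`. -/
  l₀_add_r₀ : ∀ x v, l₀ x v + r₀ v x = dV (hv x v)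
  l₁_add_r₁ : ∀ x u, l₁ x u + r₁ u x = hv x (dV u)
  lα_add_rα : ∀ α v, lα α v + rα v α = hv (L.d α) v
  /-- Compatibility of the homotopies and the actions. -/
  r₁_hv : ∀ x y v, r₁ (hv x v) y = 0
  lα_h : ∀ x y v, lα (L.h x y) v = 0
  l₁_hv : ∀ x y v, l₁ x (hv y v) = hv (L.br x y) v + hv y (l₀ x v)

variable (L : HemistrictLie2Algebra 𝕜 L₁ L₀)

/-- Cochains of weight `w` on the graded Lie algebra `L[1]` (with the bracket given by `h`), that
is, linear maps on the weight `w` part of its universal enveloping algebra: families `ω` of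
multilinear maps, symmetric in the arguments from `L₁`, with the weak symmetry property
`ω (…, x_i, x_{i+1}, … ∣ α) + ω (…, x_{i+1}, x_i, … ∣ α)
  = - ω (…, omit x_i, omit x_{i+1}, … ∣ h(x_i, x_{i+1}), α)`. -/
def cochains (W : Type*) [AddCommGroup W] [Module 𝕜 W] (w : ℤ) :
    Submodule 𝕜 (Family L₀ L₁ W) :=
  multilinearFamilies 𝕜 L₁ L₀ W w ⊓
  { carrier := {ω | ∀ (m k : ℕ) (i : Fin (m + 1)) (x : Fin (m + 2) → L₀) (α : Fin k → L₁),
      ω (m + 2) k x α + ω (m + 2) k (x ∘ Equiv.swap i.castSucc i.succ) α =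
        - ω m (k + 1) (i.removeNth (i.castSucc.removeNth x))
            (Matrix.vecCons (L.h (x i.castSucc) (x i.succ)) α)}
    zero_mem' := fun _ _ _ _ _ => by simp
    add_mem' := fun {a b} ha hb m k i x α => by
      have h1 := ha m k i x α
      have h2 := hb m k i x α
      simp only [Pi.add_apply, neg_add, ← h1, ← h2]
      abel
    smul_mem' := fun c {a} ha m k i x α => by
      have h1 := ha m k i x α
      simp only [Pi.smul_apply, ← smul_add, h1, smul_neg] }

variable {L}
variable {V₁ V₀ : Type*} [AddCommGroup V₁] [Module 𝕜 V₁] [AddCommGroup V₀] [Module 𝕜 V₀]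

namespace Rep

/-- The degree `n` part `Hom(U(L[1])_{-(n+1)}, V₁) ⊕ Hom(U(L[1])_{-n}, V₀)` of the standard
complex. -/
def standardCochains (_V : L.Rep V₁ V₀) (n : ℤ) :
    Submodule 𝕜 (Family L₀ L₁ V₁ × Family L₀ L₁ V₀) :=
  (L.cochains V₁ (n + 1)).prod (L.cochains V₀ n)

/-- The differential of the standard complex; only the left action enters. -/
def standardD (V : L.Rep V₁ V₀) :
    (Family L₀ L₁ V₁ × Family L₀ L₁ V₀) →ₗ[𝕜] (Family L₀ L₁ V₁ × Family L₀ L₁ V₀) :=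
  LinearMap.prod
    ((insertTerm L.d + actionTerm V.l₁ + bracketTerm L.br + mixedBracketTerm L.brL) ∘ₗ
        LinearMap.fst 𝕜 _ _ + oddActionTerm V.lα ∘ₗ LinearMap.snd 𝕜 _ _)
    ((insertTerm L.d + actionTerm V.l₀ + bracketTerm L.br + mixedBracketTerm L.brL) ∘ₗ
        LinearMap.snd 𝕜 _ _ + coefficientTerm V.dV ∘ₗ LinearMap.fst 𝕜 _ _)

/-- The cohomology `H^n(L, V)`. -/
abbrev Cohomology (V : L.Rep V₁ V₀) (n : ℤ) : Type _ :=
  gradedCohomology V.standardCochains V.standardD n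

end Rep

end

end HemistrictLie2Algebra

/-! ### Semistrict Lie 2-algebras, their representations and their cohomology -/

/-- A semistrict Lie 2-algebra (2-term `L_∞`-algebra) on `d : L₁ → L₀`, with `L₁` in degree `-1`.
The 2-bracket has the components `l₂(x, y) = br x y` and `l₂(x, α) = -l₂(α, x) = brα x α`; the
3-bracket is `l₃`. -/
structure SemistrictLie2Algebra (𝕜 L₁ L₀ : Type*) [Field 𝕜] [AddCommGroup L₁] [Module 𝕜 L₁]
    [AddCommGroup L₀] [Module 𝕜 L₀] where
  d : L₁ →ₗ[𝕜] L₀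
  br : L₀ →ₗ[𝕜] L₀ →ₗ[𝕜] L₀
  brα : L₀ →ₗ[𝕜] L₁ →ₗ[𝕜] L₁
  l₃ : L₀ →ₗ[𝕜] L₀ →ₗ[𝕜] L₀ →ₗ[𝕜] L₁
  br_self : ∀ x, br x x = 0
  l₃_left : ∀ x y, l₃ x x y = 0
  l₃_right : ∀ x y, l₃ x y y = 0
  d_brα : ∀ x α, d (brα x α) = br x (d α)
  brα_d : ∀ α β, brα (d α) β = - brα (d β) α
  d_l₃ : ∀ x y z, d (l₃ x y z) = br x (br y z) + br y (br z x) + br z (br x y)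
  l₃_d : ∀ x y α, l₃ x y (d α) = brα x (brα y α) - brα y (brα x α) - brα (br x y) α
  l₃_coherence : ∀ w x y z,
    brα w (l₃ x y z) - brα x (l₃ w y z) + brα y (l₃ w x z) - brα z (l₃ w x y)
      - l₃ (br w x) y z + l₃ (br w y) x z - l₃ (br w z) x y
      - l₃ (br x y) w z + l₃ (br x z) w y - l₃ (br y z) w x = 0

namespace SemistrictLie2Algebra

section

variable {𝕜 L₁ L₀ : Type*} [Field 𝕜] [AddCommGroup L₁] [Module 𝕜 L₁]
  [AddCommGroup L₀] [Module 𝕜 L₀]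

/-- A representation (up to homotopy) of a semistrict Lie 2-algebra on the 2-term complex
`dV : V₁ → V₀`: the action `l₀`, `l₁` of `L₀` on `V₀` and `V₁`, the action `lα : L₁ × V₀ → V₁`, and
the homotopy `μ₃ : L₀ ∧ L₀ × V₀ → V₁`. -/
structure Rep (L : SemistrictLie2Algebra 𝕜 L₁ L₀) (V₁ V₀ : Type*) [AddCommGroup V₁] [Module 𝕜 V₁]
    [AddCommGroup V₀] [Module 𝕜 V₀] where
  dV : V₁ →ₗ[𝕜] V₀
  l₀ : L₀ →ₗ[𝕜] V₀ →ₗ[𝕜] V₀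
  l₁ : L₀ →ₗ[𝕜] V₁ →ₗ[𝕜] V₁
  lα : L₁ →ₗ[𝕜] V₀ →ₗ[𝕜] V₁
  μ₃ : L₀ →ₗ[𝕜] L₀ →ₗ[𝕜] V₀ →ₗ[𝕜] V₁
  μ₃_self : ∀ x v, μ₃ x x v = 0
  dV_l₁ : ∀ x u, dV (l₁ x u) = l₀ x (dV u)
  dV_lα : ∀ α v, dV (lα α v) = l₀ (L.d α) v
  l₁_d : ∀ α u, l₁ (L.d α) u = lα α (dV u)
  l₀_br : ∀ x y v, l₀ x (l₀ y v) - l₀ y (l₀ x v) - l₀ (L.br x y) v = dV (μ₃ x y v)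
  l₁_br : ∀ x y u, l₁ x (l₁ y u) - l₁ y (l₁ x u) - l₁ (L.br x y) u = μ₃ x y (dV u)
  lα_brα : ∀ x α v, l₁ x (lα α v) - lα α (l₀ x v) - lα (L.brα x α) v = μ₃ x (L.d α) v
  μ₃_coherence : ∀ x y z v,
    l₁ x (μ₃ y z v) - l₁ y (μ₃ x z v) + l₁ z (μ₃ x y v) + lα (L.l₃ x y z) v
      - μ₃ (L.br x y) z v + μ₃ (L.br x z) y v - μ₃ (L.br y z) x v
      - μ₃ y z (l₀ x v) + μ₃ x z (l₀ y v) - μ₃ x y (l₀ z v) = 0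

/-- Cochains of weight `w`: families of multilinear maps, alternating in the arguments from `L₀` and
symmetric in the arguments from `L₁`, with `m + 2k = w`. -/
def cochains (_L : SemistrictLie2Algebra 𝕜 L₁ L₀) (W : Type*) [AddCommGroup W] [Module 𝕜 W]
    (w : ℤ) : Submodule 𝕜 (Family L₀ L₁ W) :=
  multilinearFamilies 𝕜 L₁ L₀ W w ⊓
  { carrier := {ω | ∀ (m k : ℕ) (x : Fin m → L₀) (α : Fin k → L₁) (i j : Fin m),
      i ≠ j → x i = x j → ω m k x α = 0}
    zero_mem' := fun _ _ _ _ _ _ _ _ => rfl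
    add_mem' := fun {a b} ha hb m k x α i j hij h => by
      simp [ha m k x α i j hij h, hb m k x α i j hij h]
    smul_mem' := fun c {a} ha m k x α i j hij h => by
      simp [ha m k x α i j hij h] }

variable {L : SemistrictLie2Algebra 𝕜 L₁ L₀}
variable {V₁ V₀ : Type*} [AddCommGroup V₁] [Module 𝕜 V₁] [AddCommGroup V₀] [Module 𝕜 V₀]

namespace Rep

/-- The degree `n` cochains of `L` with values in the complex `V`. -/
def ceCochains (_V : L.Rep V₁ V₀) (n : ℤ) :
    Submodule 𝕜 (Family L₀ L₁ V₁ × Family L₀ L₁ V₀) :=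
  (L.cochains V₁ (n + 1)).prod (L.cochains V₀ n)

/-- The generalized Chevalley–Eilenberg differential: the sum of the differential of `V` and the
duals of `d`, of `l₂`, of `l₃` and of the action. -/
def ceD (V : L.Rep V₁ V₀) :
    (Family L₀ L₁ V₁ × Family L₀ L₁ V₀) →ₗ[𝕜] (Family L₀ L₁ V₁ × Family L₀ L₁ V₀) :=
  LinearMap.prod
    ((insertTerm L.d + actionTerm V.l₁ + bracketTerm L.br + mixedBracketTerm (-L.brα.flip)
          + tripleBracketTerm L.l₃) ∘ₗ LinearMap.fst 𝕜 _ _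
      + (oddActionTerm V.lα + pairActionTerm V.μ₃) ∘ₗ LinearMap.snd 𝕜 _ _)
    ((insertTerm L.d + actionTerm V.l₀ + bracketTerm L.br + mixedBracketTerm (-L.brα.flip)
          + tripleBracketTerm L.l₃) ∘ₗ LinearMap.snd 𝕜 _ _
      + coefficientTerm V.dV ∘ₗ LinearMap.fst 𝕜 _ _)

/-- The cohomology `H^n(L, V)` of a semistrict Lie 2-algebra with values in a representation. -/
abbrev Cohomology (V : L.Rep V₁ V₀) (n : ℤ) : Type _ :=
  gradedCohomology V.ceCochains V.ceD n

end Rep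

end

end SemistrictLie2Algebra

/-! ### Chevalley–Eilenberg cohomology of a Lie algebra with values in a 2-term complex -/

namespace LieCE

section

attribute [local instance] LieRing.ofAssociativeRing

variable {𝕜 𝔤 : Type*} [Field 𝕜] [LieRing 𝔤] [LieAlgebra 𝕜 𝔤]

variable (𝕜 𝔤) in
/-- Alternating multilinear cochains `𝔤^w → W`, as families concentrated in `m = w`. -/
def cochains (W : Type*) [AddCommGroup W] [Module 𝕜 W] (w : ℤ) :
    Submodule 𝕜 ((m : ℕ) → (Fin m → 𝔤) → W) where
  carrier := {f | (∀ m : ℕ, (m : ℤ) ≠ w → f m = 0) ∧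
    ∀ m : ℕ, ∃ F : 𝔤 [⋀^Fin m]→ₗ[𝕜] W, ∀ x, f m x = F x}
  zero_mem' := ⟨fun _ _ => rfl, fun _ => ⟨0, fun _ => rfl⟩⟩
  add_mem' := by
    rintro a b ⟨ha, ha'⟩ ⟨hb, hb'⟩
    refine ⟨fun m h => by simp [ha m h, hb m h], fun m => ?_⟩
    obtain ⟨F, hF⟩ := ha' m
    obtain ⟨G, hG⟩ := hb' m
    exact ⟨F + G, fun x => by simp [hF, hG]⟩
  smul_mem' := by
    rintro c a ⟨ha, ha'⟩
    refine ⟨fun m h => by simp [ha m h], fun m => ?_⟩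
    obtain ⟨F, hF⟩ := ha' m
    exact ⟨c • F, fun x => by simp [hF]⟩

/-- The Chevalley–Eilenberg differential with values in the module given by `ρ`:
`∑ i, (-1)^i ρ(x_i) f(…, omit x_i, …) + ∑ i < j, (-1)^(i+1) f(…, omit x_i, …, ⁅x_i, x_j⁆, …)`,
indices starting at `0`, with `⁅x_i, x_j⁆` in the place of `x_j`.  On alternating `f` the second sum
is `∑ i < j, (-1)^(i+j) f(⁅x_i, x_j⁆, …, omit x_i, …, omit x_j, …)`. -/
def ceDifferential {W : Type*} [AddCommGroup W] [Module 𝕜 W] (ρ : 𝔤 →ₗ⁅𝕜⁆ Module.End 𝕜 W) :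
    ((m : ℕ) → (Fin m → 𝔤) → W) →ₗ[𝕜] ((m : ℕ) → (Fin m → 𝔤) → W) where
  toFun f
    | 0 => 0
    | m + 1 => fun x => ∑ i : Fin (m + 1), (-1 : 𝕜) ^ (i : ℕ) • ρ (x i) (f m (i.removeNth x))
        + ∑ i : Fin (m + 1), ∑ j ∈ Finset.Ioi i, (-1 : 𝕜) ^ ((i : ℕ) + 1) •
            f m (i.removeNth (Function.update x j ⁅x i, x j⁆))
  map_add' a b := by
    funext m x
    cases m
    · simp
    · simp only [Pi.add_apply, map_add, smul_add, Finset.sum_add_distrib]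
      abel
  map_smul' c a := by
    funext m x
    cases m
    · exact (smul_zero c).symm
    · simp only [Pi.smul_apply, map_smul, smul_add, Finset.smul_sum, smul_comm c, RingHom.id_apply]

variable {V₁ V₀ : Type*} [AddCommGroup V₁] [Module 𝕜 V₁] [AddCommGroup V₀] [Module 𝕜 V₀]

/-- The differential `d_V + d_CE` of the total Chevalley–Eilenberg complex with values in the 2-term
complex `dV : V₁ → V₀` of `𝔤`-modules; the sign of `d_V` on a cochain of `m` arguments is
`(-1)^m`. -/
def totalD (dV : V₁ →ₗ[𝕜] V₀) (ρ₁ : 𝔤 →ₗ⁅𝕜⁆ Module.End 𝕜 V₁) (ρ₀ : 𝔤 →ₗ⁅𝕜⁆ Module.End 𝕜 V₀) :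
    (((m : ℕ) → (Fin m → 𝔤) → V₁) × ((m : ℕ) → (Fin m → 𝔤) → V₀)) →ₗ[𝕜]
      (((m : ℕ) → (Fin m → 𝔤) → V₁) × ((m : ℕ) → (Fin m → 𝔤) → V₀)) where
  toFun f := (ceDifferential ρ₁ f.1,
    ceDifferential ρ₀ f.2 + fun m x => (-1 : 𝕜) ^ m • dV (f.1 m x))
  map_add' a b := by
    ext1
    · simp
    · funext m x
      simp only [Prod.snd_add, Prod.fst_add, map_add, Pi.add_apply, smul_add]
      abel
  map_smul' c a := by
    ext1
    · simp
    · funext m x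
      simp [smul_comm c]

/-- The cohomology `H^n_CE(𝔤, V)` with values in the 2-term complex `dV : V₁ → V₀` of `𝔤`-modules,
where `V₁` is in degree `-1` and `V₀` in degree `0`. -/
abbrev Cohomology (dV : V₁ →ₗ[𝕜] V₀) (ρ₁ : 𝔤 →ₗ⁅𝕜⁆ Module.End 𝕜 V₁)
    (ρ₀ : 𝔤 →ₗ⁅𝕜⁆ Module.End 𝕜 V₀) (n : ℤ) : Type _ :=
  gradedCohomology (fun n => (cochains 𝕜 𝔤 V₁ (n + 1)).prod (cochains 𝕜 𝔤 V₀ n))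
    (totalD dV ρ₁ ρ₀) n

end

end LieCE

/-! ### The Lie algebra and the semistrict Lie 2-algebra of a hemistrict Lie 2-algebra -/

namespace HemistrictLie2Algebra

section

attribute [local instance] LieRing.ofAssociativeRing

variable {𝕜 L₁ L₀ : Type*} [Field 𝕜] [AddCommGroup L₁] [Module 𝕜 L₁]
  [AddCommGroup L₀] [Module 𝕜 L₀] (L : HemistrictLie2Algebra 𝕜 L₁ L₀)

/-- The space `L_Lie = L₀ / d L₁`. -/
abbrev LieQuot : Type _ := L₀ ⧸ LinearMap.range L.d

/-- The bracket of `L_Lie`, induced from that of `L₀`. -/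
def lieQuotBracket : L.LieQuot →ₗ[𝕜] L.LieQuot →ₗ[𝕜] L.LieQuot :=
  (LinearMap.range L.d).liftQ
    (LinearMap.flip ((LinearMap.range L.d).liftQ
      (L.br.compr₂ (LinearMap.range L.d).mkQ).flip (by
        rintro _ ⟨α, rfl⟩
        ext x
        simpa using ⟨L.brR x α, L.d_brR x α⟩))) (by
        rintro _ ⟨α, rfl⟩
        ext x
        simpa using ⟨L.brL α x, L.d_brL α x⟩)

@[simp] theorem lieQuotBracket_mk (x y : L₀) :
    L.lieQuotBracket (Submodule.Quotient.mk x) (Submodule.Quotient.mk y) =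
      Submodule.Quotient.mk (L.br x y) := rfl

/-- The 2-bracket `l̃₂(x, y) = ([x, y] - [y, x]) / 2` on `L₀`. -/
def skewBr : L₀ →ₗ[𝕜] L₀ →ₗ[𝕜] L₀ := (2⁻¹ : 𝕜) • (L.br - L.br.flip)

/-- The 2-bracket `l̃₂(x, α) = ([x, α] - [α, x]) / 2`. -/
def skewBrα : L₀ →ₗ[𝕜] L₁ →ₗ[𝕜] L₁ := (2⁻¹ : 𝕜) • (L.brR - L.brL.flip)

/-- `F(y, z, x)` as a trilinear map in `x, y, z`. -/
def cyclicShift (F : L₀ →ₗ[𝕜] L₀ →ₗ[𝕜] L₀ →ₗ[𝕜] L₁) : L₀ →ₗ[𝕜] L₀ →ₗ[𝕜] L₀ →ₗ[𝕜] L₁ :=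
  (LinearMap.lflip.toLinearMap ∘ₗ F).flip

/-- The 3-bracket
`l̃₃(x, y, z) = -(h(l̃₂(x, y), z) + h(l̃₂(y, z), x) + h(l̃₂(z, x), y)) / 6`. -/
def skewL₃ : L₀ →ₗ[𝕜] L₀ →ₗ[𝕜] L₀ →ₗ[𝕜] L₁ :=
  (-(6⁻¹ : 𝕜)) • (L.skewBr.compr₂ L.h + cyclicShift (L.skewBr.compr₂ L.h)
    + cyclicShift (cyclicShift (L.skewBr.compr₂ L.h)))

theorem skewBr_apply (x y : L₀) : L.skewBr x y = (2⁻¹ : 𝕜) • (L.br x y - L.br y x) := rfl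

theorem skewBrα_apply (x : L₀) (α : L₁) :
    L.skewBrα x α = (2⁻¹ : 𝕜) • (L.brR x α - L.brL α x) := rfl

theorem skewL₃_apply (x y z : L₀) : L.skewL₃ x y z =
    (-(6⁻¹ : 𝕜)) • (L.h (L.skewBr x y) z + L.h (L.skewBr y z) x + L.h (L.skewBr z x) y) := rfl

theorem h_d (x : L₀) (α : L₁) : L.h (L.d α) x = L.brR x α + L.brL α x := by
  rw [L.h_symm, L.brR_add_brL]

theorem br_br_left (x y z : L₀) : L.br (L.br x y) z + L.br (L.br y x) z = 0 := by
  rw [← LinearMap.add_apply, ← map_add, L.br_add_br, ← L.d_brL, L.brL_h, map_zero]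

theorem h_br_br_left (x y z w : L₀) :
    L.h (L.br (L.br x y) z) w + L.h (L.br (L.br y x) z) w = 0 := by
  rw [← LinearMap.add_apply, ← map_add, L.br_br_left, map_zero, LinearMap.zero_apply]

theorem h_leibniz (x y z w : L₀) : L.h (L.br x (L.br y z)) w =
    L.h (L.br (L.br x y) z) w + L.h (L.br y (L.br x z)) w := by
  rw [L.leibniz, map_add, LinearMap.add_apply]

theorem brL_skewL₃ (x y z w : L₀) : L.brL (L.skewL₃ x y z) w = 0 := by
  simp [skewL₃_apply, L.brL_h]

variable [CharZero 𝕜]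

instance instLieRingLieQuot : LieRing L.LieQuot where
  bracket x y := L.lieQuotBracket x y
  add_lie x y z := by simp
  lie_add x y z := by simp
  lie_self x := by
    obtain ⟨x, rfl⟩ := Submodule.Quotient.mk_surjective _ x
    change L.lieQuotBracket _ _ = 0
    rw [lieQuotBracket_mk, Submodule.Quotient.mk_eq_zero]
    refine ⟨(2 : 𝕜)⁻¹ • L.h x x, ?_⟩
    rw [map_smul, ← L.br_add_br, ← two_smul 𝕜, smul_smul, inv_mul_cancel₀ two_ne_zero, one_smul]
  leibniz_lie x y z := by
    obtain ⟨x, rfl⟩ := Submodule.Quotient.mk_surjective _ x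
    obtain ⟨y, rfl⟩ := Submodule.Quotient.mk_surjective _ y
    obtain ⟨z, rfl⟩ := Submodule.Quotient.mk_surjective _ z
    change L.lieQuotBracket _ (L.lieQuotBracket _ _) =
      L.lieQuotBracket (L.lieQuotBracket _ _) _ + L.lieQuotBracket _ (L.lieQuotBracket _ _)
    simp only [lieQuotBracket_mk, L.leibniz x y z, Submodule.Quotient.mk_add]

instance instLieAlgebraLieQuot : LieAlgebra 𝕜 L.LieQuot where
  lie_smul t x y := (L.lieQuotBracket x).map_smul t y

theorem skewL₃_eq (x y z : L₀) : L.skewL₃ x y z = (-(12⁻¹ : 𝕜)) •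
    (L.h (L.br x y) z - L.h (L.br y x) z + (L.h (L.br y z) x - L.h (L.br z y) x)
      + (L.h (L.br z x) y - L.h (L.br x z) y)) := by
  simp only [skewL₃_apply, skewBr_apply, map_sub, map_smul, LinearMap.sub_apply,
    LinearMap.smul_apply]
  module

theorem skewBrα_skewL₃ (w x y z : L₀) : L.skewBrα w (L.skewL₃ x y z) = (-(24⁻¹ : 𝕜)) •
    L.brR w (L.h (L.br x y) z - L.h (L.br y x) z + (L.h (L.br y z) x - L.h (L.br z y) x)
      + (L.h (L.br z x) y - L.h (L.br x z) y)) := by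
  rw [skewBrα_apply, brL_skewL₃, sub_zero, skewL₃_eq, map_smul, smul_smul]
  congr 1
  norm_num

theorem skewL₃_skewBr (w x y z : L₀) : L.skewL₃ (L.skewBr w x) y z = (-(24⁻¹ : 𝕜)) •
    (L.h (L.br (L.br w x - L.br x w) y) z - L.h (L.br y (L.br w x - L.br x w)) z
      + (L.h (L.br y z) (L.br w x - L.br x w) - L.h (L.br z y) (L.br w x - L.br x w))
      + (L.h (L.br z (L.br w x - L.br x w)) y - L.h (L.br (L.br w x - L.br x w) z) y)) := by
  rw [skewBr_apply, map_smul, LinearMap.smul_apply, LinearMap.smul_apply, skewL₃_eq, smul_smul]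
  congr 1
  norm_num

set_option maxHeartbeats 1000000 in
theorem skewL₃_coherence (w x y z : L₀) :
    L.skewBrα w (L.skewL₃ x y z) - L.skewBrα x (L.skewL₃ w y z) + L.skewBrα y (L.skewL₃ w x z)
      - L.skewBrα z (L.skewL₃ w x y)
      - L.skewL₃ (L.skewBr w x) y z + L.skewL₃ (L.skewBr w y) x z - L.skewL₃ (L.skewBr w z) x y
      - L.skewL₃ (L.skewBr x y) w z + L.skewL₃ (L.skewBr x z) w y
      - L.skewL₃ (L.skewBr y z) w x = 0 := by
  have hs : ∀ a b c e, L.h (L.br (L.br b a) c) e = -(L.h (L.br (L.br a b) c) e) := fun a b c e =>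
    eq_neg_of_add_eq_zero_left (L.h_br_br_left b a c e)
  have hl : ∀ a b c e, L.h (L.br (L.br a b) c) e =
      L.h (L.br a (L.br b c)) e - L.h (L.br b (L.br a c)) e := fun a b c e =>
    eq_sub_of_add_eq (L.h_leibniz a b c e).symm
  simp only [skewBrα_skewL₃, skewL₃_skewBr, ← smul_sub, ← smul_add]
  refine smul_eq_zero_of_right _ ?_
  simp only [map_add, map_sub, LinearMap.sub_apply, L.brR_h]
  simp only [L.h_symm (L.br y z) (L.br w x), L.h_symm (L.br z y) (L.br w x),
    L.h_symm (L.br y z) (L.br x w), L.h_symm (L.br z y) (L.br x w),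
    L.h_symm (L.br x z) (L.br w y), L.h_symm (L.br z x) (L.br w y),
    L.h_symm (L.br x z) (L.br y w), L.h_symm (L.br z x) (L.br y w),
    L.h_symm (L.br y x) (L.br w z), L.h_symm (L.br x y) (L.br w z),
    L.h_symm (L.br y x) (L.br z w), L.h_symm (L.br x y) (L.br z w)]
  simp only [hs w x, hs w y, hs w z, hs x y, hs x z, hs y z, hl]
  abel

/-- The semistrict Lie 2-algebra `L̃ = (d : L₁ → L₀, l̃₂, l̃₃)` obtained from `L` by
skew-symmetrization. -/
def skew : SemistrictLie2Algebra 𝕜 L₁ L₀ where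
  d := L.d
  br := L.skewBr
  brα := L.skewBrα
  l₃ := L.skewL₃
  br_self x := by simp [skewBr_apply]
  l₃_left x y := by
    simp only [skewL₃_apply, skewBr_apply, map_sub, map_smul, LinearMap.sub_apply,
      LinearMap.smul_apply]
    module
  l₃_right x y := by
    simp only [skewL₃_apply, skewBr_apply, map_sub, map_smul, LinearMap.sub_apply,
      LinearMap.smul_apply]
    module
  d_brα x α := by
    simp [skewBrα_apply, skewBr_apply, L.d_brR, L.d_brL]
  brα_d α β := by
    simp only [skewBrα_apply, L.brR_d]
    module
  d_l₃ x y z := by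
    have hl := L.leibniz
    have hs := L.br_br_left
    simp only [skewL₃_apply, skewBr_apply, map_add, map_sub, map_smul, LinearMap.sub_apply,
      LinearMap.smul_apply, ← L.br_add_br]
    linear_combination (norm := module) -(6⁻¹ : 𝕜) • hs x y z + (6⁻¹ : 𝕜) • hs x z y
      - (6⁻¹ : 𝕜) • hs y z x - (3⁻¹ : 𝕜) • hl x y z + (3⁻¹ : 𝕜) • hl x z y
      - (3⁻¹ : 𝕜) • hl y z x
  l₃_d x y α := by
    have e1 : L.brL (L.brR x α) y + L.brL (L.brL α x) y = 0 := by
      rw [← LinearMap.add_apply, ← map_add, L.brR_add_brL, L.brL_h]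
    have e2 : L.brL (L.brR y α) x + L.brL (L.brL α y) x = 0 := by
      rw [← LinearMap.add_apply, ← map_add, L.brR_add_brL, L.brL_h]
    have e3 : L.brR (L.br x y) α + L.brR (L.br y x) α = 0 := by
      rw [← LinearMap.add_apply, ← map_add, L.br_add_br, L.brR_d, L.brL_h]
    simp only [skewL₃_apply, skewBr_apply, skewBrα_apply, map_sub, map_smul,
      LinearMap.sub_apply, LinearMap.smul_apply, ← L.d_brR, ← L.d_brL, L.h_d, ← L.brR_add_brL]
    linear_combination (norm := module) -(6⁻¹ : 𝕜) • e3 + (6⁻¹ : 𝕜) • e1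
      - (6⁻¹ : 𝕜) • e2 - (3⁻¹ : 𝕜) • L.leibniz_right x y α + (3⁻¹ : 𝕜) • L.leibniz_mid x α y
      - (3⁻¹ : 𝕜) • L.leibniz_mid y α x
  l₃_coherence := L.skewL₃_coherence

namespace Rep

variable {L} {V₁ V₀ : Type*} [AddCommGroup V₁] [Module 𝕜 V₁] [AddCommGroup V₀] [Module 𝕜 V₀]

/-- The representation of `L̃` on the complex `V` given by the left action of `L`; the homotopy
`l(h(x, y), v) / 2` vanishes by the axioms of a representation of `L`. -/
def skew (V : L.Rep V₁ V₀) : L.skew.Rep V₁ V₀ where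
  dV := V.dV
  l₀ := V.l₀
  l₁ := V.l₁
  lα := V.lα
  μ₃ := 0
  μ₃_self _ _ := rfl
  dV_l₁ := V.dV_l₁
  dV_lα := V.dV_lα
  l₁_d := V.l₁_d
  l₀_br x y v := by
    have h1 := V.l₀_br x y v
    have h2 := V.l₀_br y x v
    change _ - _ - V.l₀ (L.skewBr x y) v = V.dV 0
    rw [skewBr_apply, map_smul, map_sub, LinearMap.smul_apply, LinearMap.sub_apply, ← h1, ← h2,
      map_zero]
    module
  l₁_br x y u := by
    have h1 := V.l₁_br x y u
    have h2 := V.l₁_br y x u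
    change _ - _ - V.l₁ (L.skewBr x y) u = 0
    rw [skewBr_apply, map_smul, map_sub, LinearMap.smul_apply, LinearMap.sub_apply, ← h1, ← h2]
    module
  lα_brα x α v := by
    have h1 := V.lα_brR x α v
    have h2 := V.lα_brL α x v
    change _ - _ - V.lα (L.skewBrα x α) v = 0
    rw [skewBrα_apply, map_smul, map_sub, LinearMap.smul_apply, LinearMap.sub_apply, ← h1, ← h2]
    module
  μ₃_coherence x y z v := by
    have h : V.lα (L.skewL₃ x y z) v = 0 := by
      simp [skewL₃_apply, V.lα_h]
    change V.l₁ x 0 - V.l₁ y 0 + V.l₁ z 0 + V.lα (L.skewL₃ x y z) v - 0 + 0 - 0 - 0 + 0 - 0 = 0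
    simp [h]

/-- The `L_Lie`-module structure on `V₀` induced by the left action if `l_α = 0` for `α` in `L₁`. -/
def lieRep₀ (V : L.Rep V₁ V₀) (hV : ∀ α v, V.lα α v = 0) :
    L.LieQuot →ₗ⁅𝕜⁆ Module.End 𝕜 V₀ where
  toLinearMap := (LinearMap.range L.d).liftQ V.l₀ (by
    rintro _ ⟨α, rfl⟩
    ext v
    simp [← V.dV_lα, hV])
  map_lie' {x y} := by
    obtain ⟨x, rfl⟩ := Submodule.Quotient.mk_surjective _ x
    obtain ⟨y, rfl⟩ := Submodule.Quotient.mk_surjective _ y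
    ext v
    exact (V.l₀_br x y v).symm

/-- The `L_Lie`-module structure on `V₁` induced by the left action if `l_α = 0` for `α` in `L₁`. -/
def lieRep₁ (V : L.Rep V₁ V₀) (hV : ∀ α v, V.lα α v = 0) :
    L.LieQuot →ₗ⁅𝕜⁆ Module.End 𝕜 V₁ where
  toLinearMap := (LinearMap.range L.d).liftQ V.l₁ (by
    rintro _ ⟨α, rfl⟩
    ext u
    simp [V.l₁_d, hV])
  map_lie' {x y} := by
    obtain ⟨x, rfl⟩ := Submodule.Quotient.mk_surjective _ x
    obtain ⟨y, rfl⟩ := Submodule.Quotient.mk_surjective _ y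
    ext u
    exact (V.l₁_br x y u).symm

/-- The cohomology `H^n_CE(L_Lie, V)`. -/
abbrev LieCohomology (V : L.Rep V₁ V₀) (hV : ∀ α v, V.lα α v = 0) (n : ℤ) : Type _ :=
  LieCE.Cohomology V.dV (V.lieRep₁ hV) (V.lieRep₀ hV) n

end Rep

end

end HemistrictLie2Algebra

/-!
The proof compares three complexes: the standard complex of `L`, the Chevalley–Eilenberg complex of
the skew-symmetrization `L̃`, and that of `L_Lie = L₀ / d L₁`.

The standard complex and that of `L̃` are isomorphic.  The cochains of both are determined by their
contractions with elements of `L₀` and `L₁`, and the operator `Family.twist` by `-h/2`, which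
replaces the contraction `ι_x` by `j_x = ι_x + κ(-h(x, -)/2)`, where `κ` converts an argument from
`L₀` into one from `L₁`, carries alternating families to families with the weak symmetry governed by
`h`. The point is the Cartan formula `j_x D + D j_x = 𝓛_x` for the differential `D` of `L̃`
(`twistedContr_skewD`): the 3-bracket `l̃₃` cancels the error of `κ`, and `𝓛_x` is the Lie
derivative along the Leibniz bracket of `L`.  The standard differential satisfies the same formula
with `ι_x`, so the twist intertwines the two (`weakD_twist`).  The formula also gives `D² = 0`
(`skewD_skewD`).

Pulling back along `L₀ → L_Lie` embeds the complex of `L_Lie` into that of `L̃`, as the cochains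
without arguments from `L₁` that vanish on `d L₁`; these form a subcomplex since `L₁` acts
trivially. The embedding is a quasi-isomorphism when `d` is injective.  For a left inverse `π` of
`d`, the anticommutator of `D` and `κ(π)` acts on the component with the maximal number `K` of
arguments from `L₁` as `K` plus the number of arguments from `L₀` that lie in `d L₁`, up to terms
with more such arguments (`convertTerm_fullTerm`).  In characteristic zero this is invertible for
`K > 0`, so such a component is removed by a coboundary (`exists_sub_skewD_mem_level`), as in a
Koszul complex.  What remains at `K = 0` descends to `L_Lie` (`exists_eq_pullbackMap_add_ceD`).

Identities between operators are proved by recursion on the number of arguments: both sides have the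
same contractions (`Family.eq_zero_of_contr` and its variants), so the multilinear sums are expanded
only once, in the recursion formulas of the elementary operators.
-/

set_option linter.unusedSectionVars false

/-! ### Operators on families and their recursion formulas -/

namespace Family

section Operators

variable {𝕜 L₁ L₀ W W' : Type*} [Field 𝕜] [AddCommGroup L₁] [Module 𝕜 L₁]
  [AddCommGroup L₀] [Module 𝕜 L₀] [AddCommGroup W] [Module 𝕜 W] [AddCommGroup W'] [Module 𝕜 W']

theorem removeNth_zero_vecCons {X : Type*} {m : ℕ} (a : X) (x : Fin m → X) :
    (0 : Fin (m + 1)).removeNth (Matrix.vecCons a x) = x := rfl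

theorem removeNth_succ_vecCons {X : Type*} {m : ℕ} (i : Fin (m + 1)) (a : X)
    (x : Fin (m + 1) → X) :
    i.succ.removeNth (Matrix.vecCons a x) = Matrix.vecCons a (i.removeNth x) := by
  funext j
  refine Fin.cases ?_ (fun j => ?_) j
  · simp [Fin.removeNth]
  · simp [Fin.removeNth, Fin.succ_succAbove_succ]

theorem update_vecCons_zero {X : Type*} {m : ℕ} (a b : X) (x : Fin m → X) :
    Function.update (Matrix.vecCons a x) 0 b = Matrix.vecCons b x :=
  Fin.update_cons_zero (α := fun _ => X) a x b

theorem update_vecCons_succ {X : Type*} {m : ℕ} (j : Fin m) (a b : X) (x : Fin m → X) :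
    Function.update (Matrix.vecCons a x) j.succ b = Matrix.vecCons a (Function.update x j b) :=
  (Fin.cons_update (α := fun _ => X) a x j b).symm

variable (𝕜) in
/-- Contraction with `x : L₀`: insert `x` as the first argument from `L₀`. -/
def contr₀ (x : L₀) : Family L₀ L₁ W →ₗ[𝕜] Family L₀ L₁ W where
  toFun ω m k y α := ω (m + 1) k (Matrix.vecCons x y) α
  map_add' _ _ := rfl
  map_smul' _ _ := rfl

variable (𝕜) in
/-- Contraction with `a : L₁`: insert `a` as the first argument from `L₁`. -/
def contr₁ (a : L₁) : Family L₀ L₁ W →ₗ[𝕜] Family L₀ L₁ W where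
  toFun ω m k y α := ω m (k + 1) y (Matrix.vecCons a α)
  map_add' _ _ := rfl
  map_smul' _ _ := rfl

/-- Apply a linear map to the values. -/
def valueMap (g : W →ₗ[𝕜] W') : Family L₀ L₁ W →ₗ[𝕜] Family L₀ L₁ W' where
  toFun ω m k y α := g (ω m k y α)
  map_add' _ _ := by funext; simp
  map_smul' _ _ := by funext; simp

/-- `(x ∣ α) ↦ ∑ i, (-1)^i ω (…, omit x_i, … ∣ φ(x_i), α)`: one argument from `L₀` is converted into
an argument from `L₁`.  For `φ` a left inverse of `d` this is the homotopy used against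
`insertTerm d`. -/
def convertTerm (φ : L₀ →ₗ[𝕜] L₁) : Family L₀ L₁ W →ₗ[𝕜] Family L₀ L₁ W where
  toFun ω
    | 0, _ => 0
    | m + 1, k => fun x α => ∑ i : Fin (m + 1), (-1 : 𝕜) ^ (i : ℕ) •
        ω m (k + 1) (i.removeNth x) (Matrix.vecCons (φ (x i)) α)
  map_add' a b := by
    funext m k x α
    cases m
    · exact (add_zero _).symm
    · simp only [Pi.add_apply, smul_add, Finset.sum_add_distrib]
  map_smul' c a := by
    funext m k x α
    cases m
    · exact (smul_zero c).symm
    · simp only [Pi.smul_apply, Finset.smul_sum, smul_comm c, RingHom.id_apply]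

/-- The derivation extending `f` in the arguments from `L₀`: the sum over `i` of `ω` with `x_i`
replaced by `f(x_i)`. -/
def derivTerm₀ (f : L₀ →ₗ[𝕜] L₀) : Family L₀ L₁ W →ₗ[𝕜] Family L₀ L₁ W where
  toFun ω m k x α := ∑ i : Fin m, ω m k (Function.update x i (f (x i))) α
  map_add' a b := by
    funext m k x α
    simp only [Pi.add_apply, Finset.sum_add_distrib]
  map_smul' c a := by
    funext m k x α
    simp only [Pi.smul_apply, Finset.smul_sum, RingHom.id_apply]

/-- The derivation extending `g` in the arguments from `L₁`. -/
def derivTerm₁ (g : L₁ →ₗ[𝕜] L₁) : Family L₀ L₁ W →ₗ[𝕜] Family L₀ L₁ W where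
  toFun ω m k x α := ∑ j : Fin k, ω m k x (Function.update α j (g (α j)))
  map_add' a b := by
    funext m k x α
    simp only [Pi.add_apply, Finset.sum_add_distrib]
  map_smul' c a := by
    funext m k x α
    simp only [Pi.smul_apply, Finset.smul_sum, RingHom.id_apply]

/-- The term dual to a skew-symmetric map `ψ` from pairs in `L₀` to `L₁`:
`(x ∣ α) ↦ ∑ ± ω (x with two entries omitted ∣ ψ(the two entries), α)`, over the pairs of entries in
increasing order, with the sign of the permutation that moves them to the front.  As in
`tripleBracketTerm`, the index `j ≥ i` is counted after the omission of `x_i`. -/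
def pairTerm (ψ : L₀ →ₗ[𝕜] L₀ →ₗ[𝕜] L₁) : Family L₀ L₁ W →ₗ[𝕜] Family L₀ L₁ W where
  toFun ω
    | m + 2, k => fun x α => ∑ i : Fin (m + 2), ∑ j : Fin (m + 1),
        if (i : ℕ) ≤ j then
          (-1 : 𝕜) ^ ((i : ℕ) + j) • ω m (k + 1) (j.removeNth (i.removeNth x))
            (Matrix.vecCons (ψ (x i) (i.removeNth x j)) α)
        else 0
    | 0, _ => 0
    | 1, _ => 0
  map_add' a b := by
    funext m k x α
    rcases m with _ | _ | m
    iterate 2 exact (add_zero _).symm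
    simp only [Pi.add_apply, smul_add, ite_add_zero, Finset.sum_add_distrib]
  map_smul' c a := by
    funext m k x α
    rcases m with _ | _ | m
    iterate 2 exact (smul_zero c).symm
    simp only [Pi.smul_apply, Finset.smul_sum, smul_comm c, smul_ite, smul_zero, RingHom.id_apply]

theorem contr₀_apply (x : L₀) (ω : Family L₀ L₁ W) (m k : ℕ) (y : Fin m → L₀) (α : Fin k → L₁) :
    contr₀ 𝕜 x ω m k y α = ω (m + 1) k (Matrix.vecCons x y) α := rfl

theorem contr₁_apply (a : L₁) (ω : Family L₀ L₁ W) (m k : ℕ) (y : Fin m → L₀) (α : Fin k → L₁) :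
    contr₁ 𝕜 a ω m k y α = ω m (k + 1) y (Matrix.vecCons a α) := rfl

theorem contr₁_contr₀ (a : L₁) (x : L₀) (ω : Family L₀ L₁ W) :
    contr₁ 𝕜 a (contr₀ 𝕜 x ω) = contr₀ 𝕜 x (contr₁ 𝕜 a ω) := rfl

theorem contr₀_valueMap (x : L₀) (g : W →ₗ[𝕜] W') (ω : Family L₀ L₁ W) :
    contr₀ 𝕜 x (valueMap g ω) = valueMap g (contr₀ 𝕜 x ω) := rfl

theorem contr₁_valueMap (a : L₁) (g : W →ₗ[𝕜] W') (ω : Family L₀ L₁ W) :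
    contr₁ 𝕜 a (valueMap g ω) = valueMap g (contr₁ 𝕜 a ω) := rfl

theorem contr₀_convertTerm (x : L₀) (φ : L₀ →ₗ[𝕜] L₁) (ω : Family L₀ L₁ W) :
    contr₀ 𝕜 x (convertTerm φ ω) = contr₁ 𝕜 (φ x) ω - convertTerm φ (contr₀ 𝕜 x ω) := by
  funext m k y α
  change ∑ i : Fin (m + 1), _ = _
  rw [Fin.sum_univ_succ]
  simp only [Fin.val_zero, pow_zero, one_smul, removeNth_zero_vecCons, Matrix.cons_val_zero]
  rcases m with _ | m
  · simp [convertTerm, contr₁_apply]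
  · simp [convertTerm, contr₁_apply, contr₀_apply, removeNth_succ_vecCons, pow_succ,
      sub_eq_add_neg]

theorem contr₀_derivTerm₀ (x : L₀) (f : L₀ →ₗ[𝕜] L₀) (ω : Family L₀ L₁ W) :
    contr₀ 𝕜 x (derivTerm₀ f ω) = contr₀ 𝕜 (f x) ω + derivTerm₀ f (contr₀ 𝕜 x ω) := by
  funext m k y α
  change ∑ i : Fin (m + 1), _ = _
  rw [Fin.sum_univ_succ]
  simp [derivTerm₀, contr₀_apply, update_vecCons_zero, update_vecCons_succ]

theorem contr₁_derivTerm₀ (a : L₁) (f : L₀ →ₗ[𝕜] L₀) (ω : Family L₀ L₁ W) :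
    contr₁ 𝕜 a (derivTerm₀ f ω) = derivTerm₀ f (contr₁ 𝕜 a ω) := rfl

theorem contr₀_derivTerm₁ (x : L₀) (g : L₁ →ₗ[𝕜] L₁) (ω : Family L₀ L₁ W) :
    contr₀ 𝕜 x (derivTerm₁ g ω) = derivTerm₁ g (contr₀ 𝕜 x ω) := rfl

theorem contr₁_derivTerm₁ (a : L₁) (g : L₁ →ₗ[𝕜] L₁) (ω : Family L₀ L₁ W) :
    contr₁ 𝕜 a (derivTerm₁ g ω) = contr₁ 𝕜 (g a) ω + derivTerm₁ g (contr₁ 𝕜 a ω) := by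
  funext m k y α
  change ∑ i : Fin (k + 1), _ = _
  rw [Fin.sum_univ_succ]
  simp [derivTerm₁, contr₁_apply, update_vecCons_zero, update_vecCons_succ]

theorem contr₀_pairTerm (x : L₀) (ψ : L₀ →ₗ[𝕜] L₀ →ₗ[𝕜] L₁) (ω : Family L₀ L₁ W) :
    contr₀ 𝕜 x (pairTerm ψ ω) = convertTerm (ψ x) ω + pairTerm ψ (contr₀ 𝕜 x ω) := by
  funext m k y α
  rcases m with _ | m
  · exact (add_zero _).symm
  change ∑ i : Fin (m + 2), ∑ j : Fin (m + 1), _ = _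
  rw [Fin.sum_univ_succ]
  simp only [Pi.add_apply]
  congr 1
  · simp [convertTerm]
  · rcases m with _ | m
    · simp [pairTerm]
    · simp only [pairTerm, LinearMap.coe_mk, AddHom.coe_mk]
      refine Finset.sum_congr rfl fun i _ => ?_
      rw [Fin.sum_univ_succ]
      simp [contr₀_apply, removeNth_succ_vecCons, pow_succ, pow_add]

theorem contr₁_insertTerm (a : L₁) (d : L₁ →ₗ[𝕜] L₀) (ω : Family L₀ L₁ W) :
    contr₁ 𝕜 a (insertTerm d ω) = contr₀ 𝕜 (d a) ω + insertTerm d (contr₁ 𝕜 a ω) := by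
  funext m k y α
  change ∑ i : Fin (k + 1), _ = _
  rw [Fin.sum_univ_succ]
  simp only [Pi.add_apply]
  congr 1
  rcases k with _ | k
  · simp [insertTerm]
  · simp [insertTerm, contr₁_apply, removeNth_succ_vecCons]

theorem contr₀_actionTerm (x : L₀) (l : L₀ →ₗ[𝕜] W →ₗ[𝕜] W) (ω : Family L₀ L₁ W) :
    contr₀ 𝕜 x (actionTerm l ω) = valueMap (l x) ω - actionTerm l (contr₀ 𝕜 x ω) := by
  funext m k y α
  change ∑ i : Fin (m + 1), _ = _
  rw [Fin.sum_univ_succ]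
  simp only [Fin.val_zero, pow_zero, one_smul, removeNth_zero_vecCons, Matrix.cons_val_zero]
  rcases m with _ | m
  · simp [actionTerm, valueMap]
  · simp [actionTerm, valueMap, contr₀_apply, removeNth_succ_vecCons, pow_succ, sub_eq_add_neg]

theorem contr₁_actionTerm (a : L₁) (l : L₀ →ₗ[𝕜] W →ₗ[𝕜] W) (ω : Family L₀ L₁ W) :
    contr₁ 𝕜 a (actionTerm l ω) = actionTerm l (contr₁ 𝕜 a ω) := by
  funext m k y α
  cases m <;> rfl

theorem contr₀_bracketTerm (x : L₀) (b : L₀ →ₗ[𝕜] L₀ →ₗ[𝕜] L₀) (ω : Family L₀ L₁ W) :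
    contr₀ 𝕜 x (bracketTerm b ω) = -derivTerm₀ (b x) ω - bracketTerm b (contr₀ 𝕜 x ω) := by
  funext m k y α
  change ∑ i : Fin (m + 1), ∑ j ∈ Finset.Ioi i, _ = _
  rw [Fin.sum_univ_succ, Fin.sum_Ioi_zero]
  simp only [Fin.sum_Ioi_succ, update_vecCons_succ, Matrix.cons_val_succ, Matrix.cons_val_zero]
  rcases m with _ | m
  · simp [bracketTerm, derivTerm₀]
  · simp [bracketTerm, derivTerm₀, contr₀_apply, removeNth_succ_vecCons, pow_succ,
      sub_eq_add_neg]

theorem contr₁_bracketTerm (a : L₁) (b : L₀ →ₗ[𝕜] L₀ →ₗ[𝕜] L₀) (ω : Family L₀ L₁ W) :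
    contr₁ 𝕜 a (bracketTerm b ω) = bracketTerm b (contr₁ 𝕜 a ω) := by
  funext m k y α
  cases m <;> rfl

theorem contr₀_mixedBracketTerm (x : L₀) (c : L₁ →ₗ[𝕜] L₀ →ₗ[𝕜] L₁) (ω : Family L₀ L₁ W) :
    contr₀ 𝕜 x (mixedBracketTerm c ω) =
      derivTerm₁ (c.flip x) ω - mixedBracketTerm c (contr₀ 𝕜 x ω) := by
  funext m k y α
  change ∑ i : Fin (m + 1), ∑ j : Fin k, _ = _
  rw [Fin.sum_univ_succ]
  simp only [Fin.val_zero, pow_zero, one_smul, removeNth_zero_vecCons, Matrix.cons_val_zero]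
  rcases m with _ | m
  · simp [mixedBracketTerm, derivTerm₁]
  · simp [mixedBracketTerm, derivTerm₁, contr₀_apply, removeNth_succ_vecCons, pow_succ,
      sub_eq_add_neg]

theorem contr₁_mixedBracketTerm (a : L₁) (c : L₁ →ₗ[𝕜] L₀ →ₗ[𝕜] L₁) (ω : Family L₀ L₁ W) :
    contr₁ 𝕜 a (mixedBracketTerm c ω) =
      convertTerm (c a) ω + mixedBracketTerm c (contr₁ 𝕜 a ω) := by
  funext m k y α
  rcases m with _ | m
  · exact (add_zero _).symm
  simp [mixedBracketTerm, convertTerm, contr₁_apply, Fin.sum_univ_succ (n := k),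
    update_vecCons_zero, update_vecCons_succ, Finset.sum_add_distrib]

theorem contr₀_tripleBracketTerm (x : L₀) (t : L₀ →ₗ[𝕜] L₀ →ₗ[𝕜] L₀ →ₗ[𝕜] L₁)
    (ω : Family L₀ L₁ W) : contr₀ 𝕜 x (tripleBracketTerm t ω) =
      pairTerm (t x) ω - tripleBracketTerm t (contr₀ 𝕜 x ω) := by
  funext m k y α
  rcases m with _ | _ | m
  iterate 2 exact (sub_zero _).symm
  change ∑ i : Fin (m + 3), ∑ j : Fin (m + 2), ∑ r : Fin (m + 1), _ = _
  rw [Fin.sum_univ_succ, Pi.sub_apply, Pi.sub_apply, Pi.sub_apply, Pi.sub_apply, sub_eq_add_neg]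
  congr 1
  · simp [pairTerm]
  · rcases m with _ | m
    · simp [tripleBracketTerm]
    · simp only [tripleBracketTerm, LinearMap.coe_mk, AddHom.coe_mk, ← Finset.sum_neg_distrib]
      refine Finset.sum_congr rfl fun i _ => ?_
      rw [Fin.sum_univ_succ, Finset.sum_eq_zero (fun r _ => if_neg (by simp)), zero_add]
      refine Finset.sum_congr rfl fun j _ => ?_
      rw [Fin.sum_univ_succ, if_neg (by simp), zero_add]
      refine Finset.sum_congr rfl fun r _ => ?_
      simp only [contr₀_apply, removeNth_succ_vecCons, Fin.val_succ, Matrix.cons_val_succ,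
        add_le_add_iff_right]
      split_ifs
      · rw [← neg_smul]
        congr 1
        ring
      · exact neg_zero.symm

end Operators

end Family

/-! ### Weakly skew-symmetric families -/

namespace Family

section Cochains

variable {𝕜 L₁ L₀ W W' : Type*} [Field 𝕜] [AddCommGroup L₁] [Module 𝕜 L₁]
  [AddCommGroup L₀] [Module 𝕜 L₀] [AddCommGroup W] [Module 𝕜 W] [AddCommGroup W'] [Module 𝕜 W']

/-- The families that satisfy multilinearity, symmetry and weak skew-symmetry in their leading
arguments, expressed through contractions. -/
def firstRelations (W : Type*) [AddCommGroup W] [Module 𝕜 W] (h : L₀ →ₗ[𝕜] L₀ →ₗ[𝕜] L₁) :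
    Submodule 𝕜 (Family L₀ L₁ W) where
  carrier := {ω |
    (∀ (x y : L₀) (c : 𝕜), contr₀ 𝕜 (x + c • y) ω = contr₀ 𝕜 x ω + c • contr₀ 𝕜 y ω) ∧
    (∀ (a b : L₁) (c : 𝕜), contr₁ 𝕜 (a + c • b) ω = contr₁ 𝕜 a ω + c • contr₁ 𝕜 b ω) ∧
    (∀ a b : L₁, contr₁ 𝕜 a (contr₁ 𝕜 b ω) = contr₁ 𝕜 b (contr₁ 𝕜 a ω)) ∧
    (∀ x y : L₀, contr₀ 𝕜 x (contr₀ 𝕜 y ω) =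
      -contr₀ 𝕜 y (contr₀ 𝕜 x ω) - contr₁ 𝕜 (h x y) ω)}
  zero_mem' := by simp
  add_mem' := by
    rintro ω η ⟨h1, h2, h3, h4⟩ ⟨g1, g2, g3, g4⟩
    refine ⟨fun x y c => ?_, fun a b c => ?_, fun a b => ?_, fun x y => ?_⟩
    · simp only [map_add, h1, g1]; module
    · simp only [map_add, h2, g2]; module
    · simp only [map_add, h3 a b, g3 a b]
    · simp only [map_add, h4 x y, g4 x y]; abel
  smul_mem' := by
    rintro r ω ⟨h1, h2, h3, h4⟩
    refine ⟨fun x y c => ?_, fun a b c => ?_, fun a b => ?_, fun x y => ?_⟩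
    · simp only [map_smul, h1]; module
    · simp only [map_smul, h2]; module
    · simp only [map_smul, h3 a b]
    · simp only [map_smul, h4 x y]; module

/-- The multilinear families, symmetric in the arguments from `L₁`, with the weak skew-symmetry
governed by `h`, of arbitrary weights: the largest subspace of `firstRelations W h` that is stable
under all contractions.  In this form every relation is needed in the leading arguments only.  For
`h = 0` these are the families skew-symmetric in the arguments from `L₀`. -/
def weakFamilies (W : Type*) [AddCommGroup W] [Module 𝕜 W] (h : L₀ →ₗ[𝕜] L₀ →ₗ[𝕜] L₁) :
    Submodule 𝕜 (Family L₀ L₁ W) :=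
  sSup {S | S ≤ firstRelations W h ∧ (∀ x, S ≤ S.comap (contr₀ 𝕜 x)) ∧
    ∀ a, S ≤ S.comap (contr₁ 𝕜 a)}

variable {h : L₀ →ₗ[𝕜] L₀ →ₗ[𝕜] L₁}

/-- Coinduction principle for `weakFamilies`. -/
theorem mem_weakFamilies_of_closed (S : Set (Family L₀ L₁ W))
    (hS : ∀ ω ∈ S, ω ∈ firstRelations W h) (h₀ : ∀ ω ∈ S, ∀ x, contr₀ 𝕜 x ω ∈ S)
    (h₁ : ∀ ω ∈ S, ∀ a, contr₁ 𝕜 a ω ∈ S) {ω : Family L₀ L₁ W} (hω : ω ∈ S) :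
    ω ∈ weakFamilies W h := by
  have key : Submodule.span 𝕜 S ≤ weakFamilies W h := le_sSup
    ⟨Submodule.span_le.2 hS,
      fun x => Submodule.span_le.2 fun η hη => Submodule.subset_span (h₀ η hη x),
      fun a => Submodule.span_le.2 fun η hη => Submodule.subset_span (h₁ η hη a)⟩
  exact key (Submodule.subset_span hω)

variable {ω : Family L₀ L₁ W}

theorem firstRelations_of_mem (hω : ω ∈ weakFamilies W h) : ω ∈ firstRelations W h :=
  (sSup_le fun _ hS => hS.1 : weakFamilies W h ≤ firstRelations W h) hω

theorem contr₀_mem (hω : ω ∈ weakFamilies W h) (x : L₀) : contr₀ 𝕜 x ω ∈ weakFamilies W h :=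
  (sSup_le fun _ hS => (hS.2.1 x).trans (Submodule.comap_mono (le_sSup hS)) :
    weakFamilies W h ≤ (weakFamilies W h).comap (contr₀ 𝕜 x)) hω

theorem contr₁_mem (hω : ω ∈ weakFamilies W h) (a : L₁) : contr₁ 𝕜 a ω ∈ weakFamilies W h :=
  (sSup_le fun _ hS => (hS.2.2 a).trans (Submodule.comap_mono (le_sSup hS)) :
    weakFamilies W h ≤ (weakFamilies W h).comap (contr₁ 𝕜 a)) hω

theorem contr₀_add_smul (hω : ω ∈ weakFamilies W h) (x y : L₀) (c : 𝕜) :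
    contr₀ 𝕜 (x + c • y) ω = contr₀ 𝕜 x ω + c • contr₀ 𝕜 y ω :=
  (firstRelations_of_mem hω).1 x y c

theorem contr₁_add_smul (hω : ω ∈ weakFamilies W h) (a b : L₁) (c : 𝕜) :
    contr₁ 𝕜 (a + c • b) ω = contr₁ 𝕜 a ω + c • contr₁ 𝕜 b ω :=
  (firstRelations_of_mem hω).2.1 a b c

theorem contr₁_comm (hω : ω ∈ weakFamilies W h) (a b : L₁) :
    contr₁ 𝕜 a (contr₁ 𝕜 b ω) = contr₁ 𝕜 b (contr₁ 𝕜 a ω) :=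
  (firstRelations_of_mem hω).2.2.1 a b

theorem contr₀_anticomm (hω : ω ∈ weakFamilies W h) (x y : L₀) :
    contr₀ 𝕜 x (contr₀ 𝕜 y ω) = -contr₀ 𝕜 y (contr₀ 𝕜 x ω) - contr₁ 𝕜 (h x y) ω :=
  (firstRelations_of_mem hω).2.2.2 x y

theorem contr₁_sub (hω : ω ∈ weakFamilies W h) (a b : L₁) :
    contr₁ 𝕜 (a - b) ω = contr₁ 𝕜 a ω - contr₁ 𝕜 b ω := by
  simpa [sub_eq_add_neg] using contr₁_add_smul hω a b (-1)

theorem contr₁_zero (hω : ω ∈ weakFamilies W h) : contr₁ 𝕜 (0 : L₁) ω = 0 := by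
  simpa using contr₁_sub hω 0 0

theorem contr₁_neg (hω : ω ∈ weakFamilies W h) (a : L₁) :
    contr₁ 𝕜 (-a) ω = -contr₁ 𝕜 a ω := by
  simpa [contr₁_zero hω] using contr₁_sub hω 0 a

theorem contr₀_sub (hω : ω ∈ weakFamilies W h) (a b : L₀) :
    contr₀ 𝕜 (a - b) ω = contr₀ 𝕜 a ω - contr₀ 𝕜 b ω := by
  simpa [sub_eq_add_neg] using contr₀_add_smul hω a b (-1)

theorem contr₀_zero (hω : ω ∈ weakFamilies W h) : contr₀ 𝕜 (0 : L₀) ω = 0 := by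
  simpa using contr₀_sub hω 0 0

theorem contr₀_neg (hω : ω ∈ weakFamilies W h) (a : L₀) :
    contr₀ 𝕜 (-a) ω = -contr₀ 𝕜 a ω := by
  simpa [contr₀_zero hω] using contr₀_sub hω 0 a

theorem contr₀_anticomm_zero (hω : ω ∈ weakFamilies W (0 : L₀ →ₗ[𝕜] L₀ →ₗ[𝕜] L₁)) (x y : L₀) :
    contr₀ 𝕜 x (contr₀ 𝕜 y ω) = -contr₀ 𝕜 y (contr₀ 𝕜 x ω) := by
  simpa [contr₁_zero hω] using contr₀_anticomm hω x y

/-! ### Identities of operators, checked on contractions -/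

/-- An operator `E` on a set `S` of families vanishes if its components without arguments from `L₀`
vanish and its contractions are multiples of its values at elements of `S` again.  Nearly all
operator identities below are proved by this principle or one of its variants, so that only
recursion formulas enter and no sums over indices. -/
theorem eq_zero_of_contr₀ (𝕜 : Type*) [Field 𝕜] [Module 𝕜 L₁] [Module 𝕜 L₀] [Module 𝕜 W]
    [Module 𝕜 W'] {S : Set (Family L₀ L₁ W)} (E : Family L₀ L₁ W → Family L₀ L₁ W')
    (h₀ : ∀ ω ∈ S, ∀ k, E ω 0 k = 0)
    (hE : ∀ ω ∈ S, ∀ x, ∃ η ∈ S, ∃ s : 𝕜, contr₀ 𝕜 x (E ω) = s • E η) :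
    ∀ ω ∈ S, E ω = 0 := by
  have key : ∀ m, ∀ ω ∈ S, ∀ k, E ω m k = 0 := by
    intro m
    induction m with
    | zero => exact h₀
    | succ m ih =>
      intro ω hω k
      funext x α
      obtain ⟨η, hη, s, e⟩ := hE ω hω (Matrix.vecHead x)
      have := congrFun (congrFun (congrFun (congrFun e m) k) (Matrix.vecTail x)) α
      rw [contr₀_apply, Matrix.cons_head_tail] at this
      simp [this, ih η hη k]
  exact fun ω hω => funext fun m => funext fun k => key m ω hω k

theorem eq_zero_of_contr₁ (𝕜 : Type*) [Field 𝕜] [Module 𝕜 L₁] [Module 𝕜 L₀] [Module 𝕜 W]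
    [Module 𝕜 W'] {S : Set (Family L₀ L₁ W)} (E : Family L₀ L₁ W → Family L₀ L₁ W')
    (h₀ : ∀ ω ∈ S, ∀ m, E ω m 0 = 0)
    (hE : ∀ ω ∈ S, ∀ a, ∃ η ∈ S, ∃ s : 𝕜, contr₁ 𝕜 a (E ω) = s • E η) :
    ∀ ω ∈ S, E ω = 0 := by
  have key : ∀ k, ∀ ω ∈ S, ∀ m, E ω m k = 0 := by
    intro k
    induction k with
    | zero => exact h₀
    | succ k ih =>
      intro ω hω m
      funext x α
      obtain ⟨η, hη, s, e⟩ := hE ω hω (Matrix.vecHead α)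
      have := congrFun (congrFun (congrFun (congrFun e m) k) x) (Matrix.vecTail α)
      rw [contr₁_apply, Matrix.cons_head_tail] at this
      simp [this, ih η hη m]
  exact fun ω hω => funext fun m => funext fun k => key k ω hω m

theorem eq_zero_of_contr (𝕜 : Type*) [Field 𝕜] [Module 𝕜 L₁] [Module 𝕜 L₀] [Module 𝕜 W]
    [Module 𝕜 W'] {S : Set (Family L₀ L₁ W)} (E : Family L₀ L₁ W → Family L₀ L₁ W')
    (h₀₀ : ∀ ω ∈ S, E ω 0 0 = 0)
    (hE₀ : ∀ ω ∈ S, ∀ x, ∃ η ∈ S, ∃ s : 𝕜, contr₀ 𝕜 x (E ω) = s • E η)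
    (hE₁ : ∀ ω ∈ S, ∀ a, ∃ η ∈ S, ∃ s : 𝕜, contr₁ 𝕜 a (E ω) = s • E η) :
    ∀ ω ∈ S, E ω = 0 := by
  refine eq_zero_of_contr₀ 𝕜 E (fun ω hω k => ?_) hE₀
  induction k generalizing ω with
  | zero => exact h₀₀ ω hω
  | succ k ih =>
    funext x α
    obtain ⟨η, hη, s, e⟩ := hE₁ ω hω (Matrix.vecHead α)
    have := congrFun (congrFun (congrFun (congrFun e 0) k) x) (Matrix.vecTail α)
    rw [contr₁_apply, Matrix.cons_head_tail] at this
    simp [this, ih η hη]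

/-- An operator that satisfies the leading relations preserves weak skew-symmetry, provided that it
commutes with the contractions up to a sign and terms which are already known to be weakly
skew-symmetric. -/
theorem mem_of_contr (Op : Family L₀ L₁ W →ₗ[𝕜] Family L₀ L₁ W') (s : 𝕜)
    (hR : ∀ ω ∈ weakFamilies W h, Op ω ∈ firstRelations W' h)
    (h₀ : ∀ ω ∈ weakFamilies W h, ∀ x,
      ∃ η ∈ weakFamilies W' h, contr₀ 𝕜 x (Op ω) = η + s • Op (contr₀ 𝕜 x ω))
    (h₁ : ∀ ω ∈ weakFamilies W h, ∀ a,
      ∃ η ∈ weakFamilies W' h, contr₁ 𝕜 a (Op ω) = η + Op (contr₁ 𝕜 a ω))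
    (hω : ω ∈ weakFamilies W h) : Op ω ∈ weakFamilies W' h := by
  refine mem_weakFamilies_of_closed
    {θ | ∃ ω ∈ weakFamilies W h, ∃ η ∈ weakFamilies W' h, θ = Op ω + η} ?_ ?_ ?_
    ⟨ω, hω, 0, zero_mem _, (add_zero _).symm⟩
  · rintro _ ⟨ω, hω, η, hη, rfl⟩
    exact add_mem (hR ω hω) (firstRelations_of_mem hη)
  · rintro _ ⟨ω, hω, η, hη, rfl⟩ x
    obtain ⟨θ, hθ, e⟩ := h₀ ω hω x
    refine ⟨s • contr₀ 𝕜 x ω, Submodule.smul_mem _ _ (contr₀_mem hω x), _,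
      add_mem hθ (contr₀_mem hη x), ?_⟩
    rw [map_add, e, map_smul]
    abel
  · rintro _ ⟨ω, hω, η, hη, rfl⟩ a
    obtain ⟨θ, hθ, e⟩ := h₁ ω hω a
    refine ⟨contr₁ 𝕜 a ω, contr₁_mem hω a, _, add_mem hθ (contr₁_mem hη a), ?_⟩
    rw [map_add, e]
    abel

/-! ### Linear dependence of the operators on their parameters -/

theorem convertTerm_add_smul (hω : ω ∈ weakFamilies W h) (φ ψ : L₀ →ₗ[𝕜] L₁) (c : 𝕜) :
    convertTerm (φ + c • ψ) ω = convertTerm φ ω + c • convertTerm ψ ω := by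
  refine sub_eq_zero.1 (eq_zero_of_contr₀ 𝕜 (S := weakFamilies W h)
    (fun ω => convertTerm (φ + c • ψ) ω - (convertTerm φ ω + c • convertTerm ψ ω))
    (fun ω _ k => ?_) (fun ω hω x => ⟨_, contr₀_mem hω x, -1, ?_⟩) ω hω)
  · simp [convertTerm]
  · simp only [map_sub, map_add, map_smul, contr₀_convertTerm, LinearMap.add_apply,
      LinearMap.smul_apply, contr₁_add_smul hω]
    module

theorem derivTerm₀_add_smul (hω : ω ∈ weakFamilies W h) (φ ψ : L₀ →ₗ[𝕜] L₀) (c : 𝕜) :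
    derivTerm₀ (φ + c • ψ) ω = derivTerm₀ φ ω + c • derivTerm₀ ψ ω := by
  refine sub_eq_zero.1 (eq_zero_of_contr₀ 𝕜 (S := weakFamilies W h)
    (fun ω => derivTerm₀ (φ + c • ψ) ω - (derivTerm₀ φ ω + c • derivTerm₀ ψ ω))
    (fun ω _ k => ?_) (fun ω hω x => ⟨_, contr₀_mem hω x, 1, ?_⟩) ω hω)
  · funext
    simp [derivTerm₀]
  · simp only [map_sub, map_add, map_smul, contr₀_derivTerm₀, LinearMap.add_apply,
      LinearMap.smul_apply, contr₀_add_smul hω]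
    module

theorem derivTerm₁_add_smul (hω : ω ∈ weakFamilies W h) (φ ψ : L₁ →ₗ[𝕜] L₁) (c : 𝕜) :
    derivTerm₁ (φ + c • ψ) ω = derivTerm₁ φ ω + c • derivTerm₁ ψ ω := by
  refine sub_eq_zero.1 (eq_zero_of_contr₁ 𝕜 (S := weakFamilies W h)
    (fun ω => derivTerm₁ (φ + c • ψ) ω - (derivTerm₁ φ ω + c • derivTerm₁ ψ ω))
    (fun ω _ k => ?_) (fun ω hω a => ⟨_, contr₁_mem hω a, 1, ?_⟩) ω hω)
  · funext
    simp [derivTerm₁]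
  · simp only [map_sub, map_add, map_smul, contr₁_derivTerm₁, LinearMap.add_apply,
      LinearMap.smul_apply, contr₁_add_smul hω]
    module

theorem pairTerm_add_smul (hω : ω ∈ weakFamilies W h) (φ ψ : L₀ →ₗ[𝕜] L₀ →ₗ[𝕜] L₁) (c : 𝕜) :
    pairTerm (φ + c • ψ) ω = pairTerm φ ω + c • pairTerm ψ ω := by
  refine sub_eq_zero.1 (eq_zero_of_contr₀ 𝕜 (S := weakFamilies W h)
    (fun ω => pairTerm (φ + c • ψ) ω - (pairTerm φ ω + c • pairTerm ψ ω))
    (fun ω _ k => ?_) (fun ω hω x => ⟨_, contr₀_mem hω x, 1, ?_⟩) ω hω)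
  · simp [pairTerm]
  · simp only [map_sub, map_add, map_smul, contr₀_pairTerm, LinearMap.add_apply,
      LinearMap.smul_apply, convertTerm_add_smul hω]
    module

theorem convertTerm_sub (hω : ω ∈ weakFamilies W h) (φ ψ : L₀ →ₗ[𝕜] L₁) :
    convertTerm (φ - ψ) ω = convertTerm φ ω - convertTerm ψ ω := by
  simpa [sub_eq_add_neg] using convertTerm_add_smul hω φ ψ (-1)

theorem convertTerm_zero (hω : ω ∈ weakFamilies W h) :
    convertTerm (0 : L₀ →ₗ[𝕜] L₁) ω = 0 := by
  simpa using convertTerm_sub hω 0 0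

theorem convertTerm_neg (hω : ω ∈ weakFamilies W h) (φ : L₀ →ₗ[𝕜] L₁) :
    convertTerm (-φ) ω = -convertTerm φ ω := by
  simpa [convertTerm_zero hω] using convertTerm_sub hω 0 φ

theorem derivTerm₁_zero (hω : ω ∈ weakFamilies W h) :
    derivTerm₁ (0 : L₁ →ₗ[𝕜] L₁) ω = 0 := by
  have := derivTerm₁_add_smul hω (0 : L₁ →ₗ[𝕜] L₁) 0 (-1)
  simpa using this

theorem pairTerm_zero (hω : ω ∈ weakFamilies W h) :
    pairTerm (0 : L₀ →ₗ[𝕜] L₀ →ₗ[𝕜] L₁) ω = 0 := by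
  have := pairTerm_add_smul hω (0 : L₀ →ₗ[𝕜] L₀ →ₗ[𝕜] L₁) 0 (-1)
  simpa using this

/-! ### Commutation relations and stability of weak skew-symmetry -/

theorem contr₁_convertTerm (hω : ω ∈ weakFamilies W h) (a : L₁) (φ : L₀ →ₗ[𝕜] L₁) :
    contr₁ 𝕜 a (convertTerm φ ω) = convertTerm φ (contr₁ 𝕜 a ω) := by
  refine sub_eq_zero.1 (eq_zero_of_contr₀ 𝕜 (S := weakFamilies W h)
    (fun ω => contr₁ 𝕜 a (convertTerm φ ω) - convertTerm φ (contr₁ 𝕜 a ω))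
    (fun ω _ k => ?_) (fun ω hω x => ⟨_, contr₀_mem hω x, -1, ?_⟩) ω hω)
  · funext
    simp [convertTerm, contr₁_apply]
  · simp only [map_sub, ← contr₁_contr₀, contr₀_convertTerm, contr₁_comm hω a]
    module

theorem contr₁_pairTerm (hω : ω ∈ weakFamilies W h) (a : L₁) (ψ : L₀ →ₗ[𝕜] L₀ →ₗ[𝕜] L₁) :
    contr₁ 𝕜 a (pairTerm ψ ω) = pairTerm ψ (contr₁ 𝕜 a ω) := by
  refine sub_eq_zero.1 (eq_zero_of_contr₀ 𝕜 (S := weakFamilies W h)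
    (fun ω => contr₁ 𝕜 a (pairTerm ψ ω) - pairTerm ψ (contr₁ 𝕜 a ω))
    (fun ω _ k => ?_) (fun ω hω x => ⟨_, contr₀_mem hω x, 1, ?_⟩) ω hω)
  · funext
    simp [pairTerm, contr₁_apply]
  · simp only [map_sub, map_add, ← contr₁_contr₀, contr₀_pairTerm, contr₁_convertTerm hω]
    module

theorem contr₁_tripleBracketTerm (hω : ω ∈ weakFamilies W h) (a : L₁)
    (t : L₀ →ₗ[𝕜] L₀ →ₗ[𝕜] L₀ →ₗ[𝕜] L₁) :
    contr₁ 𝕜 a (tripleBracketTerm t ω) = tripleBracketTerm t (contr₁ 𝕜 a ω) := by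
  refine sub_eq_zero.1 (eq_zero_of_contr₀ 𝕜 (S := weakFamilies W h)
    (fun ω => contr₁ 𝕜 a (tripleBracketTerm t ω) - tripleBracketTerm t (contr₁ 𝕜 a ω))
    (fun ω _ k => ?_) (fun ω hω x => ⟨_, contr₀_mem hω x, -1, ?_⟩) ω hω)
  · funext
    simp [tripleBracketTerm, contr₁_apply]
  · simp only [map_sub, ← contr₁_contr₀, contr₀_tripleBracketTerm, contr₁_pairTerm hω]
    module

/-- On weakly skew-symmetric families, contraction with `x` anticommutes with `insertTerm d` up to
the derivation extending `α ↦ h(x, dα)`. -/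
theorem contr₀_insertTerm (hω : ω ∈ weakFamilies W h) (x : L₀) (d : L₁ →ₗ[𝕜] L₀) :
    contr₀ 𝕜 x (insertTerm d ω) = -derivTerm₁ (h x ∘ₗ d) ω - insertTerm d (contr₀ 𝕜 x ω) := by
  refine sub_eq_zero.1 (eq_zero_of_contr₁ 𝕜 (S := weakFamilies W h)
    (fun ω => contr₀ 𝕜 x (insertTerm d ω) -
      (-derivTerm₁ (h x ∘ₗ d) ω - insertTerm d (contr₀ 𝕜 x ω)))
    (fun ω _ k => ?_) (fun ω hω a => ⟨_, contr₁_mem hω a, 1, ?_⟩) ω hω)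
  · funext
    simp [insertTerm, contr₀_apply, derivTerm₁]
  · simp only [map_sub, map_add, map_neg, contr₁_contr₀, contr₁_insertTerm, contr₁_derivTerm₁,
      contr₀_anticomm hω x, LinearMap.comp_apply]
    module

theorem convertTerm_convertTerm (hω : ω ∈ weakFamilies W h) (φ ψ : L₀ →ₗ[𝕜] L₁) :
    convertTerm φ (convertTerm ψ ω) = -convertTerm ψ (convertTerm φ ω) := by
  refine sub_eq_zero.1 (eq_zero_of_contr₀ 𝕜 (S := weakFamilies W h)
    (fun ω => convertTerm φ (convertTerm ψ ω) - -convertTerm ψ (convertTerm φ ω))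
    (fun ω _ k => ?_) (fun ω hω x => ⟨_, contr₀_mem hω x, 1, ?_⟩) ω hω)
  · simp [convertTerm]
  · simp only [map_sub, map_neg, contr₀_convertTerm, contr₁_convertTerm hω]
    module

theorem convertTerm_mem (hω : ω ∈ weakFamilies W h) (φ : L₀ →ₗ[𝕜] L₁) :
    convertTerm φ ω ∈ weakFamilies W h := by
  refine mem_of_contr (convertTerm φ) (-1) (fun ω hω => ⟨fun x y c => ?_, fun a b c => ?_,
    fun a b => ?_, fun x y => ?_⟩) (fun ω hω x => ⟨_, contr₁_mem hω (φ x), ?_⟩)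
    (fun ω hω a => ⟨0, zero_mem _, ?_⟩) hω
  · simp only [contr₀_convertTerm, map_add, map_smul, contr₁_add_smul hω, contr₀_add_smul hω]
    module
  · simp only [contr₁_convertTerm hω, map_add, map_smul, contr₁_add_smul hω]
  · simp only [contr₁_convertTerm hω, contr₁_convertTerm (contr₁_mem hω _), contr₁_comm hω a b]
  · simp only [contr₀_convertTerm, map_sub, map_neg, ← contr₁_contr₀, contr₁_convertTerm hω,
      contr₀_anticomm hω x y]
    module
  · rw [contr₀_convertTerm]
    module
  · rw [contr₁_convertTerm hω, zero_add]

theorem valueMap_mem (hω : ω ∈ weakFamilies W h) (g : W →ₗ[𝕜] W') :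
    valueMap g ω ∈ weakFamilies W' h := by
  refine mem_of_contr (valueMap g) 1 (fun ω hω => ⟨fun x y c => ?_, fun a b c => ?_,
    fun a b => ?_, fun x y => ?_⟩) (fun ω hω x => ⟨0, zero_mem _, ?_⟩)
    (fun ω hω a => ⟨0, zero_mem _, ?_⟩) hω
  · simp only [contr₀_valueMap, map_add, map_smul, contr₀_add_smul hω]
  · simp only [contr₁_valueMap, map_add, map_smul, contr₁_add_smul hω]
  · simp only [contr₁_valueMap, contr₁_comm hω a b]
  · simp only [contr₀_valueMap, contr₁_valueMap, contr₀_anticomm hω x y, map_sub, map_neg]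
  · rw [contr₀_valueMap, one_smul, zero_add]
  · rw [contr₁_valueMap, zero_add]

theorem derivTerm₀_mem (hω : ω ∈ weakFamilies W (0 : L₀ →ₗ[𝕜] L₀ →ₗ[𝕜] L₁))
    (f : L₀ →ₗ[𝕜] L₀) : derivTerm₀ f ω ∈ weakFamilies W (0 : L₀ →ₗ[𝕜] L₀ →ₗ[𝕜] L₁) := by
  refine mem_of_contr (derivTerm₀ f) 1 (fun ω hω => ⟨fun x y c => ?_, fun a b c => ?_,
    fun a b => ?_, fun x y => ?_⟩) (fun ω hω x => ⟨_, contr₀_mem hω (f x), ?_⟩)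
    (fun ω hω a => ⟨0, zero_mem _, ?_⟩) hω
  · simp only [contr₀_derivTerm₀, map_add, map_smul, contr₀_add_smul hω]
    module
  · simp only [contr₁_derivTerm₀, map_add, map_smul, contr₁_add_smul hω]
  · simp only [contr₁_derivTerm₀, contr₁_comm hω a b]
  · simp only [contr₀_derivTerm₀, map_add, contr₀_anticomm_zero hω x, contr₁_derivTerm₀,
      contr₀_anticomm_zero hω (f x), LinearMap.zero_apply, contr₁_zero hω, map_zero, map_neg]
    module
  · rw [contr₀_derivTerm₀, one_smul]
  · rw [contr₁_derivTerm₀, zero_add]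

theorem derivTerm₁_mem (hω : ω ∈ weakFamilies W (0 : L₀ →ₗ[𝕜] L₀ →ₗ[𝕜] L₁))
    (g : L₁ →ₗ[𝕜] L₁) : derivTerm₁ g ω ∈ weakFamilies W (0 : L₀ →ₗ[𝕜] L₀ →ₗ[𝕜] L₁) := by
  refine mem_of_contr (derivTerm₁ g) 1 (fun ω hω => ⟨fun x y c => ?_, fun a b c => ?_,
    fun a b => ?_, fun x y => ?_⟩) (fun ω hω x => ⟨0, zero_mem _, ?_⟩)
    (fun ω hω a => ⟨_, contr₁_mem hω (g a), ?_⟩) hω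
  · simp only [contr₀_derivTerm₁, map_add, map_smul, contr₀_add_smul hω]
  · simp only [contr₁_derivTerm₁, map_add, map_smul, contr₁_add_smul hω]
    module
  · simp only [contr₁_derivTerm₁, map_add, contr₁_comm hω a, contr₁_comm hω (g a)]
    module
  · simp only [contr₀_derivTerm₁, contr₀_anticomm_zero hω x, contr₁_derivTerm₁, map_neg,
      LinearMap.zero_apply, contr₁_zero hω, map_zero]
    module
  · rw [contr₀_derivTerm₁, one_smul, zero_add]
  · rw [contr₁_derivTerm₁]

theorem pairTerm_mem (hω : ω ∈ weakFamilies W (0 : L₀ →ₗ[𝕜] L₀ →ₗ[𝕜] L₁))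
    (ψ : L₀ →ₗ[𝕜] L₀ →ₗ[𝕜] L₁) (hψ : ∀ x y, ψ x y = -ψ y x) :
    pairTerm ψ ω ∈ weakFamilies W (0 : L₀ →ₗ[𝕜] L₀ →ₗ[𝕜] L₁) := by
  refine mem_of_contr (pairTerm ψ) 1 (fun ω hω => ⟨fun x y c => ?_, fun a b c => ?_,
    fun a b => ?_, fun x y => ?_⟩) (fun ω hω x => ⟨_, convertTerm_mem hω (ψ x), ?_⟩)
    (fun ω hω a => ⟨0, zero_mem _, ?_⟩) hω
  · simp only [contr₀_pairTerm, map_add, map_smul, contr₀_add_smul hω, convertTerm_add_smul hω]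
    module
  · simp only [contr₁_pairTerm hω, map_add, map_smul, contr₁_add_smul hω]
  · simp only [contr₁_pairTerm hω, contr₁_pairTerm (contr₁_mem hω _), contr₁_comm hω a b]
  · simp only [contr₀_pairTerm, contr₀_convertTerm, map_add, contr₀_anticomm_zero hω x,
      contr₁_pairTerm hω, hψ y x, contr₁_neg hω, LinearMap.zero_apply, contr₁_zero hω, map_zero,
      map_neg]
    module
  · rw [contr₀_pairTerm, one_smul]
  · rw [contr₁_pairTerm hω, zero_add]

theorem pairTerm_convertTerm (hω : ω ∈ weakFamilies W h) (ψ : L₀ →ₗ[𝕜] L₀ →ₗ[𝕜] L₁)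
    (φ : L₀ →ₗ[𝕜] L₁) :
    pairTerm ψ (convertTerm φ ω) = convertTerm φ (pairTerm ψ ω) := by
  refine sub_eq_zero.1 (eq_zero_of_contr₀ 𝕜 (S := weakFamilies W h)
    (fun ω => pairTerm ψ (convertTerm φ ω) - convertTerm φ (pairTerm ψ ω))
    (fun ω _ k => ?_) (fun ω hω x => ⟨_, contr₀_mem hω x, -1, ?_⟩) ω hω)
  · simp [convertTerm, pairTerm]
  · simp only [map_sub, map_add, contr₀_convertTerm, contr₀_pairTerm, contr₁_pairTerm hω,
      convertTerm_convertTerm hω φ]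
    module

end Cochains

end Family

/-! ### Lie derivatives and differentials -/

namespace Family

section Differential

variable {𝕜 L₁ L₀ W W' : Type*} [Field 𝕜] [AddCommGroup L₁] [Module 𝕜 L₁]
  [AddCommGroup L₀] [Module 𝕜 L₀] [AddCommGroup W] [Module 𝕜 W] [AddCommGroup W'] [Module 𝕜 W']
  {h h' : L₀ →ₗ[𝕜] L₀ →ₗ[𝕜] L₁} {ω : Family L₀ L₁ W}

/-- The Lie derivative along a derivation that acts by `f` on `L₀`, by `g` on `L₁` and by `l` on the
values. -/
def lieTerm (l : W →ₗ[𝕜] W) (f : L₀ →ₗ[𝕜] L₀) (g : L₁ →ₗ[𝕜] L₁) :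
    Family L₀ L₁ W →ₗ[𝕜] Family L₀ L₁ W :=
  valueMap l - derivTerm₀ f - derivTerm₁ g

theorem lieTerm_apply (l : W →ₗ[𝕜] W) (f : L₀ →ₗ[𝕜] L₀) (g : L₁ →ₗ[𝕜] L₁)
    (ω : Family L₀ L₁ W) :
    lieTerm l f g ω = valueMap l ω - derivTerm₀ f ω - derivTerm₁ g ω := rfl

theorem lieTerm_zero_zero (l : W →ₗ[𝕜] W) (f : L₀ →ₗ[𝕜] L₀) (g : L₁ →ₗ[𝕜] L₁)
    (ω : Family L₀ L₁ W) (x : Fin 0 → L₀) (α : Fin 0 → L₁) :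
    lieTerm l f g ω 0 0 x α = l (ω 0 0 x α) := by
  simp [lieTerm_apply, valueMap, derivTerm₀, derivTerm₁]

theorem contr₀_lieTerm (x : L₀) (l : W →ₗ[𝕜] W) (f : L₀ →ₗ[𝕜] L₀) (g : L₁ →ₗ[𝕜] L₁)
    (ω : Family L₀ L₁ W) :
    contr₀ 𝕜 x (lieTerm l f g ω) = lieTerm l f g (contr₀ 𝕜 x ω) - contr₀ 𝕜 (f x) ω := by
  simp only [lieTerm_apply, map_sub, contr₀_valueMap, contr₀_derivTerm₀, contr₀_derivTerm₁]
  abel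

theorem contr₁_lieTerm (a : L₁) (l : W →ₗ[𝕜] W) (f : L₀ →ₗ[𝕜] L₀) (g : L₁ →ₗ[𝕜] L₁)
    (ω : Family L₀ L₁ W) :
    contr₁ 𝕜 a (lieTerm l f g ω) = lieTerm l f g (contr₁ 𝕜 a ω) - contr₁ 𝕜 (g a) ω := by
  simp only [lieTerm_apply, map_sub, contr₁_valueMap, contr₁_derivTerm₀, contr₁_derivTerm₁]
  abel

theorem lieTerm_mem (hω : ω ∈ weakFamilies W (0 : L₀ →ₗ[𝕜] L₀ →ₗ[𝕜] L₁)) (l : W →ₗ[𝕜] W)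
    (f : L₀ →ₗ[𝕜] L₀) (g : L₁ →ₗ[𝕜] L₁) :
    lieTerm l f g ω ∈ weakFamilies W (0 : L₀ →ₗ[𝕜] L₀ →ₗ[𝕜] L₁) :=
  sub_mem (sub_mem (valueMap_mem hω l) (derivTerm₀_mem hω f)) (derivTerm₁_mem hω g)

theorem lieTerm_convertTerm (hω : ω ∈ weakFamilies W h) (l : W →ₗ[𝕜] W) (f : L₀ →ₗ[𝕜] L₀)
    (g : L₁ →ₗ[𝕜] L₁) (φ χ : L₀ →ₗ[𝕜] L₁) (hχ : ∀ x, χ x = g (φ x) - φ (f x)) :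
    lieTerm l f g (convertTerm φ ω) = convertTerm φ (lieTerm l f g ω) + convertTerm χ ω := by
  refine sub_eq_zero.1 (eq_zero_of_contr₀ 𝕜 (S := weakFamilies W h)
    (fun ω => lieTerm l f g (convertTerm φ ω) -
      (convertTerm φ (lieTerm l f g ω) + convertTerm χ ω))
    (fun ω _ k => ?_) (fun ω hω x => ⟨_, contr₀_mem hω x, -1, ?_⟩) ω hω)
  · funext
    simp [lieTerm_apply, valueMap, derivTerm₀, derivTerm₁, convertTerm]
  · simp only [map_sub, map_add, contr₀_lieTerm, contr₀_convertTerm, contr₁_lieTerm, hχ,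
      contr₁_sub hω]
    module

theorem lieTerm_lieTerm (hω : ω ∈ weakFamilies W h) {l l' l'' : W →ₗ[𝕜] W}
    {f f' f'' : L₀ →ₗ[𝕜] L₀} {g g' g'' : L₁ →ₗ[𝕜] L₁}
    (hl : ∀ v, l'' v = l (l' v) - l' (l v)) (hf : ∀ x, f'' x = f (f' x) - f' (f x))
    (hg : ∀ a, g'' a = g (g' a) - g' (g a)) :
    lieTerm l f g (lieTerm l' f' g' ω) - lieTerm l' f' g' (lieTerm l f g ω) =
      lieTerm l'' f'' g'' ω := by
  refine sub_eq_zero.1 (eq_zero_of_contr 𝕜 (S := weakFamilies W h)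
    (fun ω => lieTerm l f g (lieTerm l' f' g' ω) - lieTerm l' f' g' (lieTerm l f g ω) -
      lieTerm l'' f'' g'' ω) (fun ω _ => ?_) (fun ω hω x => ⟨_, contr₀_mem hω x, 1, ?_⟩)
      (fun ω hω a => ⟨_, contr₁_mem hω a, 1, ?_⟩) ω hω)
  · funext
    simp [lieTerm_zero_zero, hl]
  · simp only [map_sub, contr₀_lieTerm, hf, contr₀_sub hω]
    module
  · simp only [map_sub, contr₁_lieTerm, hg, contr₁_sub hω]
    module

/-- The Leibniz differential without 3-bracket, built from `d`, an action `l` and brackets `b` and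
`c`. -/
def baseTerm (d : L₁ →ₗ[𝕜] L₀) (l : L₀ →ₗ[𝕜] W →ₗ[𝕜] W) (b : L₀ →ₗ[𝕜] L₀ →ₗ[𝕜] L₀)
    (c : L₁ →ₗ[𝕜] L₀ →ₗ[𝕜] L₁) : Family L₀ L₁ W →ₗ[𝕜] Family L₀ L₁ W :=
  insertTerm d + actionTerm l + bracketTerm b + mixedBracketTerm c

/-- The Chevalley–Eilenberg differential with the contribution of a 3-bracket `t`. -/
def fullTerm (d : L₁ →ₗ[𝕜] L₀) (l : L₀ →ₗ[𝕜] W →ₗ[𝕜] W) (b : L₀ →ₗ[𝕜] L₀ →ₗ[𝕜] L₀)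
    (c : L₁ →ₗ[𝕜] L₀ →ₗ[𝕜] L₁) (t : L₀ →ₗ[𝕜] L₀ →ₗ[𝕜] L₀ →ₗ[𝕜] L₁) :
    Family L₀ L₁ W →ₗ[𝕜] Family L₀ L₁ W :=
  baseTerm d l b c + tripleBracketTerm t

variable {d : L₁ →ₗ[𝕜] L₀} {l : L₀ →ₗ[𝕜] W →ₗ[𝕜] W} {b : L₀ →ₗ[𝕜] L₀ →ₗ[𝕜] L₀}
    {c : L₁ →ₗ[𝕜] L₀ →ₗ[𝕜] L₁} {t : L₀ →ₗ[𝕜] L₀ →ₗ[𝕜] L₀ →ₗ[𝕜] L₁}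

theorem baseTerm_apply (ω : Family L₀ L₁ W) : baseTerm d l b c ω =
    insertTerm d ω + actionTerm l ω + bracketTerm b ω + mixedBracketTerm c ω := rfl

theorem fullTerm_apply (ω : Family L₀ L₁ W) : fullTerm d l b c t ω =
    insertTerm d ω + actionTerm l ω + bracketTerm b ω + mixedBracketTerm c ω +
      tripleBracketTerm t ω := rfl

theorem baseTerm_zero_zero (ω : Family L₀ L₁ W) : baseTerm d l b c ω 0 0 = 0 := by
  simp [baseTerm_apply, insertTerm, actionTerm, bracketTerm, mixedBracketTerm]

theorem fullTerm_zero_zero (ω : Family L₀ L₁ W) : fullTerm d l b c t ω 0 0 = 0 := by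
  simp [fullTerm_apply, insertTerm, actionTerm, bracketTerm, mixedBracketTerm, tripleBracketTerm]

/-- Cartan formula for weakly skew-symmetric families: the alternator turns the left action
`α ↦ -c(α, x)` into `α ↦ h(x, dα) - c(α, x)`. -/
theorem contr₀_baseTerm (hω : ω ∈ weakFamilies W h) (x : L₀) {g : L₁ →ₗ[𝕜] L₁}
    (hg : ∀ a, g a = h x (d a) - c a x) :
    contr₀ 𝕜 x (baseTerm d l b c ω) =
      lieTerm (l x) (b x) g ω - baseTerm d l b c (contr₀ 𝕜 x ω) := by
  have e : g = h x ∘ₗ d + (-1 : 𝕜) • c.flip x := by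
    ext a
    simp [hg, sub_eq_add_neg]
  simp only [baseTerm_apply, map_add, contr₀_insertTerm hω, contr₀_actionTerm, contr₀_bracketTerm,
    contr₀_mixedBracketTerm, lieTerm_apply, e, derivTerm₁_add_smul hω]
  module

theorem contr₁_baseTerm (ω : Family L₀ L₁ W) (a : L₁) :
    contr₁ 𝕜 a (baseTerm d l b c ω) = contr₀ 𝕜 (d a) ω + convertTerm (c a) ω +
      baseTerm d l b c (contr₁ 𝕜 a ω) := by
  simp only [baseTerm_apply, map_add, contr₁_insertTerm, contr₁_actionTerm, contr₁_bracketTerm,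
    contr₁_mixedBracketTerm]
  abel

theorem contr₀_fullTerm (hω : ω ∈ weakFamilies W (0 : L₀ →ₗ[𝕜] L₀ →ₗ[𝕜] L₁)) (x : L₀) :
    contr₀ 𝕜 x (fullTerm d l b c t ω) = lieTerm (l x) (b x) (-c.flip x) ω + pairTerm (t x) ω -
      fullTerm d l b c t (contr₀ 𝕜 x ω) := by
  simp only [fullTerm, LinearMap.add_apply, map_add,
    contr₀_baseTerm (c := c) hω x (g := -c.flip x) (by simp), contr₀_tripleBracketTerm]
  abel

theorem contr₁_fullTerm (hω : ω ∈ weakFamilies W h) (a : L₁) :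
    contr₁ 𝕜 a (fullTerm d l b c t ω) = contr₀ 𝕜 (d a) ω + convertTerm (c a) ω +
      fullTerm d l b c t (contr₁ 𝕜 a ω) := by
  simp only [fullTerm, LinearMap.add_apply, map_add, contr₁_baseTerm,
    contr₁_tripleBracketTerm hω]
  abel

theorem lieTerm_add_smul (hω : ω ∈ weakFamilies W h) (l l' : W →ₗ[𝕜] W) (f f' : L₀ →ₗ[𝕜] L₀)
    (g g' : L₁ →ₗ[𝕜] L₁) (r : 𝕜) :
    lieTerm (l + r • l') (f + r • f') (g + r • g') ω =
      lieTerm l f g ω + r • lieTerm l' f' g' ω := by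
  have e : valueMap (l + r • l') ω = valueMap l ω + r • valueMap l' ω := rfl
  simp only [lieTerm_apply, e, derivTerm₀_add_smul hω, derivTerm₁_add_smul hω]
  module

theorem fullTerm_mem (hω : ω ∈ weakFamilies W (0 : L₀ →ₗ[𝕜] L₀ →ₗ[𝕜] L₁))
    (hb : ∀ x y, b x y = -b y x) (ht : ∀ x y z, t x y z = -t y x z)
    (ht' : ∀ x y z, t x y z = -t x z y) :
    fullTerm d l b c t ω ∈ weakFamilies W (0 : L₀ →ₗ[𝕜] L₀ →ₗ[𝕜] L₁) := by
  refine mem_of_contr (fullTerm d l b c t) (-1) (fun ω hω => ⟨fun x y r => ?_, fun a a' r => ?_,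
    fun a a' => ?_, fun x y => ?_⟩) (fun ω hω x => ⟨_, add_mem
      (lieTerm_mem hω (l x) (b x) (-c.flip x)) (pairTerm_mem hω (t x) (ht' x)), ?_⟩)
    (fun ω hω a => ⟨_, add_mem (contr₀_mem hω (d a)) (convertTerm_mem hω (c a)), ?_⟩) hω
  · simp only [contr₀_fullTerm hω, map_add, map_smul, neg_add, ← smul_neg,
      lieTerm_add_smul hω, pairTerm_add_smul hω, contr₀_add_smul hω]
    module
  · simp only [contr₁_fullTerm hω, map_add, map_smul, contr₀_add_smul hω, contr₁_add_smul hω,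
      convertTerm_add_smul hω]
    module
  · simp only [contr₁_fullTerm hω, contr₁_fullTerm (contr₁_mem hω _), map_add, contr₁_contr₀,
      contr₁_convertTerm hω, contr₁_comm hω a a']
    abel
  · have e : t x y = (0 : L₀ →ₗ[𝕜] L₁) - t y x := by
      ext z
      simpa using ht x y z
    have e' : contr₁ 𝕜 0 (fullTerm d l b c t ω) = 0 := by
      rw [contr₁_fullTerm hω]
      simp only [map_zero, contr₁_zero hω, contr₀_zero hω, convertTerm_zero hω, add_zero]
    simp only [contr₀_fullTerm hω, contr₀_fullTerm (contr₀_mem hω _), map_add, map_sub,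
      contr₀_lieTerm, contr₀_pairTerm, contr₀_anticomm_zero hω x y, map_neg,
      LinearMap.zero_apply, hb x y, contr₀_neg hω, e, e', convertTerm_sub hω, convertTerm_zero hω]
    module
  · rw [contr₀_fullTerm hω]
    module
  · rw [contr₁_fullTerm hω]

/-- The failure of `φ : L₀ → L₁` to be a crossed homomorphism for the brackets `b` and `c`. -/
def pairBracket (b : L₀ →ₗ[𝕜] L₀ →ₗ[𝕜] L₀) (c : L₁ →ₗ[𝕜] L₀ →ₗ[𝕜] L₁) (φ : L₀ →ₗ[𝕜] L₁) :
    L₀ →ₗ[𝕜] L₀ →ₗ[𝕜] L₁ :=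
  c ∘ₗ φ - (c ∘ₗ φ).flip - b.compr₂ φ

theorem pairBracket_apply (φ : L₀ →ₗ[𝕜] L₁) (x y : L₀) :
    pairBracket b c φ x y = c (φ x) y - c (φ y) x - φ (b x y) := rfl

/-- The anticommutator of the differential and `convertTerm φ`.  For `φ` a left inverse of `d` its
leading part `derivTerm₀ (d ∘ₗ φ) + derivTerm₁ (φ ∘ₗ d)` counts arguments, as the homotopy of a
Koszul complex does. -/
theorem convertTerm_fullTerm (hω : ω ∈ weakFamilies W (0 : L₀ →ₗ[𝕜] L₀ →ₗ[𝕜] L₁))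
    (hb : ∀ x y, b x y = -b y x) (ht : ∀ x y z, t x y z = -t y x z)
    (ht' : ∀ x y z, t x y z = -t x z y) (φ : L₀ →ₗ[𝕜] L₁) :
    convertTerm φ (fullTerm d l b c t ω) = derivTerm₀ (d ∘ₗ φ) ω + derivTerm₁ (φ ∘ₗ d) ω +
      pairTerm (pairBracket b c φ) ω - fullTerm d l b c t (convertTerm φ ω) := by
  refine sub_eq_zero.1 (eq_zero_of_contr 𝕜
    (S := weakFamilies W (0 : L₀ →ₗ[𝕜] L₀ →ₗ[𝕜] L₁))
    (fun ω => convertTerm φ (fullTerm d l b c t ω) - (derivTerm₀ (d ∘ₗ φ) ω +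
      derivTerm₁ (φ ∘ₗ d) ω + pairTerm (pairBracket b c φ) ω -
      fullTerm d l b c t (convertTerm φ ω)))
    (fun ω _ => ?_) (fun ω hω x => ⟨_, contr₀_mem hω x, 1, ?_⟩)
    (fun ω hω a => ⟨_, contr₁_mem hω a, 1, ?_⟩) ω hω)
  · funext
    simp [convertTerm, derivTerm₀, derivTerm₁, pairTerm, fullTerm_zero_zero]
  · have e : pairBracket b c φ x = (c (φ x) - φ ∘ₗ b x) - c.flip x ∘ₗ φ := by
      ext y
      simp only [pairBracket_apply, LinearMap.sub_apply, LinearMap.comp_apply,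
        LinearMap.flip_apply]
      abel
    simp only [map_sub, map_add, contr₀_convertTerm, contr₁_fullTerm hω, contr₀_fullTerm hω,
      contr₀_fullTerm (convertTerm_mem hω φ), contr₀_derivTerm₀, contr₀_derivTerm₁,
      contr₀_pairTerm, pairTerm_convertTerm hω, LinearMap.comp_apply, e, convertTerm_sub hω,
      lieTerm_convertTerm hω (l x) (b x) (-c.flip x) φ (-(c.flip x ∘ₗ φ) - φ ∘ₗ b x) (by simp)]
    rw [convertTerm_neg hω]
    module
  · simp only [map_sub, map_add, contr₁_convertTerm hω, contr₁_fullTerm hω,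
      contr₁_fullTerm (convertTerm_mem hω φ), contr₁_derivTerm₀, contr₁_derivTerm₁,
      contr₁_pairTerm hω, contr₀_convertTerm, LinearMap.comp_apply,
      contr₁_convertTerm (fullTerm_mem hω hb ht ht'), convertTerm_convertTerm hω φ]
    module

end Differential

end Family

/-! ### Twisting the contractions -/

namespace Family

section Twist

variable {𝕜 L₁ L₀ W W' : Type*} [Field 𝕜] [AddCommGroup L₁] [Module 𝕜 L₁]
  [AddCommGroup L₀] [Module 𝕜 L₀] [AddCommGroup W] [Module 𝕜 W] [AddCommGroup W'] [Module 𝕜 W']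
  {h h' : L₀ →ₗ[𝕜] L₀ →ₗ[𝕜] L₁} {ω : Family L₀ L₁ W}

/-- The contraction with `x`, corrected by the conversion of an argument `y` from `L₀` into
`φ(x, y)`. -/
def twistedContr (φ : L₀ →ₗ[𝕜] L₀ →ₗ[𝕜] L₁) (x : L₀) : Family L₀ L₁ W →ₗ[𝕜] Family L₀ L₁ W :=
  contr₀ 𝕜 x + convertTerm (φ x)

theorem twistedContr_apply (φ : L₀ →ₗ[𝕜] L₀ →ₗ[𝕜] L₁) (x : L₀) (ω : Family L₀ L₁ W) :
    twistedContr φ x ω = contr₀ 𝕜 x ω + convertTerm (φ x) ω := rfl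

theorem twistedContr_mem (hω : ω ∈ weakFamilies W h) (φ : L₀ →ₗ[𝕜] L₀ →ₗ[𝕜] L₁) (x : L₀) :
    twistedContr φ x ω ∈ weakFamilies W h :=
  add_mem (contr₀_mem hω x) (convertTerm_mem hω (φ x))

theorem contr₁_twistedContr (hω : ω ∈ weakFamilies W h) (a : L₁) (φ : L₀ →ₗ[𝕜] L₀ →ₗ[𝕜] L₁)
    (x : L₀) : contr₁ 𝕜 a (twistedContr φ x ω) = twistedContr φ x (contr₁ 𝕜 a ω) := by
  simp only [twistedContr_apply, map_add, contr₁_contr₀, contr₁_convertTerm hω]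

/-- Successive twisted contractions with the entries of `x`, followed by the restriction to the
components without further arguments from `L₀`. -/
def twistLevel (φ : L₀ →ₗ[𝕜] L₀ →ₗ[𝕜] L₁) : (m : ℕ) → (Fin m → L₀) →
    Family L₀ L₁ W →ₗ[𝕜] ((k : ℕ) → (Fin k → L₁) → W)
  | 0, x =>
    { toFun := fun ω k α => ω 0 k x α
      map_add' := fun _ _ => rfl
      map_smul' := fun _ _ => rfl }
  | m + 1, x => twistLevel φ m (Matrix.vecTail x) ∘ₗ twistedContr φ (Matrix.vecHead x)

/-- The operator that intertwines the contractions `contr₀` and `twistedContr φ`.  Explicitly, it is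
a signed sum over the ways to replace disjoint pairs of arguments from `L₀` by values of `φ`. -/
def twist (φ : L₀ →ₗ[𝕜] L₀ →ₗ[𝕜] L₁) : Family L₀ L₁ W →ₗ[𝕜] Family L₀ L₁ W where
  toFun ω m k x α := twistLevel φ m x ω k α
  map_add' _ _ := by funext; simp
  map_smul' _ _ := by funext; simp

theorem twist_apply_zero (φ : L₀ →ₗ[𝕜] L₀ →ₗ[𝕜] L₁) (ω : Family L₀ L₁ W) (k : ℕ) :
    twist φ ω 0 k = ω 0 k := rfl

theorem contr₀_twist (x : L₀) (φ : L₀ →ₗ[𝕜] L₀ →ₗ[𝕜] L₁) (ω : Family L₀ L₁ W) :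
    contr₀ 𝕜 x (twist φ ω) = twist φ (twistedContr φ x ω) := rfl

theorem contr₁_twist (hω : ω ∈ weakFamilies W h) (a : L₁) (φ : L₀ →ₗ[𝕜] L₀ →ₗ[𝕜] L₁) :
    contr₁ 𝕜 a (twist φ ω) = twist φ (contr₁ 𝕜 a ω) := by
  refine sub_eq_zero.1 (eq_zero_of_contr₀ 𝕜 (S := weakFamilies W h)
    (fun ω => contr₁ 𝕜 a (twist φ ω) - twist φ (contr₁ 𝕜 a ω))
    (fun ω _ k => ?_) (fun ω hω x => ⟨_, twistedContr_mem hω φ x, 1, ?_⟩) ω hω)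
  · exact sub_self _
  · simp only [map_sub, ← contr₁_contr₀, contr₀_twist, contr₁_twistedContr hω, one_smul]

theorem convertTerm_twist (hω : ω ∈ weakFamilies W h) (φ : L₀ →ₗ[𝕜] L₀ →ₗ[𝕜] L₁)
    (ψ : L₀ →ₗ[𝕜] L₁) : convertTerm ψ (twist φ ω) = twist φ (convertTerm ψ ω) := by
  refine sub_eq_zero.1 (eq_zero_of_contr₀ 𝕜 (S := weakFamilies W h)
    (fun ω => convertTerm ψ (twist φ ω) - twist φ (convertTerm ψ ω))
    (fun ω _ k => ?_) (fun ω hω x => ⟨_, twistedContr_mem hω φ x, -1, ?_⟩) ω hω)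
  · simp [twist_apply_zero, convertTerm]
  · simp only [map_sub, map_add, contr₀_convertTerm, contr₀_twist, contr₁_twist hω,
      twistedContr_apply, convertTerm_convertTerm hω (φ x)]
    simp only [map_neg]
    module

/-- Twisting by `φ` subtracts the symmetrization of `φ` from the alternator. -/
theorem twist_mem (hω : ω ∈ weakFamilies W h) (φ : L₀ →ₗ[𝕜] L₀ →ₗ[𝕜] L₁)
    (hφ : ∀ x y, h' x y = h x y - φ x y - φ y x) : twist φ ω ∈ weakFamilies W h' := by
  refine mem_weakFamilies_of_closed {θ | ∃ ω ∈ weakFamilies W h, twist φ ω = θ} ?_ ?_ ?_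
    ⟨ω, hω, rfl⟩
  · rintro _ ⟨ω, hω, rfl⟩
    refine ⟨fun x y r => ?_, fun a a' r => ?_, fun a a' => ?_, fun x y => ?_⟩
    · simp only [contr₀_twist, twistedContr_apply, contr₀_add_smul hω, map_add, map_smul,
        convertTerm_add_smul hω]
      module
    · simp only [contr₁_twist hω, contr₁_add_smul hω, map_add, map_smul]
    · simp only [contr₁_twist hω, contr₁_twist (contr₁_mem hω _), contr₁_comm hω a a']
    · simp only [contr₀_twist, twistedContr_apply, map_add, contr₀_convertTerm, hφ, map_sub,
        contr₁_twist hω, contr₁_sub hω, contr₀_anticomm hω x y,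
        convertTerm_convertTerm hω (φ x) (φ y), map_neg]
      abel
  · rintro _ ⟨ω, hω, rfl⟩ x
    exact ⟨_, twistedContr_mem hω φ x, rfl⟩
  · rintro _ ⟨ω, hω, rfl⟩ a
    exact ⟨_, contr₁_mem hω a, (contr₁_twist hω a φ).symm⟩

theorem twist_twist (hω : ω ∈ weakFamilies W h) {φ ψ : L₀ →ₗ[𝕜] L₀ →ₗ[𝕜] L₁}
    (hφ : ∀ x, ψ x = -φ x) : twist ψ (twist φ ω) = ω := by
  refine sub_eq_zero.1 (eq_zero_of_contr₀ 𝕜 (S := weakFamilies W h)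
    (fun ω => twist ψ (twist φ ω) - ω)
    (fun ω _ k => ?_) (fun ω hω x => ⟨_, contr₀_mem hω x, 1, ?_⟩) ω hω)
  · exact sub_self _
  · have e₁ : convertTerm (-φ x) (twist φ ω) = -twist φ (convertTerm (φ x) ω) := by
      rw [convertTerm_twist hω, convertTerm_neg hω, map_neg]
    simp only [map_sub, contr₀_twist, twistedContr_apply, map_add, hφ, e₁, map_neg]
    module

/-- Variant of `eq_zero_of_contr` with twisted contractions, which jointly detect zero as `twist φ`
is injective. -/
theorem eq_zero_of_twistedContr {V : Type*} [AddCommGroup V] [Module 𝕜 V]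
    (φ : L₀ →ₗ[𝕜] L₀ →ₗ[𝕜] L₁) (E : Family L₀ L₁ W → Family L₀ L₁ V)
    (hE : ∀ ω ∈ weakFamilies W h, E ω ∈ weakFamilies V h')
    (h₀₀ : ∀ ω ∈ weakFamilies W h, E ω 0 0 = 0)
    (hE₀ : ∀ ω ∈ weakFamilies W h, ∀ x, ∃ η ∈ weakFamilies W h, ∃ s : 𝕜,
      twistedContr φ x (E ω) = s • E η)
    (hE₁ : ∀ ω ∈ weakFamilies W h, ∀ a, ∃ η ∈ weakFamilies W h, ∃ s : 𝕜,
      contr₁ 𝕜 a (E ω) = s • E η) (hω : ω ∈ weakFamilies W h) : E ω = 0 := by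
  have key := eq_zero_of_contr 𝕜 (S := weakFamilies W h) (fun ω => twist φ (E ω))
    (fun ω hω => by rw [twist_apply_zero, h₀₀ ω hω])
    (fun ω hω x => by
      obtain ⟨η, hη, s, e⟩ := hE₀ ω hω x
      exact ⟨η, hη, s, by rw [contr₀_twist, e, map_smul]⟩)
    (fun ω hω a => by
      obtain ⟨η, hη, s, e⟩ := hE₁ ω hω a
      exact ⟨η, hη, s, by rw [contr₁_twist (hE ω hω), e, map_smul]⟩) ω hω
  rw [← twist_twist (hE ω hω) (φ := φ) (ψ := -φ) (fun _ => rfl), key, map_zero]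

end Twist

end Family

/-! ### The skew-symmetrized differential and the standard differential -/

namespace HemistrictLie2Algebra

section

open Family

variable {𝕜 L₁ L₀ W W' : Type*} [Field 𝕜] [CharZero 𝕜] [AddCommGroup L₁] [Module 𝕜 L₁]
  [AddCommGroup L₀] [Module 𝕜 L₀] [AddCommGroup W] [Module 𝕜 W] [AddCommGroup W'] [Module 𝕜 W']
  (L : HemistrictLie2Algebra 𝕜 L₁ L₀) {l : L₀ →ₗ[𝕜] W →ₗ[𝕜] W} {ω : Family L₀ L₁ W}

/-- The twist `-h/2`, half of the alternator: it carries alternating families to weakly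
skew-symmetric ones. -/
def halfH : L₀ →ₗ[𝕜] L₀ →ₗ[𝕜] L₁ := -(2⁻¹ : 𝕜) • L.h

theorem halfH_apply (x y : L₀) : L.halfH x y = -(2⁻¹ : 𝕜) • L.h x y := rfl

/-- The part of the generalized Chevalley–Eilenberg differential of the skew-symmetrization that
involves only the coefficients `W`. -/
def skewD (l : L₀ →ₗ[𝕜] W →ₗ[𝕜] W) : Family L₀ L₁ W →ₗ[𝕜] Family L₀ L₁ W :=
  fullTerm L.d l L.skewBr (-L.skewBrα.flip) L.skewL₃

/-- The part of the differential of the standard complex that involves only the coefficients `W`. -/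
def weakD (l : L₀ →ₗ[𝕜] W →ₗ[𝕜] W) : Family L₀ L₁ W →ₗ[𝕜] Family L₀ L₁ W :=
  baseTerm L.d l L.br L.brL

/-- The Lie derivative along the left adjoint action of `x : L₀`, a derivation of the whole
structure by the Leibniz rule. -/
def lieD (l : L₀ →ₗ[𝕜] W →ₗ[𝕜] W) (x : L₀) : Family L₀ L₁ W →ₗ[𝕜] Family L₀ L₁ W :=
  lieTerm (l x) (L.br x) (L.brR x)

theorem skewBr_antisymm (x y : L₀) : L.skewBr x y = -L.skewBr y x := by
  simp only [skewBr_apply]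
  module

theorem skewL₃_antisymm_left (x y z : L₀) : L.skewL₃ x y z = -L.skewL₃ y x z := by
  simp only [skewL₃_apply, L.skewBr_antisymm y x, L.skewBr_antisymm z y, L.skewBr_antisymm x z,
    map_neg, LinearMap.neg_apply]
  module

theorem skewL₃_antisymm_right (x y z : L₀) : L.skewL₃ x y z = -L.skewL₃ x z y := by
  simp only [skewL₃_apply, L.skewBr_antisymm y x, L.skewBr_antisymm z y, L.skewBr_antisymm x z,
    map_neg, LinearMap.neg_apply]
  module

theorem skewD_mem (hω : ω ∈ weakFamilies W (0 : L₀ →ₗ[𝕜] L₀ →ₗ[𝕜] L₁)) :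
    L.skewD l ω ∈ weakFamilies W (0 : L₀ →ₗ[𝕜] L₀ →ₗ[𝕜] L₁) :=
  fullTerm_mem hω L.skewBr_antisymm L.skewL₃_antisymm_left L.skewL₃_antisymm_right

theorem convertTerm_skewD (hω : ω ∈ weakFamilies W (0 : L₀ →ₗ[𝕜] L₀ →ₗ[𝕜] L₁))
    (φ : L₀ →ₗ[𝕜] L₁) :
    convertTerm φ (L.skewD l ω) = derivTerm₀ (L.d ∘ₗ φ) ω + derivTerm₁ (φ ∘ₗ L.d) ω +
      pairTerm (pairBracket L.skewBr (-L.skewBrα.flip) φ) ω - L.skewD l (convertTerm φ ω) :=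
  convertTerm_fullTerm hω L.skewBr_antisymm L.skewL₃_antisymm_left L.skewL₃_antisymm_right φ

theorem contr₁_skewD (hω : ω ∈ weakFamilies W (0 : L₀ →ₗ[𝕜] L₀ →ₗ[𝕜] L₁)) (a : L₁) :
    contr₁ 𝕜 a (L.skewD l ω) = contr₀ 𝕜 (L.d a) ω + convertTerm ((-L.skewBrα.flip) a) ω +
      L.skewD l (contr₁ 𝕜 a ω) :=
  contr₁_fullTerm hω a

/-- The 3-bracket `l̃₃` is exactly what is needed to cancel the defect that `-h/2` produces in
`convertTerm_skewD`. -/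
theorem skewL₃_add_pairBracket (x y z : L₀) :
    L.skewL₃ x y z + pairBracket L.skewBr (-L.skewBrα.flip) (L.halfH x) y z = 0 := by
  have r : ∀ x y z, L.h (L.br x y) z + L.h (L.br y x) z = L.brR z (L.h x y) := fun x y z => by
    rw [← LinearMap.add_apply, ← map_add, L.br_add_br, L.h_d, L.brL_h, add_zero]
  have h1 := r x z y
  have h2 := r x y z
  rw [L.brR_h, L.h_symm x] at h1 h2
  simp only [skewL₃_apply, pairBracket_apply, halfH_apply, skewBr_apply, skewBrα_apply,
    LinearMap.neg_apply, LinearMap.flip_apply, map_smul, map_sub, LinearMap.smul_apply,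
    LinearMap.sub_apply, L.brL_h, L.brR_h, L.h_symm x,
    L.h_symm y (L.br z x), L.h_symm z (L.br y x)]
  linear_combination (norm := module) (12⁻¹ : 𝕜) • h1 - (12⁻¹ : 𝕜) • h2

/-- Cartan formula: with the contraction twisted by `-h/2`, the anticommutator with the differential
of the skew-symmetrization is the Lie derivative along the (non-skew) bracket of `L`; the 3-bracket
disappears. -/
theorem twistedContr_skewD (hω : ω ∈ weakFamilies W (0 : L₀ →ₗ[𝕜] L₀ →ₗ[𝕜] L₁)) (x : L₀) :
    twistedContr L.halfH x (L.skewD l ω) =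
      L.lieD l x ω - L.skewD l (twistedContr L.halfH x ω) := by
  have e₀ : L.br x = L.skewBr x + (-1 : 𝕜) • L.d ∘ₗ L.halfH x := by
    ext y
    simp only [LinearMap.add_apply, LinearMap.smul_apply, LinearMap.comp_apply, skewBr_apply,
      halfH_apply, map_smul, ← L.br_add_br]
    module
  have e₁ : L.brR x = -(-L.skewBrα.flip).flip x + (-1 : 𝕜) • L.halfH x ∘ₗ L.d := by
    ext a
    simp only [LinearMap.add_apply, LinearMap.smul_apply, LinearMap.comp_apply, skewBrα_apply,
      halfH_apply, ← L.brR_add_brL, LinearMap.neg_apply, LinearMap.flip_apply]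
    module
  have e₂ : pairTerm (L.skewL₃ x) ω +
      pairTerm (pairBracket L.skewBr (-L.skewBrα.flip) (L.halfH x)) ω = 0 := by
    have := pairTerm_add_smul hω (L.skewL₃ x)
      (pairBracket L.skewBr (-L.skewBrα.flip) (L.halfH x)) 1
    rw [one_smul, one_smul] at this
    have e : L.skewL₃ x + pairBracket L.skewBr (-L.skewBrα.flip) (L.halfH x) = 0 := by
      ext y z
      exact L.skewL₃_add_pairBracket x y z
    rw [← this, e, pairTerm_zero hω]
  rw [twistedContr_apply, twistedContr_apply, convertTerm_skewD L hω, skewD, contr₀_fullTerm hω,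
    lieD, lieTerm_apply, lieTerm_apply, e₀, e₁, derivTerm₀_add_smul hω, derivTerm₁_add_smul hω,
    map_add]
  linear_combination (norm := module) e₂

theorem lieD_twistedContr (hω : ω ∈ weakFamilies W (0 : L₀ →ₗ[𝕜] L₀ →ₗ[𝕜] L₁)) (x y : L₀) :
    twistedContr L.halfH y (L.lieD l x ω) =
      L.lieD l x (twistedContr L.halfH y ω) - twistedContr L.halfH (L.br x y) ω := by
  have e := lieTerm_convertTerm hω (l x) (L.br x) (L.brR x) (L.halfH y) (L.halfH (L.br x y))
    (fun z => by
      simp only [halfH_apply, map_smul, L.brR_h]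
      module)
  simp only [twistedContr_apply, lieD, map_add, contr₀_lieTerm, e]
  abel

theorem contr₁_lieD (a : L₁) (x : L₀) (ω : Family L₀ L₁ W) :
    contr₁ 𝕜 a (L.lieD l x ω) = L.lieD l x (contr₁ 𝕜 a ω) - contr₁ 𝕜 (L.brR x a) ω :=
  contr₁_lieTerm _ _ _ _ _

theorem lieD_mem (hω : ω ∈ weakFamilies W (0 : L₀ →ₗ[𝕜] L₀ →ₗ[𝕜] L₁)) (x : L₀) :
    L.lieD l x ω ∈ weakFamilies W (0 : L₀ →ₗ[𝕜] L₀ →ₗ[𝕜] L₁) :=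
  lieTerm_mem hω _ _ _

/-- The commutator `contr₁ a ∘ D - D ∘ contr₁ a` for the differential `D = skewD`. -/
def contrDefect (a : L₁) : Family L₀ L₁ W →ₗ[𝕜] Family L₀ L₁ W :=
  contr₀ 𝕜 (L.d a) + convertTerm ((-L.skewBrα.flip) a)

theorem contrDefect_apply (a : L₁) (ω : Family L₀ L₁ W) : L.contrDefect a ω =
    contr₀ 𝕜 (L.d a) ω + convertTerm ((-L.skewBrα.flip) a) ω := rfl

theorem lieD_contrDefect (hω : ω ∈ weakFamilies W (0 : L₀ →ₗ[𝕜] L₀ →ₗ[𝕜] L₁)) (x : L₀) (a : L₁) :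
    L.lieD l x (L.contrDefect a ω) = L.contrDefect a (L.lieD l x ω) +
      L.contrDefect (L.brR x a) ω := by
  have e := lieTerm_convertTerm hω (l x) (L.br x) (L.brR x) ((-L.skewBrα.flip) a)
    ((-L.skewBrα.flip) (L.brR x a)) (fun z => by
      simp only [skewBrα_apply, LinearMap.neg_apply, LinearMap.flip_apply, map_smul, map_sub,
        map_neg]
      linear_combination (norm := module) -(2⁻¹ : 𝕜) • L.leibniz_mid x a z +
        (2⁻¹ : 𝕜) • L.leibniz_right x z a)
  simp only [contrDefect_apply, lieD, map_add, contr₀_lieTerm, e, L.d_brR]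
  abel

/-- The defect `[contr₁ a, D]` anticommutes with `D`, by the axioms of the semistrict Lie 2-algebra
`L̃` that involve an argument from `L₁`. -/
theorem contrDefect_skewD (hl : ∀ a, l (L.d a) = 0)
    (hω : ω ∈ weakFamilies W (0 : L₀ →ₗ[𝕜] L₀ →ₗ[𝕜] L₁)) (a : L₁) :
    L.contrDefect a (L.skewD l ω) = -L.skewD l (L.contrDefect a ω) := by
  have e₀ : L.d ∘ₗ (-L.skewBrα.flip) a = L.skewBr (L.d a) := by
    ext y
    have := L.skew.d_brα y a
    change L.d (L.skewBrα y a) = L.skewBr y (L.d a) at this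
    rw [L.skewBr_antisymm, ← this]
    simp
  have e₁ : -(-L.skewBrα.flip).flip (L.d a) + (-1 : 𝕜) • (-L.skewBrα.flip) a ∘ₗ L.d = 0 := by
    ext b
    have := L.skew.brα_d a b
    change L.skewBrα (L.d a) b = -L.skewBrα (L.d b) a at this
    simp [this]
  have e₂ : L.skewL₃ (L.d a) + pairBracket L.skewBr (-L.skewBrα.flip) ((-L.skewBrα.flip) a) =
      0 := by
    ext y z
    have := L.skew.l₃_d y z a
    change L.skewL₃ y z (L.d a) = L.skewBrα y (L.skewBrα z a) - L.skewBrα z (L.skewBrα y a) -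
      L.skewBrα (L.skewBr y z) a at this
    rw [LinearMap.add_apply, LinearMap.add_apply, L.skewL₃_antisymm_left,
      L.skewL₃_antisymm_right, neg_neg, this]
    simp only [pairBracket_apply, LinearMap.neg_apply, LinearMap.flip_apply, map_neg,
      LinearMap.zero_apply]
    abel
  have f₁ := derivTerm₁_add_smul hω (-(-L.skewBrα.flip).flip (L.d a))
    ((-L.skewBrα.flip) a ∘ₗ L.d) (-1 : 𝕜)
  have f₂ := pairTerm_add_smul hω (L.skewL₃ (L.d a))
    (pairBracket L.skewBr (-L.skewBrα.flip) ((-L.skewBrα.flip) a)) 1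
  rw [e₁, derivTerm₁_zero hω] at f₁
  rw [one_smul, e₂, pairTerm_zero hω] at f₂
  have f₃ : valueMap (0 : W →ₗ[𝕜] W) ω = 0 := rfl
  rw [contrDefect_apply, contrDefect_apply, convertTerm_skewD L hω, skewD, contr₀_fullTerm hω,
    lieTerm_apply, e₀, map_add, hl, f₃]
  linear_combination (norm := module) f₁ - f₂

theorem lieD_skewD (hl : ∀ x y v, l x (l y v) - l y (l x v) = l (L.br x y) v)
    (hω : ω ∈ weakFamilies W (0 : L₀ →ₗ[𝕜] L₀ →ₗ[𝕜] L₁)) (x : L₀) :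
    L.lieD l x (L.skewD l ω) = L.skewD l (L.lieD l x ω) := by
  refine sub_eq_zero.1 (eq_zero_of_twistedContr L.halfH
    (fun ω => L.lieD l x (L.skewD l ω) - L.skewD l (L.lieD l x ω))
    (fun ω hω => sub_mem (L.lieD_mem (L.skewD_mem hω) x) (L.skewD_mem (L.lieD_mem hω x)))
    (fun ω hω => ?_) (fun ω hω y => ⟨_, twistedContr_mem hω L.halfH y, -1, ?_⟩)
    (fun ω hω a => ⟨_, contr₁_mem hω a, 1, ?_⟩) hω)
  · funext y α
    simp [lieD, lieTerm_zero_zero, skewD, fullTerm_zero_zero]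
  · have e := lieTerm_lieTerm hω (l := l x) (l' := l y) (l'' := l (L.br x y)) (f := L.br x)
      (f' := L.br y) (f'' := L.br (L.br x y)) (g := L.brR x) (g' := L.brR y)
      (g'' := L.brR (L.br x y)) (fun v => (hl x y v).symm)
      (fun z => by rw [L.leibniz x y z]; abel) (fun a => by rw [L.leibniz_right x y a]; abel)
    change L.lieD l x (L.lieD l y ω) - L.lieD l y (L.lieD l x ω) = L.lieD l (L.br x y) ω at e
    simp only [map_sub, L.lieD_twistedContr (L.skewD_mem hω), L.twistedContr_skewD hω,
      L.twistedContr_skewD (L.lieD_mem hω x), L.lieD_twistedContr hω]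
    linear_combination (norm := module) e
  · simp only [map_sub, map_add, L.contr₁_lieD, L.contr₁_skewD hω,
      L.contr₁_skewD (L.lieD_mem hω x), ← contrDefect_apply, L.lieD_contrDefect hω]
    module

theorem skewD_skewD (hd : ∀ a, l (L.d a) = 0)
    (hl : ∀ x y v, l x (l y v) - l y (l x v) = l (L.br x y) v)
    (hω : ω ∈ weakFamilies W (0 : L₀ →ₗ[𝕜] L₀ →ₗ[𝕜] L₁)) :
    L.skewD l (L.skewD l ω) = 0 := by
  refine eq_zero_of_twistedContr L.halfH (fun ω => L.skewD l (L.skewD l ω))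
    (fun ω hω => L.skewD_mem (L.skewD_mem hω))
    (fun ω hω => fullTerm_zero_zero _) (fun ω hω y => ⟨_, twistedContr_mem hω L.halfH y, 1, ?_⟩)
    (fun ω hω a => ⟨_, contr₁_mem hω a, 1, ?_⟩) hω
  · simp only [L.twistedContr_skewD (L.skewD_mem hω), L.twistedContr_skewD hω, map_sub,
      L.lieD_skewD hl hω]
    module
  · simp only [L.contr₁_skewD (L.skewD_mem hω), L.contr₁_skewD hω, map_add,
      ← contrDefect_apply, L.contrDefect_skewD hd hω]
    module

theorem twist_halfH_mem (hω : ω ∈ weakFamilies W (0 : L₀ →ₗ[𝕜] L₀ →ₗ[𝕜] L₁)) :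
    twist L.halfH ω ∈ weakFamilies W L.h :=
  twist_mem hω _ fun x y => by
    rw [halfH_apply, halfH_apply, L.h_symm y x]
    simp only [LinearMap.zero_apply]
    module

theorem twist_neg_halfH_mem (hω : ω ∈ weakFamilies W L.h) :
    twist (-L.halfH) ω ∈ weakFamilies W (0 : L₀ →ₗ[𝕜] L₀ →ₗ[𝕜] L₁) :=
  twist_mem hω _ fun x y => by
    simp only [LinearMap.neg_apply, halfH_apply, L.h_symm y x, LinearMap.zero_apply]
    module

theorem lieD_twist (hω : ω ∈ weakFamilies W (0 : L₀ →ₗ[𝕜] L₀ →ₗ[𝕜] L₁)) (x : L₀) :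
    L.lieD l x (twist L.halfH ω) = twist L.halfH (L.lieD l x ω) := by
  refine sub_eq_zero.1 (eq_zero_of_contr 𝕜
    (S := weakFamilies W (0 : L₀ →ₗ[𝕜] L₀ →ₗ[𝕜] L₁))
    (fun ω => L.lieD l x (twist L.halfH ω) - twist L.halfH (L.lieD l x ω))
    (fun ω hω => ?_) (fun ω hω y => ⟨_, twistedContr_mem hω L.halfH y, 1, ?_⟩)
    (fun ω hω a => ⟨_, contr₁_mem hω a, 1, ?_⟩) ω hω)
  · funext y α
    simp [lieD, lieTerm_zero_zero, twist_apply_zero]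
  · simp only [map_sub, contr₀_twist, L.lieD_twistedContr hω]
    rw [lieD, contr₀_lieTerm, contr₀_twist, contr₀_twist]
    module
  · simp only [map_sub, L.contr₁_lieD, contr₁_twist hω, contr₁_twist (L.lieD_mem hω x)]
    module

/-- The twist by `-h/2` intertwines the differential of the skew-symmetrization with the standard
differential: both satisfy the same Cartan formula, with contractions twisted on one side. -/
theorem weakD_twist (hω : ω ∈ weakFamilies W (0 : L₀ →ₗ[𝕜] L₀ →ₗ[𝕜] L₁)) :
    L.weakD l (twist L.halfH ω) = twist L.halfH (L.skewD l ω) := by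
  refine sub_eq_zero.1 (eq_zero_of_contr 𝕜
    (S := weakFamilies W (0 : L₀ →ₗ[𝕜] L₀ →ₗ[𝕜] L₁))
    (fun ω => L.weakD l (twist L.halfH ω) - twist L.halfH (L.skewD l ω))
    (fun ω hω => ?_) (fun ω hω y => ⟨_, twistedContr_mem hω L.halfH y, -1, ?_⟩)
    (fun ω hω a => ⟨_, contr₁_mem hω a, 1, ?_⟩) ω hω)
  · simp [weakD, baseTerm_zero_zero, twist_apply_zero, skewD, fullTerm_zero_zero]
  · have e : contr₀ 𝕜 y (L.weakD l (twist L.halfH ω)) = L.lieD l y (twist L.halfH ω) -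
        L.weakD l (contr₀ 𝕜 y (twist L.halfH ω)) :=
      contr₀_baseTerm (L.twist_halfH_mem hω) y fun a => by rw [← L.brR_add_brL]; abel
    simp only [map_sub, e, contr₀_twist, L.twistedContr_skewD hω, L.lieD_twist hω]
    module
  · have e : convertTerm (L.brL a) ω =
        convertTerm ((-L.skewBrα.flip) a) ω - convertTerm (L.halfH (L.d a)) ω := by
      rw [← convertTerm_sub hω]
      congr 2
      ext w
      simp only [LinearMap.sub_apply, LinearMap.neg_apply, LinearMap.flip_apply, skewBrα_apply,
        halfH_apply, L.h_d]
      module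
    simp only [map_sub, weakD, contr₁_baseTerm, contr₁_twist hω, contr₁_twist (L.skewD_mem hω),
      contr₀_twist, twistedContr_apply, convertTerm_twist hω, L.contr₁_skewD hω, map_add,
      e, map_sub]
    module

end

end HemistrictLie2Algebra

/-! ### Comparison with multilinear maps -/

namespace Family

section Comparison

variable {𝕜 L₁ L₀ W W' : Type*} [Field 𝕜] [AddCommGroup L₁] [Module 𝕜 L₁]
  [AddCommGroup L₀] [Module 𝕜 L₀] [AddCommGroup W] [Module 𝕜 W] [AddCommGroup W'] [Module 𝕜 W']
  {h h' : L₀ →ₗ[𝕜] L₀ →ₗ[𝕜] L₁} {ω : Family L₀ L₁ W}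

theorem vecCons_comp_swap_zero {X : Type*} {m : ℕ} (a b : X) (x : Fin m → X) :
    Matrix.vecCons a (Matrix.vecCons b x) ∘ Equiv.swap (0 : Fin (m + 1)).castSucc
      (0 : Fin (m + 1)).succ = Matrix.vecCons b (Matrix.vecCons a x) := by
  funext i
  refine Fin.cases ?_ (fun i => Fin.cases ?_ (fun i => ?_) i) i
  · simp
  · simp
  · rw [Function.comp_apply, Equiv.swap_apply_of_ne_of_ne]
    · rfl
    · exact Fin.succ_ne_zero _
    · simp [Fin.ext_iff]

theorem vecCons_comp_swap_succ {X : Type*} {n : ℕ} (i : Fin n) (a : X) (x : Fin (n + 1) → X) :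
    Matrix.vecCons a x ∘ Equiv.swap i.succ.castSucc i.succ.succ =
      Matrix.vecCons a (x ∘ Equiv.swap i.castSucc i.succ) := by
  funext j
  rw [← Fin.succ_castSucc]
  refine Fin.cases ?_ (fun j => ?_) j
  · rw [Function.comp_apply, Equiv.swap_apply_of_ne_of_ne]
    · rfl
    · exact (Fin.succ_ne_zero _).symm
    · exact (Fin.succ_ne_zero _).symm
  · rw [Function.comp_apply, (Fin.succ_injective _).swap_apply]
    rfl

/-- All components are multilinear, and symmetric in the arguments from `L₁`. -/
def IsMultilinearSymm (𝕜 : Type*) [Field 𝕜] [Module 𝕜 L₁] [Module 𝕜 L₀] [Module 𝕜 W]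
    (ω : Family L₀ L₁ W) : Prop :=
  (∀ m k : ℕ, ∃ F : MultilinearMap 𝕜 (fun _ : Fin m => L₀)
    (MultilinearMap 𝕜 (fun _ : Fin k => L₁) W), ∀ x α, ω m k x α = F x α) ∧
  (∀ (m k : ℕ) (σ : Equiv.Perm (Fin k)) x α, ω m k x (α ∘ σ) = ω m k x α)

namespace IsMultilinearSymm

theorem contr₀ (hω : IsMultilinearSymm 𝕜 ω) (x : L₀) :
    IsMultilinearSymm 𝕜 (contr₀ 𝕜 x ω) := by
  refine ⟨fun m k => ?_, fun m k σ y α => hω.2 _ _ _ _ _⟩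
  obtain ⟨F, hF⟩ := hω.1 (m + 1) k
  exact ⟨F.curryLeft x, fun y α => hF _ _⟩

theorem contr₁ (hω : IsMultilinearSymm 𝕜 ω) (a : L₁) :
    IsMultilinearSymm 𝕜 (contr₁ 𝕜 a ω) := by
  refine ⟨fun m k => ?_, fun m k σ y α => ?_⟩
  · obtain ⟨F, hF⟩ := hω.1 m (k + 1)
    let ev : MultilinearMap 𝕜 (fun _ : Fin (k + 1) => L₁) W →ₗ[𝕜]
        MultilinearMap 𝕜 (fun _ : Fin k => L₁) W :=
      { toFun := fun G => G.curryLeft a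
        map_add' := fun _ _ => rfl
        map_smul' := fun _ _ => rfl }
    exact ⟨ev.compMultilinearMap F, fun y α => hF _ _⟩
  · have e : Matrix.vecCons a (α ∘ σ) =
        Matrix.vecCons a α ∘ Equiv.Perm.decomposeFin.symm (0, σ) := by
      funext i
      refine Fin.cases ?_ (fun i => ?_) i
      · simp
      · simp
    rw [contr₁_apply, contr₁_apply, e, hω.2]

theorem contr₀_add_smul (hω : IsMultilinearSymm 𝕜 ω) (x y : L₀) (c : 𝕜) :
    Family.contr₀ 𝕜 (x + c • y) ω = Family.contr₀ 𝕜 x ω + c • Family.contr₀ 𝕜 y ω := by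
  funext m k z α
  obtain ⟨F, hF⟩ := hω.1 (m + 1) k
  simp only [contr₀_apply, Pi.add_apply, Pi.smul_apply, hF, Matrix.vecCons]
  rw [F.cons_add, F.cons_smul]
  rfl

theorem contr₁_add_smul (hω : IsMultilinearSymm 𝕜 ω) (x y : L₁) (c : 𝕜) :
    Family.contr₁ 𝕜 (x + c • y) ω = Family.contr₁ 𝕜 x ω + c • Family.contr₁ 𝕜 y ω := by
  funext m k z α
  obtain ⟨F, hF⟩ := hω.1 m (k + 1)
  simp only [contr₁_apply, Pi.add_apply, Pi.smul_apply, hF, Matrix.vecCons]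
  rw [(F z).cons_add, (F z).cons_smul]

theorem contr₁_comm (hω : IsMultilinearSymm 𝕜 ω) (a b : L₁) :
    Family.contr₁ 𝕜 a (Family.contr₁ 𝕜 b ω) = Family.contr₁ 𝕜 b (Family.contr₁ 𝕜 a ω) := by
  funext m k z α
  rw [contr₁_apply, contr₁_apply, contr₁_apply, contr₁_apply, ← vecCons_comp_swap_zero, hω.2]

end IsMultilinearSymm

theorem mem_weakFamilies_of_swap (hω : IsMultilinearSymm 𝕜 ω)
    (hw : ∀ (m k : ℕ) (i : Fin (m + 1)) (x : Fin (m + 2) → L₀) (α : Fin k → L₁),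
      ω (m + 2) k x α + ω (m + 2) k (x ∘ Equiv.swap i.castSucc i.succ) α =
        - ω m (k + 1) (i.removeNth (i.castSucc.removeNth x))
            (Matrix.vecCons (h (x i.castSucc) (x i.succ)) α)) :
    ω ∈ weakFamilies W h := by
  refine mem_weakFamilies_of_closed {ω | IsMultilinearSymm 𝕜 ω ∧
    ∀ (m k : ℕ) (i : Fin (m + 1)) (x : Fin (m + 2) → L₀) (α : Fin k → L₁),
      ω (m + 2) k x α + ω (m + 2) k (x ∘ Equiv.swap i.castSucc i.succ) α =
        - ω m (k + 1) (i.removeNth (i.castSucc.removeNth x))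
            (Matrix.vecCons (h (x i.castSucc) (x i.succ)) α)} ?_ ?_ ?_ ⟨hω, hw⟩
  · rintro ω ⟨hω, hw⟩
    refine ⟨hω.contr₀_add_smul, hω.contr₁_add_smul, hω.contr₁_comm, fun x y => ?_⟩
    funext m k z α
    have := hw m k 0 (Matrix.vecCons x (Matrix.vecCons y z)) α
    rw [vecCons_comp_swap_zero] at this
    change ω (m + 2) k (Matrix.vecCons y (Matrix.vecCons x z)) α =
      -ω (m + 2) k (Matrix.vecCons x (Matrix.vecCons y z)) α -
        ω m (k + 1) z (Matrix.vecCons (h x y) α)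
    change _ = -ω m (k + 1) z (Matrix.vecCons (h x y) α) at this
    rw [sub_eq_add_neg, ← this]
    abel
  · rintro ω ⟨hω, hw⟩ x
    refine ⟨hω.contr₀ x, fun m k i z α => ?_⟩
    have := hw (m + 1) k i.succ (Matrix.vecCons x z) α
    rw [vecCons_comp_swap_succ, ← Fin.succ_castSucc, removeNth_succ_vecCons,
      removeNth_succ_vecCons] at this
    exact this
  · rintro ω ⟨hω, hw⟩ a
    refine ⟨hω.contr₁ a, fun m k i z α => ?_⟩
    have := hw m (k + 1) i z (Matrix.vecCons a α)
    rw [← vecCons_comp_swap_zero, hω.2] at this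
    exact this

theorem mem_weakFamilies_of_alternating (hω : IsMultilinearSymm 𝕜 ω)
    (ha : ∀ (m k : ℕ) (x : Fin m → L₀) (α : Fin k → L₁) (i j : Fin m),
      i ≠ j → x i = x j → ω m k x α = 0) :
    ω ∈ weakFamilies W (0 : L₀ →ₗ[𝕜] L₀ →ₗ[𝕜] L₁) := by
  refine mem_weakFamilies_of_closed {ω | IsMultilinearSymm 𝕜 ω ∧
    ∀ (m k : ℕ) (x : Fin m → L₀) (α : Fin k → L₁) (i j : Fin m),
      i ≠ j → x i = x j → ω m k x α = 0} ?_ ?_ ?_ ⟨hω, ha⟩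
  · rintro ω ⟨hω, ha⟩
    refine ⟨hω.contr₀_add_smul, hω.contr₁_add_smul, hω.contr₁_comm, fun x y => ?_⟩
    have h0 : ∀ x, contr₀ 𝕜 x (contr₀ 𝕜 x ω) = 0 := fun x => by
      funext m k z α
      exact ha _ _ _ _ 0 1 (by simp) rfl
    have h1 := h0 (x + (1 : 𝕜) • y)
    rw [hω.contr₀_add_smul, map_add, map_smul, (hω.contr₀ x).contr₀_add_smul,
      (hω.contr₀ y).contr₀_add_smul, h0, h0] at h1
    have h2 : contr₁ 𝕜 (0 : L₁) ω = 0 := by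
      have := hω.contr₁_add_smul 0 0 (-1)
      simpa using this
    rw [LinearMap.zero_apply, LinearMap.zero_apply, h2]
    linear_combination (norm := module) h1
  · rintro ω ⟨hω, ha⟩ x
    exact ⟨hω.contr₀ x, fun m k z α i j hij e => ha _ _ _ _ i.succ j.succ (by simpa using hij) e⟩
  · rintro ω ⟨hω, ha⟩ a
    exact ⟨hω.contr₁ a, fun m k z α i j hij e => ha _ _ _ _ i j hij e⟩

/-- Relations in the leading arguments spread to all positions by contraction; here linearity. -/
theorem map_update₀_add_smul {m : ℕ} (hω : ω ∈ weakFamilies W h) (k : ℕ) (z : Fin m → L₀)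
    (α : Fin k → L₁) (i : Fin m) (x y : L₀) (c : 𝕜) :
    ω m k (Function.update z i (x + c • y)) α =
      ω m k (Function.update z i x) α + c • ω m k (Function.update z i y) α := by
  induction m generalizing ω with
  | zero => exact i.elim0
  | succ m ih =>
    rw [← Matrix.cons_head_tail z]
    refine Fin.cases ?_ (fun i => ?_) i
    · simp only [update_vecCons_zero, ← contr₀_apply (𝕜 := 𝕜), contr₀_add_smul hω]
      rfl
    · simp only [update_vecCons_succ, ← contr₀_apply (𝕜 := 𝕜), ih (contr₀_mem hω _)]

theorem map_update₁_add_smul {k : ℕ} (hω : ω ∈ weakFamilies W h) (m : ℕ) (z : Fin m → L₀)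
    (α : Fin k → L₁) (i : Fin k) (x y : L₁) (c : 𝕜) :
    ω m k z (Function.update α i (x + c • y)) =
      ω m k z (Function.update α i x) + c • ω m k z (Function.update α i y) := by
  induction k generalizing ω with
  | zero => exact i.elim0
  | succ m ih =>
    rw [← Matrix.cons_head_tail α]
    refine Fin.cases ?_ (fun i => ?_) i
    · simp only [update_vecCons_zero, ← contr₁_apply (𝕜 := 𝕜), contr₁_add_smul hω]
      rfl
    · simp only [update_vecCons_succ, ← contr₁_apply (𝕜 := 𝕜), ih (contr₁_mem hω _)]

theorem map_comp_swap₁ {k : ℕ} (hω : ω ∈ weakFamilies W h) (m : ℕ) (z : Fin m → L₀)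
    (α : Fin (k + 1) → L₁) (i : Fin k) :
    ω m (k + 1) z (α ∘ Equiv.swap i.castSucc i.succ) = ω m (k + 1) z α := by
  induction k generalizing ω with
  | zero => exact i.elim0
  | succ k ih =>
    rw [← Matrix.cons_head_tail α]
    refine Fin.cases ?_ (fun i => ?_) i
    · rw [← Matrix.cons_head_tail (Matrix.vecTail α), vecCons_comp_swap_zero]
      exact congrFun (congrFun (congrFun (congrFun (contr₁_comm hω _ _) m) k) z) _
    · rw [vecCons_comp_swap_succ]
      exact ih (contr₁_mem hω _) _ _

theorem map_add_map_comp_swap₀ {m : ℕ} (hω : ω ∈ weakFamilies W h) (k : ℕ) (z : Fin (m + 2) → L₀)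
    (α : Fin k → L₁) (i : Fin (m + 1)) :
    ω (m + 2) k z α + ω (m + 2) k (z ∘ Equiv.swap i.castSucc i.succ) α =
        - ω m (k + 1) (i.removeNth (i.castSucc.removeNth z))
            (Matrix.vecCons (h (z i.castSucc) (z i.succ)) α) := by
  have h0 : ∀ ω ∈ weakFamilies W h, ∀ m (z : Fin (m + 2) → L₀),
    ω (m + 2) k z α + ω (m + 2) k (z ∘ Equiv.swap (0 : Fin (m + 1)).castSucc
        (0 : Fin (m + 1)).succ) α =
        - ω m (k + 1) ((0 : Fin (m + 1)).removeNth ((0 : Fin (m + 1)).castSucc.removeNth z))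
            (Matrix.vecCons (h (z (0 : Fin (m + 1)).castSucc) (z (0 : Fin (m + 1)).succ)) α) := by
    intro ω hω m z
    obtain ⟨x, z, rfl⟩ : ∃ x z', z = Matrix.vecCons x z' := ⟨_, _, (Matrix.cons_head_tail z).symm⟩
    obtain ⟨y, z, rfl⟩ : ∃ x z', z = Matrix.vecCons x z' := ⟨_, _, (Matrix.cons_head_tail z).symm⟩
    rw [vecCons_comp_swap_zero]
    have := congrFun (congrFun (congrFun (congrFun (contr₀_anticomm hω x y) m) k) z) α
    simp only [Pi.sub_apply, Pi.neg_apply, contr₀_apply, contr₁_apply] at this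
    rw [this, ← add_sub_assoc, add_neg_cancel, zero_sub]
    rfl
  induction m generalizing ω with
  | zero =>
    obtain rfl : i = 0 := Fin.fin_one_eq_zero i
    exact h0 ω hω 0 z
  | succ m ih =>
    revert z
    refine Fin.cases (h0 ω hω _) (fun i z => ?_) i
    obtain ⟨x, z, rfl⟩ : ∃ x z', z = Matrix.vecCons x z' := ⟨_, _, (Matrix.cons_head_tail z).symm⟩
    rw [vecCons_comp_swap_succ, ← Fin.succ_castSucc, removeNth_succ_vecCons,
      removeNth_succ_vecCons]
    exact ih (contr₀_mem hω x) _ _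

theorem isMultilinearSymm_of_mem (hω : ω ∈ weakFamilies W h) : IsMultilinearSymm 𝕜 ω := by
  have z₀ : ∀ m k (z : Fin m → L₀) (α : Fin k → L₁) i, ω m k (Function.update z i 0) α = 0 :=
    fun m k z α i => by simpa using map_update₀_add_smul hω k z α i 0 0 1
  have z₁ : ∀ m k (z : Fin m → L₀) (α : Fin k → L₁) i, ω m k z (Function.update α i 0) = 0 :=
    fun m k z α i => by simpa using map_update₁_add_smul hω m z α i 0 0 1
  refine ⟨fun m k => ⟨MultilinearMap.mk' (fun z => MultilinearMap.mk' (fun α => ω m k z α) ?_ ?_)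
    ?_ ?_, fun _ _ => rfl⟩, fun m k σ z α => ?_⟩
  · intro α i x y
    simpa using map_update₁_add_smul hω m z α i x y 1
  · intro α i c x
    simpa [z₁] using map_update₁_add_smul hω m z α i 0 x c
  · intro z i x y
    ext α
    simpa using map_update₀_add_smul hω k z α i x y 1
  · intro z i c x
    ext α
    simpa [z₀] using map_update₀_add_smul hω k z α i 0 x c
  · rcases k with _ | k
    · rw [Subsingleton.elim (α ∘ σ) α]
    have hσ : σ ∈ Submonoid.closure (Set.range fun i : Fin k => Equiv.swap i.castSucc i.succ) := by
      rw [Equiv.Perm.mclosure_swap_castSucc_succ]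
      trivial
    induction hσ using Submonoid.closure_induction generalizing α with
    | mem σ hσ =>
      obtain ⟨i, rfl⟩ := hσ
      exact map_comp_swap₁ hω m z α i
    | one => rfl
    | mul σ τ _ _ h1 h2 =>
      rw [Equiv.Perm.coe_mul, ← Function.comp_assoc, h2, h1]

/-- Skew-symmetric families are alternating; this needs `2 ≠ 0`. -/
theorem map_eq_zero_of_eq [CharZero 𝕜]
    (hω : ω ∈ weakFamilies W (0 : L₀ →ₗ[𝕜] L₀ →ₗ[𝕜] L₁)) {m k : ℕ}
    (x : Fin m → L₀) (α : Fin k → L₁) (i j : Fin m) (hij : i ≠ j) (e : x i = x j) :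
    ω m k x α = 0 := by
  rcases m with _ | _ | m
  · exact i.elim0
  · exact absurd ((Fin.fin_one_eq_zero i).trans (Fin.fin_one_eq_zero j).symm) hij
  have h1 : ∀ (i : Fin (m + 1)) (x : Fin (m + 2) → L₀),
      ω (m + 2) k (x ∘ Equiv.swap i.castSucc i.succ) α = -ω (m + 2) k x α := fun i x => by
    have := map_add_map_comp_swap₀ hω k x α i
    have e : ∀ y, ω m (k + 1) y (Matrix.vecCons 0 α) = 0 := fun y =>
      congrFun (congrFun (congrFun (congrFun (contr₁_zero hω) m) k) y) α
    rw [LinearMap.zero_apply, LinearMap.zero_apply, e, neg_zero] at this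
    exact (neg_eq_of_add_eq_zero_right this).symm
  have h2 : ∀ (σ : Equiv.Perm (Fin (m + 2))) (x : Fin (m + 2) → L₀),
      ω (m + 2) k (x ∘ σ) α = Equiv.Perm.sign σ • ω (m + 2) k x α := fun σ x => by
    have hσ : σ ∈ Submonoid.closure
        (Set.range fun i : Fin (m + 1) => Equiv.swap i.castSucc i.succ) := by
      rw [Equiv.Perm.mclosure_swap_castSucc_succ]
      trivial
    induction hσ using Submonoid.closure_induction generalizing x with
    | mem σ hσ =>
      obtain ⟨i, rfl⟩ := hσ
      simp only [h1, Equiv.Perm.sign_swap i.castSucc_lt_succ.ne, Units.neg_smul, one_smul]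
    | one => simp
    | mul σ τ _ _ h1 h2 =>
      rw [Equiv.Perm.coe_mul, ← Function.comp_assoc, h2, h1, smul_smul, Equiv.Perm.sign_mul,
        mul_comm]
  have h3 := h2 (Equiv.swap i j) x
  have h4 : x ∘ Equiv.swap i j = x := by
    funext r
    rcases eq_or_ne r i with rfl | hi
    · simp [e]
    rcases eq_or_ne r j with rfl | hj
    · simp [e]
    simp [Equiv.swap_apply_of_ne_of_ne hi hj]
  rw [h4, Equiv.Perm.sign_swap hij, Units.neg_smul, one_smul] at h3
  have h5 : (2 : 𝕜) • ω (m + 2) k x α = 0 := by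
    rw [two_smul]
    nth_rewrite 1 [h3]
    exact neg_add_cancel _
  exact (smul_eq_zero.1 h5).resolve_left two_ne_zero

/-! ### Homogeneous families -/

variable (L₁ L₀ W) in
/-- The families of weight `w`: components with `m + 2k ≠ w` vanish. -/
def weightFamilies (𝕜 : Type*) [Field 𝕜] [Module 𝕜 W] (w : ℤ) :
    Submodule 𝕜 (Family L₀ L₁ W) where
  carrier := {ω | ∀ m k : ℕ, (m : ℤ) + 2 * k ≠ w → ω m k = 0}
  zero_mem' _ _ _ := rfl
  add_mem' ha hb m k e := by simp [ha m k e, hb m k e]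
  smul_mem' c a ha m k e := by simp [ha m k e]

theorem convertTerm_mem_weight {w w' : ℤ} (hω : ω ∈ weightFamilies L₁ L₀ W 𝕜 w)
    (hw : w' + 1 = w) (φ : L₀ →ₗ[𝕜] L₁) :
    convertTerm φ ω ∈ weightFamilies L₁ L₀ W 𝕜 w' := by
  intro m k e
  rcases m with _ | m
  · rfl
  · funext x α
    simp [convertTerm, hω m (k + 1) (by push_cast at *; omega)]

theorem contr₀_mem_weight {w w' : ℤ} (hω : ω ∈ weightFamilies L₁ L₀ W 𝕜 w)
    (hw : w' + 1 = w) (x : L₀) : contr₀ 𝕜 x ω ∈ weightFamilies L₁ L₀ W 𝕜 w' := by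
  intro m k e
  funext z α
  rw [contr₀_apply, hω (m + 1) k (by push_cast at *; omega)]
  rfl

theorem insertTerm_mem_weight {w w' : ℤ} (hω : ω ∈ weightFamilies L₁ L₀ W 𝕜 w)
    (hw : w + 1 = w') (d : L₁ →ₗ[𝕜] L₀) : insertTerm d ω ∈ weightFamilies L₁ L₀ W 𝕜 w' := by
  intro m k e
  rcases k with _ | k
  · rfl
  · funext x α
    simp [insertTerm, hω (m + 1) k (by push_cast at *; omega)]

theorem baseTerm_mem_weight {w w' : ℤ} (hω : ω ∈ weightFamilies L₁ L₀ W 𝕜 w)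
    (hw : w + 1 = w') (d : L₁ →ₗ[𝕜] L₀) (l : L₀ →ₗ[𝕜] W →ₗ[𝕜] W) (b : L₀ →ₗ[𝕜] L₀ →ₗ[𝕜] L₀)
    (c : L₁ →ₗ[𝕜] L₀ →ₗ[𝕜] L₁) : baseTerm d l b c ω ∈ weightFamilies L₁ L₀ W 𝕜 w' := by
  refine add_mem (add_mem (add_mem (insertTerm_mem_weight hω hw d) ?_) ?_) ?_
  all_goals
    intro m k e
    rcases m with _ | m
    · rfl
    · funext x α
      simp [actionTerm, bracketTerm, mixedBracketTerm, hω m k (by push_cast at *; omega)]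

theorem fullTerm_mem_weight {w w' : ℤ} (hω : ω ∈ weightFamilies L₁ L₀ W 𝕜 w)
    (hw : w + 1 = w') (d : L₁ →ₗ[𝕜] L₀) (l : L₀ →ₗ[𝕜] W →ₗ[𝕜] W) (b : L₀ →ₗ[𝕜] L₀ →ₗ[𝕜] L₀)
    (c : L₁ →ₗ[𝕜] L₀ →ₗ[𝕜] L₁) (t : L₀ →ₗ[𝕜] L₀ →ₗ[𝕜] L₀ →ₗ[𝕜] L₁) :
    fullTerm d l b c t ω ∈ weightFamilies L₁ L₀ W 𝕜 w' := by
  refine add_mem (baseTerm_mem_weight hω hw d l b c) ?_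
  intro m k e
  rcases m with _ | _ | _ | m
  iterate 3 rfl
  funext x α
  simp [tripleBracketTerm, hω m (k + 1) (by push_cast at *; omega)]

theorem twist_mem_weight {w : ℤ} (hω : ω ∈ weightFamilies L₁ L₀ W 𝕜 w)
    (φ : L₀ →ₗ[𝕜] L₀ →ₗ[𝕜] L₁) : twist φ ω ∈ weightFamilies L₁ L₀ W 𝕜 w := by
  intro m
  induction m generalizing ω w with
  | zero => exact fun k e => hω 0 k e
  | succ m ih =>
    intro k e
    funext x α
    rw [← Matrix.cons_head_tail x]
    change contr₀ 𝕜 (Matrix.vecHead x) (twist φ ω) m k (Matrix.vecTail x) α = 0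
    rw [contr₀_twist, twistedContr_apply, ih (w := w - 1) (add_mem
        (contr₀_mem_weight hω (by ring) _) (convertTerm_mem_weight hω (by ring) _)) k
          (by push_cast at *; omega)]
    rfl

end Comparison

end Family

namespace HemistrictLie2Algebra

variable {𝕜 L₁ L₀ W : Type*} [Field 𝕜] [AddCommGroup L₁] [Module 𝕜 L₁]
  [AddCommGroup L₀] [Module 𝕜 L₀] [AddCommGroup W] [Module 𝕜 W]

open Family

theorem cochains_eq (L : HemistrictLie2Algebra 𝕜 L₁ L₀) (w : ℤ) :
    L.cochains W w = weakFamilies W L.h ⊓ weightFamilies L₁ L₀ W 𝕜 w := by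
  ext ω
  constructor
  · rintro ⟨⟨h1, h2, h3⟩, h4⟩
    exact ⟨mem_weakFamilies_of_swap ⟨h2, h3⟩ h4, h1⟩
  · rintro ⟨h1, h2⟩
    have h3 := isMultilinearSymm_of_mem h1
    exact ⟨⟨h2, h3.1, h3.2⟩, fun m k i x α => map_add_map_comp_swap₀ h1 k x α i⟩

end HemistrictLie2Algebra

namespace SemistrictLie2Algebra

variable {𝕜 L₁ L₀ W : Type*} [Field 𝕜] [CharZero 𝕜] [AddCommGroup L₁] [Module 𝕜 L₁]
  [AddCommGroup L₀] [Module 𝕜 L₀] [AddCommGroup W] [Module 𝕜 W]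

open Family

theorem cochains_eq (L : SemistrictLie2Algebra 𝕜 L₁ L₀) (w : ℤ) :
    L.cochains W w =
      weakFamilies W (0 : L₀ →ₗ[𝕜] L₀ →ₗ[𝕜] L₁) ⊓ weightFamilies L₁ L₀ W 𝕜 w := by
  ext ω
  constructor
  · rintro ⟨⟨h1, h2, h3⟩, h4⟩
    exact ⟨mem_weakFamilies_of_alternating ⟨h2, h3⟩ h4, h1⟩
  · rintro ⟨h1, h2⟩
    have h3 := isMultilinearSymm_of_mem h1
    exact ⟨⟨h2, h3.1, h3.2⟩, fun m k x α i j hij e => map_eq_zero_of_eq h1 x α i j hij e⟩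

end SemistrictLie2Algebra

/-! ### Filtration by the number of arguments of degree `-1` -/

namespace Family

section Level

variable {𝕜 L₁ L₀ W W' : Type*} [Field 𝕜] [AddCommGroup L₁] [Module 𝕜 L₁]
  [AddCommGroup L₀] [Module 𝕜 L₀] [AddCommGroup W] [Module 𝕜 W] [AddCommGroup W'] [Module 𝕜 W']
  {h : L₀ →ₗ[𝕜] L₀ →ₗ[𝕜] L₁} {ω : Family L₀ L₁ W}

variable (L₁ L₀ W) in
/-- The families with fewer than `K` arguments from `L₁`: components with `k ≥ K` vanish. -/
def levelFamilies (𝕜 : Type*) [Field 𝕜] [Module 𝕜 W] (K : ℕ) :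
    Submodule 𝕜 (Family L₀ L₁ W) where
  carrier := {ω | ∀ m k : ℕ, K ≤ k → ω m k = 0}
  zero_mem' _ _ _ := rfl
  add_mem' ha hb m k e := by simp [ha m k e, hb m k e]
  smul_mem' c a ha m k e := by simp [ha m k e]

theorem levelFamilies_mono {K K' : ℕ} (hK : K ≤ K') :
    levelFamilies L₁ L₀ W 𝕜 K ≤ levelFamilies L₁ L₀ W 𝕜 K' :=
  fun _ hω m k hk => hω m k (hK.trans hk)

theorem convertTerm_mem_level {K : ℕ} (hω : ω ∈ levelFamilies L₁ L₀ W 𝕜 (K + 1))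
    (φ : L₀ →ₗ[𝕜] L₁) : convertTerm φ ω ∈ levelFamilies L₁ L₀ W 𝕜 K := by
  intro m k hk
  rcases m with _ | m
  · rfl
  · funext x α
    simp [convertTerm, hω m (k + 1) (by omega)]

theorem pairTerm_mem_level {K : ℕ} (hω : ω ∈ levelFamilies L₁ L₀ W 𝕜 (K + 1))
    (ψ : L₀ →ₗ[𝕜] L₀ →ₗ[𝕜] L₁) : pairTerm ψ ω ∈ levelFamilies L₁ L₀ W 𝕜 K := by
  intro m k hk
  rcases m with _ | _ | m
  iterate 2 rfl
  funext x α
  simp [pairTerm, hω m (k + 1) (by omega)]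

theorem fullTerm_mem_level {K : ℕ} (hω : ω ∈ levelFamilies L₁ L₀ W 𝕜 K)
    (d : L₁ →ₗ[𝕜] L₀) (l : L₀ →ₗ[𝕜] W →ₗ[𝕜] W) (b : L₀ →ₗ[𝕜] L₀ →ₗ[𝕜] L₀)
    (c : L₁ →ₗ[𝕜] L₀ →ₗ[𝕜] L₁) (t : L₀ →ₗ[𝕜] L₀ →ₗ[𝕜] L₀ →ₗ[𝕜] L₁) :
    fullTerm d l b c t ω ∈ levelFamilies L₁ L₀ W 𝕜 (K + 1) := by
  refine add_mem (add_mem (add_mem (add_mem ?_ ?_) ?_) ?_) ?_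
  · intro m k hk
    rcases k with _ | k
    · rfl
    · funext x α
      simp [insertTerm, hω (m + 1) k (by omega)]
  iterate 3
    intro m k hk
    rcases m with _ | m
    · rfl
    · funext x α
      simp [actionTerm, bracketTerm, mixedBracketTerm, hω m k (by omega)]
  · intro m k hk
    rcases m with _ | _ | _ | m
    iterate 3 rfl
    funext x α
    simp [tripleBracketTerm, hω m (k + 1) (by omega)]

/-! ### The differential of the coefficients -/

theorem contr₀_coefficientTerm (x : L₀) (g : W →ₗ[𝕜] W') (ω : Family L₀ L₁ W) :
    contr₀ 𝕜 x (coefficientTerm g ω) = -coefficientTerm g (contr₀ 𝕜 x ω) := by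
  funext m k y α
  simp [contr₀_apply, coefficientTerm, pow_succ]

theorem contr₁_coefficientTerm (a : L₁) (g : W →ₗ[𝕜] W') (ω : Family L₀ L₁ W) :
    contr₁ 𝕜 a (coefficientTerm g ω) = coefficientTerm g (contr₁ 𝕜 a ω) := rfl

theorem coefficientTerm_mem (hω : ω ∈ weakFamilies W h) (g : W →ₗ[𝕜] W') :
    coefficientTerm g ω ∈ weakFamilies W' h := by
  refine mem_of_contr (coefficientTerm g) (-1) (fun ω hω => ⟨fun x y c => ?_, fun a b c => ?_,
    fun a b => ?_, fun x y => ?_⟩) (fun ω hω x => ⟨0, zero_mem _, ?_⟩)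
    (fun ω hω a => ⟨0, zero_mem _, ?_⟩) hω
  · simp only [contr₀_coefficientTerm, map_add, map_smul, contr₀_add_smul hω]
    module
  · simp only [contr₁_coefficientTerm, map_add, map_smul, contr₁_add_smul hω]
  · simp only [contr₁_coefficientTerm, contr₁_comm hω a b]
  · simp only [contr₀_coefficientTerm, contr₁_coefficientTerm, contr₀_anticomm hω x y, map_sub,
      map_neg]
    module
  · rw [contr₀_coefficientTerm, neg_one_smul, zero_add]
  · rw [contr₁_coefficientTerm, zero_add]

theorem coefficientTerm_mem_weight {w : ℤ} (hω : ω ∈ weightFamilies L₁ L₀ W 𝕜 w)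
    (g : W →ₗ[𝕜] W') : coefficientTerm g ω ∈ weightFamilies L₁ L₀ W' 𝕜 w := by
  intro m k e
  funext x α
  simp [coefficientTerm, hω m k e]

theorem coefficientTerm_mem_level {K : ℕ} (hω : ω ∈ levelFamilies L₁ L₀ W 𝕜 K)
    (g : W →ₗ[𝕜] W') : coefficientTerm g ω ∈ levelFamilies L₁ L₀ W' 𝕜 K := by
  intro m k e
  funext x α
  simp [coefficientTerm, hω m k e]

theorem convertTerm_coefficientTerm (φ : L₀ →ₗ[𝕜] L₁) (g : W →ₗ[𝕜] W') (ω : Family L₀ L₁ W) :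
    convertTerm φ (coefficientTerm g ω) = -coefficientTerm g (convertTerm φ ω) := by
  funext m k x α
  rcases m with _ | m
  · simp [convertTerm, coefficientTerm]
  · simp only [convertTerm, coefficientTerm, LinearMap.coe_mk, AddHom.coe_mk, map_sum, map_smul,
      Finset.smul_sum, Pi.neg_apply, ← Finset.sum_neg_distrib, smul_smul, ← neg_smul]
    exact Finset.sum_congr rfl fun i _ => by congr 1; ring

theorem twist_coefficientTerm (φ : L₀ →ₗ[𝕜] L₀ →ₗ[𝕜] L₁) (g : W →ₗ[𝕜] W')
    (ω : Family L₀ L₁ W) : twist φ (coefficientTerm g ω) = coefficientTerm g (twist φ ω) := by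
  refine sub_eq_zero.1 (eq_zero_of_contr₀ 𝕜 (S := Set.univ)
    (fun ω => twist φ (coefficientTerm g ω) - coefficientTerm g (twist φ ω))
    (fun ω _ k => ?_) (fun ω hω x => ⟨twistedContr φ x ω, trivial, -1, ?_⟩) ω trivial)
  · exact sub_self _
  · simp only [map_sub, contr₀_twist, contr₀_coefficientTerm, twistedContr_apply,
      convertTerm_coefficientTerm, map_add, map_neg]
    module

theorem fullTerm_coefficientTerm {d : L₁ →ₗ[𝕜] L₀} {l : L₀ →ₗ[𝕜] W →ₗ[𝕜] W}
    {l' : L₀ →ₗ[𝕜] W' →ₗ[𝕜] W'} {b : L₀ →ₗ[𝕜] L₀ →ₗ[𝕜] L₀} {c : L₁ →ₗ[𝕜] L₀ →ₗ[𝕜] L₁}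
    {t : L₀ →ₗ[𝕜] L₀ →ₗ[𝕜] L₀ →ₗ[𝕜] L₁} {g : W →ₗ[𝕜] W'} (hg : ∀ x v, g (l x v) = l' x (g v))
    (ω : Family L₀ L₁ W) :
    fullTerm d l' b c t (coefficientTerm g ω) = -coefficientTerm g (fullTerm d l b c t ω) := by
  have e₁ : insertTerm d (coefficientTerm g ω) = -coefficientTerm g (insertTerm d ω) := by
    funext m k x α
    rcases k with _ | k
    · simp [insertTerm, coefficientTerm]
    · simp [insertTerm, coefficientTerm, pow_succ, Finset.smul_sum]
  have e₂ : actionTerm l' (coefficientTerm g ω) = -coefficientTerm g (actionTerm l ω) := by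
    funext m k x α
    rcases m with _ | m
    · simp [actionTerm, coefficientTerm]
    · simp only [actionTerm, coefficientTerm, LinearMap.coe_mk, AddHom.coe_mk, map_sum, map_smul,
        Finset.smul_sum, Pi.neg_apply, ← Finset.sum_neg_distrib, smul_smul, ← neg_smul, hg]
      exact Finset.sum_congr rfl fun i _ => by congr 1; ring
  have e₃ : bracketTerm b (coefficientTerm g ω) = -coefficientTerm g (bracketTerm b ω) := by
    funext m k x α
    rcases m with _ | m
    · simp [bracketTerm, coefficientTerm]
    · simp only [bracketTerm, coefficientTerm, LinearMap.coe_mk, AddHom.coe_mk, map_sum, map_smul,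
        Finset.smul_sum, Pi.neg_apply, ← Finset.sum_neg_distrib, smul_smul, ← neg_smul]
      exact Finset.sum_congr rfl fun i _ => Finset.sum_congr rfl fun j _ => by congr 1; ring
  have e₄ : mixedBracketTerm c (coefficientTerm g ω) =
      -coefficientTerm g (mixedBracketTerm c ω) := by
    funext m k x α
    rcases m with _ | m
    · simp [mixedBracketTerm, coefficientTerm]
    · simp only [mixedBracketTerm, coefficientTerm, LinearMap.coe_mk, AddHom.coe_mk, map_sum,
        map_smul, Finset.smul_sum, Pi.neg_apply, ← Finset.sum_neg_distrib, smul_smul, ← neg_smul]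
      exact Finset.sum_congr rfl fun i _ => Finset.sum_congr rfl fun j _ => by congr 1; ring
  have e₅ : tripleBracketTerm t (coefficientTerm g ω) =
      -coefficientTerm g (tripleBracketTerm t ω) := by
    funext m k x α
    rcases m with _ | _ | _ | m
    iterate 3 simp [tripleBracketTerm, coefficientTerm]
    simp only [tripleBracketTerm, coefficientTerm, LinearMap.coe_mk, AddHom.coe_mk, map_sum,
      Finset.smul_sum, Pi.neg_apply, ← Finset.sum_neg_distrib]
    refine Finset.sum_congr rfl fun i _ => Finset.sum_congr rfl fun j _ =>
      Finset.sum_congr rfl fun r _ => ?_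
    split_ifs
    · rw [map_smul, smul_smul, smul_smul, ← neg_smul]
      congr 1
      ring
    · simp
  simp only [fullTerm_apply, map_add, e₁, e₂, e₃, e₄, e₅]
  abel

end Level

end Family

/-! ### Removing the arguments of degree `-1` -/

namespace HemistrictLie2Algebra

section

open Family

variable {𝕜 L₁ L₀ W : Type*} [Field 𝕜] [CharZero 𝕜] [AddCommGroup L₁] [Module 𝕜 L₁]
  [AddCommGroup L₀] [Module 𝕜 L₀] [AddCommGroup W] [Module 𝕜 W]
  (L : HemistrictLie2Algebra 𝕜 L₁ L₀) {l : L₀ →ₗ[𝕜] W →ₗ[𝕜] W} {ω : Family L₀ L₁ W}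

/-- If `d` is injective and `K > 0`, the component with `K` arguments from `L₁` can be removed from
a cochain with at most `K` such arguments by a coboundary, as soon as the differential of the
cochain has no component with `K + 1` of them. -/
theorem exists_sub_skewD_mem_level (hL : Function.Injective L.d) (hd : ∀ a, l (L.d a) = 0)
    (hl : ∀ x y v, l x (l y v) - l y (l x v) = l (L.br x y) v) {K : ℕ} (hK : 0 < K) {w w' : ℤ}
    (hw : w' + 1 = w) (hω : ω ∈ weakFamilies W (0 : L₀ →ₗ[𝕜] L₀ →ₗ[𝕜] L₁))
    (hωw : ω ∈ weightFamilies L₁ L₀ W 𝕜 w) (hωK : ω ∈ levelFamilies L₁ L₀ W 𝕜 (K + 1))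
    (hDω : L.skewD l ω ∈ levelFamilies L₁ L₀ W 𝕜 (K + 1)) :
    ∃ η ∈ weakFamilies W (0 : L₀ →ₗ[𝕜] L₀ →ₗ[𝕜] L₁), η ∈ weightFamilies L₁ L₀ W 𝕜 w' ∧
      η ∈ levelFamilies L₁ L₀ W 𝕜 K ∧ ω - L.skewD l η ∈ levelFamilies L₁ L₀ W 𝕜 K := by
  obtain ⟨π, hπ⟩ := L.d.exists_leftInverse_of_injective (LinearMap.ker_eq_bot.2 hL)
  have hπd : ∀ a, π (L.d a) = a := fun a => LinearMap.congr_fun hπ a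
  -- Descending induction on the number `q` such that the top component vanishes whenever `q` of its
  -- arguments from `L₀` lie in the image of `d`.
  suffices key : ∀ q : ℕ, ∀ ω ∈ weakFamilies W (0 : L₀ →ₗ[𝕜] L₀ →ₗ[𝕜] L₁),
      ω ∈ weightFamilies L₁ L₀ W 𝕜 w → ω ∈ levelFamilies L₁ L₀ W 𝕜 (K + 1) →
      L.skewD l ω ∈ levelFamilies L₁ L₀ W 𝕜 (K + 1) →
      (∀ (m : ℕ) (x : Fin m → L₀) (α : Fin K → L₁) (S : Finset (Fin m)), S.card = q →
        (∀ i ∈ S, x i ∈ LinearMap.range L.d) → ω m K x α = 0) →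
      ∃ η ∈ weakFamilies W (0 : L₀ →ₗ[𝕜] L₀ →ₗ[𝕜] L₁), η ∈ weightFamilies L₁ L₀ W 𝕜 w' ∧
        η ∈ levelFamilies L₁ L₀ W 𝕜 K ∧ ω - L.skewD l η ∈ levelFamilies L₁ L₀ W 𝕜 K by
    refine key (w.toNat + 1) ω hω hωw hωK hDω fun m x α S hS _ => ?_
    have := S.card_le_univ
    rw [Fintype.card_fin] at this
    rw [hωw m K (by omega)]
    rfl
  intro q
  induction q with
  | zero =>
    intro ω hω hωw hωK hDω hZ
    refine ⟨0, zero_mem _, zero_mem _, zero_mem _, ?_⟩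
    rw [map_zero, sub_zero]
    intro m k hk
    rcases hk.eq_or_lt with rfl | hk
    · funext x α
      exact hZ m x α ∅ rfl (by simp)
    · exact hωK m k hk
  | succ q ih =>
    intro ω hω hωw hωK hDω hZ
    have hs : ((K : 𝕜) + q) ≠ 0 := by
      have : ((K + q : ℕ) : 𝕜) ≠ 0 := Nat.cast_ne_zero.2 (by omega)
      exact_mod_cast this
    -- On arguments of which `q` lie in `d L₁`, the anticommutator of the differential with
    -- `convertTerm π` multiplies the top component by `K + q`: the remaining arguments contribute
    -- terms with `q + 1` arguments in `d L₁`, which vanish.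
    set η := ((K : 𝕜) + q)⁻¹ • convertTerm π ω with hη
    have hη₁ : η ∈ weakFamilies W (0 : L₀ →ₗ[𝕜] L₀ →ₗ[𝕜] L₁) :=
      Submodule.smul_mem _ _ (convertTerm_mem hω π)
    have hη₂ : η ∈ weightFamilies L₁ L₀ W 𝕜 w' :=
      Submodule.smul_mem _ _ (convertTerm_mem_weight hωw hw π)
    have hη₃ : η ∈ levelFamilies L₁ L₀ W 𝕜 K :=
      Submodule.smul_mem _ _ (convertTerm_mem_level hωK π)
    obtain ⟨θ, hθ₁, hθ₂, hθ₃, hθ⟩ := ih (ω - L.skewD l η) (sub_mem hω (L.skewD_mem hη₁))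
      (sub_mem hωw (fullTerm_mem_weight hη₂ hw _ _ _ _ _))
      (sub_mem hωK (fullTerm_mem_level hη₃ _ _ _ _ _))
      (by rwa [map_sub, L.skewD_skewD hd hl hη₁, sub_zero]) (fun m x α S hS hx => by
        have e := congrFun (congrFun (congrFun (congrFun (L.convertTerm_skewD (l := l) hω π)
          m) K) x) α
        have e₁ := congrFun (congrFun (convertTerm_mem_level hDω π m K le_rfl) x) α
        have e₂ := congrFun (congrFun (pairTerm_mem_level hωK
          (pairBracket L.skewBr (-L.skewBrα.flip) π) m K le_rfl) x) α
        have e₃ : derivTerm₁ (π ∘ₗ L.d) ω m K x α = (K : 𝕜) • ω m K x α := by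
          simp [derivTerm₁, hπd, Nat.cast_smul_eq_nsmul]
        have e₄ : derivTerm₀ (L.d ∘ₗ π) ω m K x α = (q : 𝕜) • ω m K x α := by
          have : ∀ i, ω m K (Function.update x i ((L.d ∘ₗ π) (x i))) α =
              if i ∈ S then ω m K x α else 0 := fun i => by
            split_ifs with hi
            · obtain ⟨a, ha⟩ := hx i hi
              rw [← ha, LinearMap.comp_apply, hπd, ha, Function.update_eq_self]
            · refine hZ m _ α (insert i S) (by rw [Finset.card_insert_of_notMem hi, hS])
                fun j hj => ?_
              rcases eq_or_ne j i with rfl | hji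
              · rw [Function.update_self]
                exact ⟨_, rfl⟩
              · rw [Function.update_of_ne hji]
                exact hx j ((Finset.mem_insert.1 hj).resolve_left hji)
          change ∑ i, ω m K (Function.update x i ((L.d ∘ₗ π) (x i))) α = _
          rw [Finset.sum_congr rfl fun i _ => this i]
          simp [hS, Nat.cast_smul_eq_nsmul]
        simp only [Pi.add_apply, Pi.sub_apply, e₁, e₂, e₃, e₄] at e
        simp only [hη, map_smul, Pi.sub_apply, Pi.smul_apply]
        have e₅ : L.skewD l (convertTerm π ω) m K x α = ((K : 𝕜) + q) • ω m K x α := by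
          change (0 : W) = _ at e
          rw [add_smul, add_comm]
          simpa using (sub_eq_zero.1 e.symm).symm
        rw [e₅, inv_smul_smul₀ hs, sub_self])
    refine ⟨η + θ, add_mem hη₁ hθ₁, add_mem hη₂ hθ₂, add_mem hη₃ hθ₃, ?_⟩
    rwa [map_add, ← sub_sub]

end

end HemistrictLie2Algebra

/-! ### Families pulled back from a quotient -/

namespace Family

section Pullback

variable {𝕜 L₁ L₀ 𝔤 W W' : Type*} [Field 𝕜] [AddCommGroup L₁] [Module 𝕜 L₁]
  [AddCommGroup L₀] [Module 𝕜 L₀] [AddCommGroup 𝔤] [Module 𝕜 𝔤]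
  [AddCommGroup W] [Module 𝕜 W] [AddCommGroup W'] [Module 𝕜 W']

variable (L₁ W) in
/-- The cochain on `L₀` obtained from a cochain on `𝔤` along `q : L₀ → 𝔤`, as a family without
arguments from `L₁`. -/
def pullback (q : L₀ →ₗ[𝕜] 𝔤) : ((m : ℕ) → (Fin m → 𝔤) → W) →ₗ[𝕜] Family L₀ L₁ W where
  toFun f
    | m, 0 => fun x _ => f m (q ∘ x)
    | _, _ + 1 => 0
  map_add' a b := by
    funext m k x α
    cases k
    · rfl
    · exact (add_zero _).symm
  map_smul' c a := by
    funext m k x α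
    cases k
    · rfl
    · exact (smul_zero c).symm

theorem pullback_apply_zero (q : L₀ →ₗ[𝕜] 𝔤) (f : (m : ℕ) → (Fin m → 𝔤) → W) (m : ℕ)
    (x : Fin m → L₀) (α : Fin 0 → L₁) : pullback L₁ W q f m 0 x α = f m (q ∘ x) := rfl

theorem pullback_apply_succ (q : L₀ →ₗ[𝕜] 𝔤) (f : (m : ℕ) → (Fin m → 𝔤) → W) (m k : ℕ) :
    pullback L₁ W q f m (k + 1) = 0 := rfl

theorem pullback_injective (q : L₀ →ₗ[𝕜] 𝔤) (hq : Function.Surjective q) :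
    Function.Injective (pullback L₁ W q) := by
  intro f g e
  funext m y
  obtain ⟨x, rfl⟩ := hq.comp_left y
  exact congrFun (congrFun (congrFun (congrFun e m) 0) x) ![]

theorem pullback_mem_level (q : L₀ →ₗ[𝕜] 𝔤) (f : (m : ℕ) → (Fin m → 𝔤) → W) :
    pullback L₁ W q f ∈ levelFamilies L₁ L₀ W 𝕜 1 := by
  rintro m (_ | k) hk
  · omega
  · rfl

theorem pullback_mem_weight (q : L₀ →ₗ[𝕜] 𝔤) {f : (m : ℕ) → (Fin m → 𝔤) → W} {w : ℤ}
    (hf : ∀ m : ℕ, (m : ℤ) ≠ w → f m = 0) :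
    pullback L₁ W q f ∈ weightFamilies L₁ L₀ W 𝕜 w := by
  rintro m (_ | k) hk
  · funext x α
    rw [pullback_apply_zero, hf m (by simpa using hk)]
    rfl
  · rfl

theorem pullback_mem (q : L₀ →ₗ[𝕜] 𝔤) {f : (m : ℕ) → (Fin m → 𝔤) → W}
    (hf : ∀ m : ℕ, ∃ F : 𝔤 [⋀^Fin m]→ₗ[𝕜] W, ∀ x, f m x = F x) :
    pullback L₁ W q f ∈ weakFamilies W (0 : L₀ →ₗ[𝕜] L₀ →ₗ[𝕜] L₁) := by
  refine mem_weakFamilies_of_alternating ⟨?_, ?_⟩ ?_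
  · rintro m (_ | k)
    · obtain ⟨F, hF⟩ := hf m
      exact ⟨(MultilinearMap.constLinearEquivOfIsEmpty (R := 𝕜) (S := 𝕜)
          (M₁ := fun _ : Fin 0 => L₁) (M₂ := W)).toLinearMap.compMultilinearMap
          (F.toMultilinearMap.compLinearMap fun _ => q), fun x α => hF _⟩
    · exact ⟨0, fun _ _ => rfl⟩
  · rintro m (_ | k) σ x α <;> rfl
  · rintro m (_ | k) x α i j hij e
    · obtain ⟨F, hF⟩ := hf m
      rw [pullback_apply_zero, hF]
      exact F.map_eq_zero_of_eq _ (congrArg q e) hij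
    · rfl

theorem map_eq_of_contr₀_eq_zero {d : L₁ →ₗ[𝕜] L₀} {m k : ℕ} {ω : Family L₀ L₁ W}
    (hω : ω ∈ weakFamilies W (0 : L₀ →ₗ[𝕜] L₀ →ₗ[𝕜] L₁)) (hd : ∀ a, contr₀ 𝕜 (d a) ω = 0)
    (x y : Fin m → L₀) (α : Fin k → L₁) (hxy : ∀ i, x i - y i ∈ LinearMap.range d) :
    ω m k x α = ω m k y α := by
  induction m generalizing ω with
  | zero => rw [Subsingleton.elim x y]
  | succ m ih =>
    have e : contr₀ 𝕜 (x 0) ω = contr₀ 𝕜 (y 0) ω := by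
      obtain ⟨a, ha⟩ := hxy 0
      rw [← sub_eq_zero, ← contr₀_sub hω, ← ha, hd]
    rw [← Matrix.cons_head_tail x, ← Matrix.cons_head_tail y]
    have h1 := congrFun (congrFun (congrFun (congrFun e m) k) (Matrix.vecTail y)) α
    refine Eq.trans ?_ h1
    refine ih (contr₀_mem hω _) (fun a => ?_) _ _ fun i => hxy i.succ
    rw [contr₀_anticomm_zero hω, hd, map_zero, neg_zero]

/-- An alternating family without arguments from `L₁` that is annihilated by the contractions with
`d L₁` descends to the quotient. -/
theorem exists_pullback_eq [CharZero 𝕜] {d : L₁ →ₗ[𝕜] L₀} {q : L₀ →ₗ[𝕜] 𝔤}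
    (hq : Function.Surjective q) (hqd : LinearMap.ker q ≤ LinearMap.range d) {w : ℤ}
    {ω : Family L₀ L₁ W} (hω : ω ∈ weakFamilies W (0 : L₀ →ₗ[𝕜] L₀ →ₗ[𝕜] L₁))
    (hωw : ω ∈ weightFamilies L₁ L₀ W 𝕜 w) (hω₁ : ω ∈ levelFamilies L₁ L₀ W 𝕜 1)
    (hd : ∀ a, contr₀ 𝕜 (d a) ω = 0) :
    ∃ f : (m : ℕ) → (Fin m → 𝔤) → W, (∀ m : ℕ, (m : ℤ) ≠ w → f m = 0) ∧
      (∀ m : ℕ, ∃ F : 𝔤 [⋀^Fin m]→ₗ[𝕜] W, ∀ x, f m x = F x) ∧ pullback L₁ W q f = ω := by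
  obtain ⟨σ, hσ⟩ := q.exists_rightInverse_of_surjective (LinearMap.range_eq_top.2 hq)
  refine ⟨fun m y => ω m 0 (σ ∘ y) ![], fun m hm => ?_, fun m => ?_, ?_⟩
  · funext y
    change ω m 0 (σ ∘ y) ![] = 0
    rw [hωw m 0 (by simpa using hm)]
    rfl
  · obtain ⟨F, hF⟩ := (isMultilinearSymm_of_mem hω).1 m 0
    let ev : MultilinearMap 𝕜 (fun _ : Fin 0 => L₁) W →ₗ[𝕜] W :=
      { toFun := fun G => G ![]
        map_add' := fun _ _ => rfl
        map_smul' := fun _ _ => rfl }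
    refine ⟨{ (ev.compMultilinearMap F).compLinearMap (fun _ => σ) with
      map_eq_zero_of_eq' := fun y i j e hij => ?_ }, fun y => hF _ _⟩
    exact (hF _ _).symm.trans (map_eq_zero_of_eq hω (σ ∘ y) ![] i j hij (congrArg σ e))
  · funext m k x α
    rcases k with _ | k
    · rw [pullback_apply_zero, Subsingleton.elim α ![]]
      refine map_eq_of_contr₀_eq_zero hω hd _ _ _ fun i => hqd ?_
      rw [LinearMap.mem_ker, map_sub, sub_eq_zero]
      exact LinearMap.congr_fun hσ _
    · rw [pullback_apply_succ, hω₁ m (k + 1) (by omega)]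

end Pullback

end Family

/-! ### A criterion for isomorphic cohomology -/

section Cohomology

variable {𝕜 X Y : Type*} [Field 𝕜] [AddCommGroup X] [Module 𝕜 X] [AddCommGroup Y] [Module 𝕜 Y]

/-- A map of complexes which is surjective and injective on cohomology in degree `n` induces an
isomorphism there. -/
theorem nonempty_gradedCohomology_equiv {C : ℤ → Submodule 𝕜 X} {D : X →ₗ[𝕜] X}
    {C' : ℤ → Submodule 𝕜 Y} {D' : Y →ₗ[𝕜] Y} (p : Y →ₗ[𝕜] X) (n : ℤ)
    (hp : ∀ n, ∀ f ∈ C' n, p f ∈ C n) (hD : ∀ n, ∀ f ∈ C' n, D (p f) = p (D' f))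
    (hsurj : ∀ ω ∈ C n, D ω = 0 → ∃ f ∈ C' n, D' f = 0 ∧ ∃ η ∈ C (n - 1), ω = p f + D η)
    (hinj : ∀ f ∈ C' n, ∀ η ∈ C (n - 1), p f = D η → ∃ g ∈ C' (n - 1), D' g = f) :
    Nonempty (gradedCohomology C D n ≃ₗ[𝕜] gradedCohomology C' D' n) := by
  let P : ↥(C' n ⊓ LinearMap.ker D') →ₗ[𝕜] ↥(C n ⊓ LinearMap.ker D) :=
    p.restrict fun f hf => ⟨hp n f hf.1, LinearMap.mem_ker.2 (by
      rw [hD n f hf.1, LinearMap.mem_ker.1 hf.2, map_zero])⟩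
  let B := ((C (n - 1)).map D).comap (C n ⊓ LinearMap.ker D).subtype
  let B' := ((C' (n - 1)).map D').comap (C' n ⊓ LinearMap.ker D').subtype
  have hP : B' ≤ B.comap P := by
    rintro ⟨f, hf⟩ ⟨g, hg, e⟩
    exact ⟨p g, hp _ g hg, (hD _ g hg).trans (congrArg p e)⟩
  refine ⟨(LinearEquiv.ofBijective (B'.mapQ B P hP) ⟨?_, ?_⟩).symm⟩
  · rw [← LinearMap.ker_eq_bot, LinearMap.ker_eq_bot']
    intro f hf
    obtain ⟨⟨f, hf₁⟩, rfl⟩ := Submodule.Quotient.mk_surjective _ f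
    rw [Submodule.mapQ_apply, Submodule.Quotient.mk_eq_zero] at hf
    obtain ⟨η, hη, e⟩ := hf
    obtain ⟨g, hg, e'⟩ := hinj f hf₁.1 η hη e.symm
    rw [Submodule.Quotient.mk_eq_zero]
    exact ⟨g, hg, e'⟩
  · intro ω
    obtain ⟨⟨ω, hω⟩, rfl⟩ := Submodule.Quotient.mk_surjective _ ω
    obtain ⟨f, hf, hf', η, hη, e⟩ := hsurj ω hω.1 hω.2
    refine ⟨Submodule.Quotient.mk ⟨f, hf, hf'⟩, ?_⟩
    rw [Submodule.mapQ_apply, ← sub_eq_zero, ← Submodule.Quotient.mk_sub,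
      Submodule.Quotient.mk_eq_zero]
    refine ⟨-η, neg_mem hη, ?_⟩
    rw [map_neg]
    change -D η = p f - ω
    rw [e]
    abel

end Cohomology

/-! ### Comparison of the three complexes -/

namespace HemistrictLie2Algebra

section Comparison

open Family

attribute [local instance] LieRing.ofAssociativeRing

variable {𝕜 L₁ L₀ W : Type*} [Field 𝕜] [CharZero 𝕜] [AddCommGroup L₁] [Module 𝕜 L₁]
  [AddCommGroup L₀] [Module 𝕜 L₀] [AddCommGroup W] [Module 𝕜 W]
  (L : HemistrictLie2Algebra 𝕜 L₁ L₀) {l : L₀ →ₗ[𝕜] W →ₗ[𝕜] W}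

theorem mkQ_skewBr (x y : L₀) : (LinearMap.range L.d).mkQ (L.skewBr x y) =
    ⁅(LinearMap.range L.d).mkQ x, (LinearMap.range L.d).mkQ y⁆ := by
  have e : ⁅(LinearMap.range L.d).mkQ x, (LinearMap.range L.d).mkQ y⁆ =
      (LinearMap.range L.d).mkQ (L.br x y) := rfl
  rw [e, ← sub_eq_zero, ← map_sub, Submodule.mkQ_apply, Submodule.Quotient.mk_eq_zero]
  refine ⟨-(2⁻¹ : 𝕜) • L.h x y, ?_⟩
  rw [map_smul, ← L.br_add_br, skewBr_apply]
  module

/-- On families pulled back from `L_Lie`, only the action and the bracket contribute to the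
differential. -/
theorem skewD_pullback (ρ : L.LieQuot →ₗ⁅𝕜⁆ Module.End 𝕜 W)
    (hρ : ∀ x v, ρ ((LinearMap.range L.d).mkQ x) v = l x v)
    {f : (m : ℕ) → (Fin m → L.LieQuot) → W}
    (hf : ∀ m : ℕ, ∃ F : L.LieQuot [⋀^Fin m]→ₗ[𝕜] W, ∀ x, f m x = F x) :
    L.skewD l (pullback L₁ W (LinearMap.range L.d).mkQ f) =
      pullback L₁ W (LinearMap.range L.d).mkQ (LieCE.ceDifferential ρ f) := by
  have hd : ∀ (m : ℕ) (a : L₁) (x : Fin m → L₀) (β : Fin 0 → L₁),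
      pullback L₁ W (LinearMap.range L.d).mkQ f (m + 1) 0 (Matrix.vecCons (L.d a) x) β = 0 := by
    intro m a x β
    obtain ⟨F, hF⟩ := hf (m + 1)
    rw [pullback_apply_zero, hF]
    exact F.map_coord_zero 0 ((Submodule.Quotient.mk_eq_zero _).2 ⟨a, rfl⟩)
  funext m k x α
  rw [skewD, fullTerm_apply]
  have e₃ : tripleBracketTerm L.skewL₃ (pullback L₁ W (LinearMap.range L.d).mkQ f) = 0 := by
    funext m k x α
    rcases m with _ | _ | _ | m
    iterate 3 rfl
    simp [tripleBracketTerm, pullback_apply_succ]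
  have e₁ : insertTerm L.d (pullback L₁ W (LinearMap.range L.d).mkQ f) = 0 := by
    funext m k x α
    rcases k with _ | _ | k
    · rfl
    · simp [insertTerm, hd]
    · simp [insertTerm, pullback_apply_succ]
  have e₂ : mixedBracketTerm (-L.skewBrα.flip) (pullback L₁ W (LinearMap.range L.d).mkQ f) = 0 := by
    funext m k x α
    rcases m with _ | m
    · rfl
    · rcases k with _ | k
      · simp [mixedBracketTerm]
      · simp [mixedBracketTerm, pullback_apply_succ]
  rw [e₁, e₂, e₃, zero_add, add_zero, add_zero]
  rcases k with _ | k
  · rcases m with _ | m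
    · exact add_zero _
    · refine congrArg₂ (fun v w : W => v + w) ?_ ?_
      · simp only [actionTerm, LinearMap.coe_mk, AddHom.coe_mk]
        refine Finset.sum_congr rfl fun i _ => ?_
        rw [pullback_apply_zero, ← hρ]
        rfl
      · simp only [bracketTerm, LinearMap.coe_mk, AddHom.coe_mk]
        refine Finset.sum_congr rfl fun i _ => Finset.sum_congr rfl fun j _ => ?_
        rw [pullback_apply_zero, Function.comp_apply, Function.comp_apply, ← L.mkQ_skewBr,
          ← Function.comp_update]
        rfl
  · rcases m with _ | m
    · exact add_zero _
    · simp [actionTerm, bracketTerm, pullback_apply_succ]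

namespace Rep

variable {L} {V₁ V₀ : Type*} [AddCommGroup V₁] [Module 𝕜 V₁] [AddCommGroup V₀] [Module 𝕜 V₀]
  (V : L.Rep V₁ V₀)

theorem skew_ceD_apply (hV : ∀ α v, V.lα α v = 0) (ω : Family L₀ L₁ V₁ × Family L₀ L₁ V₀) :
    V.skew.ceD ω =
      (L.skewD V.l₁ ω.1, L.skewD V.l₀ ω.2 + coefficientTerm V.dV ω.1) := by
  refine Prod.ext ?_ rfl
  have e₁ : oddActionTerm V.lα ω.2 = 0 := by
    funext m k x α
    rcases k with _ | k
    · rfl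
    · simp [oddActionTerm, hV]
  have e₂ : pairActionTerm V.skew.μ₃ ω.2 = 0 := by
    funext m k x α
    rcases m with _ | _ | m
    iterate 2 rfl
    simp [pairActionTerm, skew]
  change L.skewD V.l₁ ω.1 + (oddActionTerm V.lα ω.2 + pairActionTerm V.skew.μ₃ ω.2) = _
  rw [e₁, e₂, add_zero, add_zero]

theorem standardD_apply (hV : ∀ α v, V.lα α v = 0) (ω : Family L₀ L₁ V₁ × Family L₀ L₁ V₀) :
    V.standardD ω =
      (L.weakD V.l₁ ω.1, L.weakD V.l₀ ω.2 + coefficientTerm V.dV ω.1) := by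
  refine Prod.ext ?_ rfl
  have e₁ : oddActionTerm V.lα ω.2 = 0 := by
    funext m k x α
    rcases k with _ | k
    · rfl
    · simp [oddActionTerm, hV]
  change L.weakD V.l₁ ω.1 + oddActionTerm V.lα ω.2 = _
  rw [e₁, add_zero]

theorem l₀_d (hV : ∀ α v, V.lα α v = 0) (a : L₁) : V.l₀ (L.d a) = 0 := by
  ext v
  rw [← V.dV_lα, hV, map_zero, LinearMap.zero_apply]

theorem l₁_d_eq_zero (hV : ∀ α v, V.lα α v = 0) (a : L₁) : V.l₁ (L.d a) = 0 := by
  ext u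
  rw [V.l₁_d, hV, LinearMap.zero_apply]

theorem mem_standardCochains {n : ℤ} {ω : Family L₀ L₁ V₁ × Family L₀ L₁ V₀} :
    ω ∈ V.standardCochains n ↔
      (ω.1 ∈ weakFamilies V₁ L.h ∧ ω.1 ∈ weightFamilies L₁ L₀ V₁ 𝕜 (n + 1)) ∧
        ω.2 ∈ weakFamilies V₀ L.h ∧ ω.2 ∈ weightFamilies L₁ L₀ V₀ 𝕜 n := by
  rw [standardCochains, Submodule.mem_prod, L.cochains_eq, L.cochains_eq]
  rfl

theorem mem_skew_ceCochains {n : ℤ} {ω : Family L₀ L₁ V₁ × Family L₀ L₁ V₀} :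
    ω ∈ V.skew.ceCochains n ↔
      (ω.1 ∈ weakFamilies V₁ (0 : L₀ →ₗ[𝕜] L₀ →ₗ[𝕜] L₁) ∧
        ω.1 ∈ weightFamilies L₁ L₀ V₁ 𝕜 (n + 1)) ∧
      ω.2 ∈ weakFamilies V₀ (0 : L₀ →ₗ[𝕜] L₀ →ₗ[𝕜] L₁) ∧
        ω.2 ∈ weightFamilies L₁ L₀ V₀ 𝕜 n := by
  rw [SemistrictLie2Algebra.Rep.ceCochains, Submodule.mem_prod,
    SemistrictLie2Algebra.cochains_eq, SemistrictLie2Algebra.cochains_eq]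
  rfl

theorem skew_ceD_mem (hV : ∀ α v, V.lα α v = 0) {n n' : ℤ} (hn : n + 1 = n')
    {ω : Family L₀ L₁ V₁ × Family L₀ L₁ V₀} (hω : ω ∈ V.skew.ceCochains n) :
    V.skew.ceD ω ∈ V.skew.ceCochains n' := by
  subst hn
  rw [mem_skew_ceCochains] at hω ⊢
  obtain ⟨⟨h₁, h₂⟩, h₃, h₄⟩ := hω
  rw [V.skew_ceD_apply hV]
  exact ⟨⟨L.skewD_mem h₁, fullTerm_mem_weight h₂ rfl _ _ _ _ _⟩,
    add_mem (L.skewD_mem h₃) (coefficientTerm_mem h₁ _),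
    add_mem (fullTerm_mem_weight h₄ rfl _ _ _ _ _) (coefficientTerm_mem_weight h₂ _)⟩

theorem skew_ceD_ceD (hV : ∀ α v, V.lα α v = 0) {n : ℤ}
    {ω : Family L₀ L₁ V₁ × Family L₀ L₁ V₀} (hω : ω ∈ V.skew.ceCochains n) :
    V.skew.ceD (V.skew.ceD ω) = 0 := by
  rw [mem_skew_ceCochains] at hω
  simp only [V.skew_ceD_apply hV, map_add, L.skewD_skewD (V.l₁_d_eq_zero hV) V.l₁_br hω.1.1,
    L.skewD_skewD (V.l₀_d hV) V.l₀_br hω.2.1]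
  refine Prod.ext rfl ?_
  change 0 + L.skewD V.l₀ (coefficientTerm V.dV ω.1) + coefficientTerm V.dV (L.skewD V.l₁ ω.1) = 0
  rw [skewD, fullTerm_coefficientTerm V.dV_l₁, zero_add]
  exact neg_add_cancel _

/-- A cochain whose differential has no arguments from `L₁` loses its own arguments from `L₁` after
subtraction of a coboundary, one level at a time. -/
theorem exists_sub_ceD_mem_level (hL : Function.Injective L.d) (hV : ∀ α v, V.lα α v = 0)
    {n : ℤ} {ω : Family L₀ L₁ V₁ × Family L₀ L₁ V₀} (hω : ω ∈ V.skew.ceCochains n)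
    (hD : V.skew.ceD ω ∈ (levelFamilies L₁ L₀ V₁ 𝕜 1).prod (levelFamilies L₁ L₀ V₀ 𝕜 1)) (K : ℕ)
    (hK : ω ∈ (levelFamilies L₁ L₀ V₁ 𝕜 (K + 1)).prod (levelFamilies L₁ L₀ V₀ 𝕜 (K + 1))) :
    ∃ η ∈ V.skew.ceCochains (n - 1), ω - V.skew.ceD η ∈
      (levelFamilies L₁ L₀ V₁ 𝕜 1).prod (levelFamilies L₁ L₀ V₀ 𝕜 1) := by
  induction K generalizing ω with
  | zero => exact ⟨0, zero_mem _, by simpa using hK⟩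
  | succ K ih =>
    have h := (V.mem_skew_ceCochains).1 hω
    have hD' := hD
    rw [V.skew_ceD_apply hV] at hD'
    obtain ⟨η₁, hη₁, hη₁w, hη₁K, h₁⟩ := L.exists_sub_skewD_mem_level hL (V.l₁_d_eq_zero hV) V.l₁_br
      K.succ_pos (w' := n) rfl h.1.1 h.1.2 hK.1 (levelFamilies_mono (by omega) hD'.1)
    obtain ⟨η₀, hη₀, hη₀w, hη₀K, h₀⟩ := L.exists_sub_skewD_mem_level hL (V.l₀_d hV) V.l₀_br
      K.succ_pos (w' := n - 1) (by ring) h.2.1 h.2.2 hK.2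
      ((Submodule.add_mem_iff_left _ (coefficientTerm_mem_level hK.1 V.dV)).1
        (levelFamilies_mono (by omega) hD'.2))
    have hη : (η₁, η₀) ∈ V.skew.ceCochains (n - 1) :=
      V.mem_skew_ceCochains.2 ⟨⟨hη₁, by simpa using hη₁w⟩, hη₀, hη₀w⟩
    obtain ⟨ζ, hζ, e⟩ := ih (ω := ω - V.skew.ceD (η₁, η₀))
      (sub_mem hω (V.skew_ceD_mem hV (by ring) hη))
      (by rwa [map_sub, V.skew_ceD_ceD hV hη, sub_zero])
      (by
        rw [V.skew_ceD_apply hV]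
        refine ⟨h₁, ?_⟩
        change ω.2 - (L.skewD V.l₀ η₀ + coefficientTerm V.dV η₁) ∈ _
        rw [← sub_sub]
        exact sub_mem h₀ (coefficientTerm_mem_level hη₁K _))
    exact ⟨(η₁, η₀) + ζ, add_mem hη hζ, by rwa [map_add, ← sub_sub]⟩

/-- On families without arguments from `L₁`, the component of the differential with one such
argument `a` is the contraction with `d a`. -/
theorem contr₀_d_eq_zero {l : L₀ →ₗ[𝕜] W →ₗ[𝕜] W} {ω : Family L₀ L₁ W}
    (hω : ω ∈ weakFamilies W (0 : L₀ →ₗ[𝕜] L₀ →ₗ[𝕜] L₁)) (h₁ : ω ∈ levelFamilies L₁ L₀ W 𝕜 1)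
    (hD : L.skewD l ω ∈ levelFamilies L₁ L₀ W 𝕜 1) (a : L₁) : contr₀ 𝕜 (L.d a) ω = 0 := by
  have e₁ : ∀ θ ∈ levelFamilies L₁ L₀ W 𝕜 1, contr₁ 𝕜 a θ = 0 := fun θ hθ => by
    funext m k x α
    rw [contr₁_apply, hθ m (k + 1) (by omega)]
    rfl
  have e₂ : convertTerm ((-L.skewBrα.flip) a) ω = 0 := by
    funext m k
    exact convertTerm_mem_level (K := 0) h₁ _ m k k.zero_le
  have e := L.contr₁_skewD (l := l) hω a
  rw [e₁ _ hD, e₁ _ h₁, e₂, map_zero, add_zero, add_zero] at e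
  exact e.symm

variable (L V₁ V₀) in
/-- The inclusion of the Chevalley–Eilenberg complex of `L_Lie` into that of the
skew-symmetrization. -/
def pullbackMap : (((m : ℕ) → (Fin m → L.LieQuot) → V₁) × ((m : ℕ) → (Fin m → L.LieQuot) → V₀))
    →ₗ[𝕜] Family L₀ L₁ V₁ × Family L₀ L₁ V₀ :=
  (pullback L₁ V₁ (LinearMap.range L.d).mkQ).prodMap (pullback L₁ V₀ (LinearMap.range L.d).mkQ)

/-- The relative complex is acyclic: a cochain whose differential has no arguments from `L₁` is, up
to a coboundary, pulled back from `L_Lie`.  Applied to cocycles this gives surjectivity on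
cohomology, and applied to primitives of pulled back cochains injectivity. -/
theorem exists_eq_pullbackMap_add_ceD (hL : Function.Injective L.d) (hV : ∀ α v, V.lα α v = 0)
    {n : ℤ} {ω : Family L₀ L₁ V₁ × Family L₀ L₁ V₀} (hω : ω ∈ V.skew.ceCochains n)
    (hD : V.skew.ceD ω ∈ (levelFamilies L₁ L₀ V₁ 𝕜 1).prod (levelFamilies L₁ L₀ V₀ 𝕜 1)) :
    ∃ f ∈ (LieCE.cochains 𝕜 L.LieQuot V₁ (n + 1)).prod (LieCE.cochains 𝕜 L.LieQuot V₀ n),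
      ∃ η ∈ V.skew.ceCochains (n - 1), ω = pullbackMap L V₁ V₀ f + V.skew.ceD η := by
  have h := V.mem_skew_ceCochains.1 hω
  obtain ⟨η, hη, e⟩ := V.exists_sub_ceD_mem_level hL hV hω hD (n + 1).toNat
    ⟨fun m k hk => h.1.2 m k (by omega), fun m k hk => h.2.2 m k (by omega)⟩
  have h' := V.mem_skew_ceCochains.1 (sub_mem hω (V.skew_ceD_mem hV (sub_add_cancel n 1) hη))
  have hD' : V.skew.ceD (ω - V.skew.ceD η) = V.skew.ceD ω := by
    rw [map_sub, V.skew_ceD_ceD hV hη, sub_zero]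
  rw [← hD', V.skew_ceD_apply hV] at hD
  have hq : LinearMap.ker (LinearMap.range L.d).mkQ ≤ LinearMap.range L.d :=
    (Submodule.ker_mkQ _).le
  obtain ⟨f₁, hf₁, hf₁', e₁⟩ := exists_pullback_eq (Submodule.mkQ_surjective _) hq h'.1.1 h'.1.2
    e.1 (contr₀_d_eq_zero h'.1.1 e.1 hD.1)
  obtain ⟨f₀, hf₀, hf₀', e₀⟩ := exists_pullback_eq (Submodule.mkQ_surjective _) hq h'.2.1 h'.2.2
    e.2 (contr₀_d_eq_zero h'.2.1 e.2
      ((Submodule.add_mem_iff_left _ (coefficientTerm_mem_level e.1 V.dV)).1 hD.2))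
  refine ⟨(f₁, f₀), ⟨⟨hf₁, hf₁'⟩, hf₀, hf₀'⟩, η, hη, ?_⟩
  rw [← sub_eq_iff_eq_add]
  exact (Prod.ext e₁ e₀).symm

theorem ceD_pullbackMap (hV : ∀ α v, V.lα α v = 0) {n : ℤ}
    {f : ((m : ℕ) → (Fin m → L.LieQuot) → V₁) × ((m : ℕ) → (Fin m → L.LieQuot) → V₀)}
    (hf : f ∈ (LieCE.cochains 𝕜 L.LieQuot V₁ (n + 1)).prod (LieCE.cochains 𝕜 L.LieQuot V₀ n)) :
    V.skew.ceD (pullbackMap L V₁ V₀ f) = pullbackMap L V₁ V₀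
      (LieCE.totalD V.dV (V.lieRep₁ hV) (V.lieRep₀ hV) f) := by
  rw [V.skew_ceD_apply hV]
  refine Prod.ext (L.skewD_pullback (V.lieRep₁ hV) (fun _ _ => rfl) hf.1.2) ?_
  let q := (LinearMap.range L.d).mkQ
  change L.skewD V.l₀ (pullback L₁ V₀ q f.2) + coefficientTerm V.dV (pullback L₁ V₁ q f.1) =
    pullback L₁ V₀ q (LieCE.ceDifferential (V.lieRep₀ hV) f.2 +
      fun m x => (-1 : 𝕜) ^ m • V.dV (f.1 m x))
  rw [map_add, L.skewD_pullback (V.lieRep₀ hV) (fun _ _ => rfl) hf.2.2]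
  congr 1
  funext m k x α
  rcases k with _ | k
  · rfl
  · change (-1 : 𝕜) ^ m • V.dV 0 = 0
    rw [map_zero, smul_zero]

theorem pullbackMap_injective : Function.Injective (pullbackMap L V₁ V₀) :=
  (pullback_injective _ (Submodule.mkQ_surjective _)).prodMap
    (pullback_injective _ (Submodule.mkQ_surjective _))

theorem nonempty_skewCohomology_equiv (hL : Function.Injective L.d) (hV : ∀ α v, V.lα α v = 0)
    (n : ℤ) : Nonempty (V.skew.Cohomology n ≃ₗ[𝕜] V.LieCohomology hV n) := by
  refine nonempty_gradedCohomology_equiv (C := V.skew.ceCochains) (D := V.skew.ceD)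
    (C' := fun n => (LieCE.cochains 𝕜 L.LieQuot V₁ (n + 1)).prod (LieCE.cochains 𝕜 L.LieQuot V₀ n))
    (D' := LieCE.totalD V.dV (V.lieRep₁ hV) (V.lieRep₀ hV))
    (pullbackMap L V₁ V₀) n (fun n f hf => ?_)
    (fun n f hf => V.ceD_pullbackMap hV hf) (fun ω hω hDω => ?_) (fun f hf η hη e => ?_)
  · exact V.mem_skew_ceCochains.2
      ⟨⟨pullback_mem _ hf.1.2, pullback_mem_weight _ hf.1.1⟩,
        pullback_mem _ hf.2.2, pullback_mem_weight _ hf.2.1⟩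
  · obtain ⟨f, hf, η, hη, e⟩ := V.exists_eq_pullbackMap_add_ceD hL hV hω
      (by rw [hDω]; exact zero_mem _)
    refine ⟨f, hf, pullbackMap_injective ?_, η, hη, e⟩
    rw [← V.ceD_pullbackMap hV hf, map_zero, ← hDω, e, map_add, V.skew_ceD_ceD hV hη, add_zero]
  · obtain ⟨g, hg, ζ, hζ, rfl⟩ := V.exists_eq_pullbackMap_add_ceD hL hV hη
      (by rw [← e]; exact ⟨pullback_mem_level _ _, pullback_mem_level _ _⟩)
    refine ⟨g, hg, pullbackMap_injective ?_⟩
    rw [← V.ceD_pullbackMap hV hg, e, map_add, V.skew_ceD_ceD hV hζ, add_zero]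

/-- The twist by `-h/2` is an isomorphism between the complex of the skew-symmetrization and the
standard complex. -/
theorem nonempty_cohomology_equiv_skewCohomology (hV : ∀ α v, V.lα α v = 0) (n : ℤ) :
    Nonempty (V.Cohomology n ≃ₗ[𝕜] V.skew.Cohomology n) := by
  let p : (Family L₀ L₁ V₁ × Family L₀ L₁ V₀) →ₗ[𝕜] Family L₀ L₁ V₁ × Family L₀ L₁ V₀ :=
    (twist L.halfH).prodMap (twist L.halfH)
  have hp : ∀ n, ∀ f ∈ V.skew.ceCochains n, p f ∈ V.standardCochains n := fun n f hf => by
    have h := V.mem_skew_ceCochains.1 hf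
    exact V.mem_standardCochains.2
      ⟨⟨L.twist_halfH_mem h.1.1, twist_mem_weight h.1.2 _⟩, L.twist_halfH_mem h.2.1,
        twist_mem_weight h.2.2 _⟩
  have hp' : ∀ n, ∀ ω ∈ V.standardCochains n, ∃ f ∈ V.skew.ceCochains n, p f = ω :=
    fun n ω hω => by
      have h := V.mem_standardCochains.1 hω
      exact ⟨(twist (-L.halfH) ω.1, twist (-L.halfH) ω.2), V.mem_skew_ceCochains.2
        ⟨⟨L.twist_neg_halfH_mem h.1.1, twist_mem_weight h.1.2 _⟩, L.twist_neg_halfH_mem h.2.1,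
          twist_mem_weight h.2.2 _⟩,
        Prod.ext (twist_twist h.1.1 fun x => (neg_neg _).symm)
          (twist_twist h.2.1 fun x => (neg_neg _).symm)⟩
  have hinj : ∀ n, ∀ f ∈ V.skew.ceCochains n, ∀ g ∈ V.skew.ceCochains n, p f = p g → f = g :=
    fun n f hf g hg e => by
      have h := V.mem_skew_ceCochains.1 hf
      have h' := V.mem_skew_ceCochains.1 hg
      have e₁ := congrArg (fun ω => twist (-L.halfH) ω.1) e
      have e₂ := congrArg (fun ω => twist (-L.halfH) ω.2) e
      change twist _ (twist _ f.1) = twist _ (twist _ g.1) at e₁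
      change twist _ (twist _ f.2) = twist _ (twist _ g.2) at e₂
      rw [twist_twist h.1.1 fun _ => rfl, twist_twist h'.1.1 fun _ => rfl] at e₁
      rw [twist_twist h.2.1 fun _ => rfl, twist_twist h'.2.1 fun _ => rfl] at e₂
      exact Prod.ext e₁ e₂
  have hD : ∀ n, ∀ f ∈ V.skew.ceCochains n, V.standardD (p f) = p (V.skew.ceD f) :=
    fun n f hf => by
      have h := V.mem_skew_ceCochains.1 hf
      rw [V.skew_ceD_apply hV, V.standardD_apply hV]
      refine Prod.ext (L.weakD_twist h.1.1) ?_
      change L.weakD V.l₀ (twist _ f.2) + coefficientTerm V.dV (twist _ f.1) = twist _ (_ + _)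
      rw [map_add, twist_coefficientTerm, L.weakD_twist h.2.1]
  have hDm : ∀ {n n' : ℤ}, n + 1 = n' → ∀ f ∈ V.skew.ceCochains n,
      V.skew.ceD f ∈ V.skew.ceCochains n' := fun hn f hf => V.skew_ceD_mem hV hn hf
  refine nonempty_gradedCohomology_equiv p n hp hD (fun ω hω hDω => ?_) (fun f hf η hη e => ?_)
  · obtain ⟨f, hf, rfl⟩ := hp' n ω hω
    refine ⟨f, hf, hinj (n + 1) _ (hDm rfl f hf) _ (zero_mem _) ?_, 0, zero_mem _, ?_⟩
    · rw [← hD n f hf, hDω, map_zero]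
    · rw [map_zero, add_zero]
  · obtain ⟨g, hg, rfl⟩ := hp' _ η hη
    refine ⟨g, hg, hinj n _ (hDm (sub_add_cancel n 1) g hg) _ hf ?_⟩
    rw [← hD _ g hg, e]

end Rep

end Comparison

end HemistrictLie2Algebra

theorem theorem4p1 {𝕜 : Type*} [RCLike 𝕜] {L₁ L₀ V₁ V₀ : Type*}
    [AddCommGroup L₁] [Module 𝕜 L₁] [AddCommGroup L₀] [Module 𝕜 L₀]
    [AddCommGroup V₁] [Module 𝕜 V₁] [AddCommGroup V₀] [Module 𝕜 V₀]
    (L : HemistrictLie2Algebra 𝕜 L₁ L₀) (hL : Function.Injective L.d)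
    (V : L.Rep V₁ V₀) (hV : ∀ α v, V.lα α v = 0) :
    ((∀ α β, L.h (L.d α) (L.d β) = 0) →
      ∀ n : ℤ, Nonempty (V.Cohomology n ≃ₗ[𝕜] V.LieCohomology hV n)) ∧
    (∀ n : ℤ, Nonempty (V.skew.Cohomology n ≃ₗ[𝕜] V.LieCohomology hV n)) := by
  refine ⟨fun _ n => ?_, V.nonempty_skewCohomology_equiv hL hV⟩
  obtain ⟨e₁⟩ := V.nonempty_cohomology_equiv_skewCohomology hV n
  obtain ⟨e₂⟩ := V.nonempty_skewCohomology_equiv hL hV n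
  exact ⟨e₁.trans e₂⟩
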